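/- **Setting.** Let $D$ be a probability distribution on $X\times\{0,1\}$ with $X$-marginal $D_X$, and let $\mathcal C$ be a class of measurable functions $X\to[-1,1]$ closed under negation. An ERM oracle for $\mathcal C$ returns, on a finite weighted sample $(x_i,w_i)_i\in (X\times\mathbb R)^n$, some $c\in\mathcal C$ minimizing $\sum_i w_i c(x_i)$ over $\mathcal C$; its answer is assumed to depend measurably on the sample. Write $\mathrm{Th}_\theta(z)=1$ if $z\le\theta$ and $-1$ otherwise, $\mathrm{Th}=\{\mathrm{Th}_\theta:\theta\in[-1,1]\}$, $\mathrm{Th}^{1/T}=\{\mathrm{Th}_\theta:\theta\in[-1,1]\cap\frac1T\mathbb Z\}$, $[1/T]=\{0,\frac1T,\dots,1\}$, $\mathrm{conv}_k(\mathcal C)$ for the convex combinations of at most $k$ elements of $\mathcal C$, and $\mathsf{rad}_T(F)=\mathbb E_{x\sim D_X^T}\mathbb E_\sigma\sup_{f\in F}\frac1T\sum_i\sigma_i f(x_i)$. For predictors $p_1,\dots,p_T:X\to[0,1]$ and their uniform mixture $\hat p$ put $$\mathrm{PCalErr}_D(\hat p)=\sup_{\ell}\Big|\tfrac1T\sum_t\mathbb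 E_D[\Delta\ell(p_t(x))(y-p_t(x))]\Big|,\qquad \mathcal C\text{-}\mathrm{MAErr}_D(\hat p)=\sup_{c\in\mathcal C}\Big|\tfrac1T\sum_t\mathbb E_D[c(x)(y-p_t(x))]\Big|,$$ the first supremum over proper losses $\ell:[0,1]\times\{0,1\}\to[-1,1]$, with $\Delta\ell(p)=\ell(p,1)-\ell(p,0)$. **Algorithm.** Input: $2T$ i.i.d. samples from $D$, the first $T$, $(x_t,y_t)$, for the calibrator (APCAL), the last $T$, $(x'_i,y'_i)$, for the learner (DOWAL); $\delta\in(0,1)$; $k=\lceil T\ln(T/\delta)\rceil$; a map $\rho$, either the identity or $\rho(a)=\lceil aT\rceil/T$ (rounding up to the grid). In round $t=1,\dots,T$: 1. *DOWAL.* Let $z_i=\sum_{s<t}(y'_i-p_s(x'_i))$. With $\lceil16T^{3/2}\rceil$ Frank–Wolfe steps (step $n$ has size $2/(n+1)$ and asks the ERM oracle for weights $w_i=-T^{-1/2}z_i+\ln(c(x'_i)+2)+1$ at the current iterate $c$; the start is the oracle's answer to zero weights) approximately minimize $-T^{-1/2}\sum_i c(x'_i)z_i+\sum_i(c(x'_i)+2)\ln(c(x'_i)+2)$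 over the convex hull of $\mathcal C$. The result is an explicit convex combination of elements of $\mathcal C$; draw $k$ independent elements according to its weights and let $q_t$ be their average. 2. *APCAL.* There are $2T+3$ weights $w_{v,s}$ ($v\in[1/T]$, $s=\pm1$) and $w_{\mathrm{sma}}$, initially equal. Let $f(a,j)=w_{\mathrm{sma}}a+\sum_{v,s}s\,w_{v,s}\mathrm{Th}_v(j)$ and let $\zeta$ be uniform in $[0,1]$. Let $u_t(a)$ be: with $(j,\lambda)=(0,0)$ if $f(a,0)\le0$; else, for the least $j\in[1/T]$, $j<1$, with $f(a,j)f(a,j+\frac1T)\le0$, $\lambda=|f(a,j)|/(|f(a,j)|+|f(a,j+\frac1T)|)$; else $(j,\lambda)=(1,1)$; then $u_t(a)=j$ if $\lambda<\zeta$ and $u_t(a)=\min(j+\frac1T,1)$ otherwise. Put $v_t=u_t\circ\rho$ and $p_t=v_t\circ q_t$. Multiply $w_{v,s}$ by $\exp(\eta s(y_t-p_t(x_t))\mathrm{Th}_v(p_t(x_t)))$ and $w_{\mathrm{sma}}$ by $\exp(\eta(y_t-p_t(x_t))\rho(q_t(x_t)))$, where $\eta=\sqrt{\ln T/T}$, and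 normalize. The output is the uniform mixture $\hat p$ of $p_1,\dots,p_T$. **Theorem.** There is a universal constant $K>0$ such that the following holds for all $X,D,\mathcal C$, all ERM oracles for $\mathcal C$, all $T\ge2$ and $\delta\in(0,1)$, and for both choices of $\rho$. Let $\mathcal G=\mathrm{Th}$ if $\rho=\mathrm{id}$ and $\mathcal G=\mathrm{Th}^{1/T}$ if $\rho$ is rounding, and assume that the suprema of signed sums over $\mathcal G\circ\mathrm{conv}_k(\mathcal C)$ that define its Rademacher complexity (with arbitrary real coefficients, for every sample size) are measurable. * On every run, at most $K\,T^{5/2}$ oracle calls are made, and each $p_t=v_t\circ q_t$ with $v_t:[-1,1]\to[1/T]$ monotone and $q_t\in\mathrm{conv}_k(\mathcal C)$. * With probability at least $1-\delta$ over samples and internal randomness, all of the following hold, where $\varepsilon=K\big(\mathsf{rad}_T(\mathcal C)+\mathsf{rad}_T(\mathcal G\circ\mathrm{conv}_k(\mathcal C))\big)+K\sqrt{\ln(T/\delta)/T}$: 1. $\mathrm{PCalErr}_D(\hat p)\le K\sqrt{\ln(T/\delta)/T}$; 2. $\mathcal C\text{-}\mathrm{MAErr}_D(\hat p)\le\varepsilon$;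 3. if $\mathcal C=\{\pm\mathrm{Th}_\theta\circ h:\theta\in[0,1],h\in\mathcal H\}$ for a class $\mathcal H$ of functions $X\to[0,1]$, then $\hat p$ is an $(\mathcal L_{BV},\mathcal H,\varepsilon)$-omnipredictor. That is, for every measurable $\ell:[0,1]\times\{0,1\}\to[-1,1]$ such that $\Delta\ell$ has total variation at most $2$ there is $k_\ell:[0,1]\to[0,1]$ with $\mathbb E_{y\sim\mathrm{Ber}(p)}\ell(k_\ell(p),y)\le\inf_q\mathbb E_{y\sim\mathrm{Ber}(p)}\ell(q,y)+T^{-2}$ for all $p\in[0,1]$, and for every such $k_\ell$ and every $h\in\mathcal H$, $$\tfrac1T\sum_t\mathbb E_D[\ell(k_\ell(p_t(x)),y)]\le\mathbb E_D[\ell(h(x),y)]+\varepsilon.$$ -/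

import Mathlib

open MeasureTheory

noncomputable section

namespace Omni

/-! ### Labels, thresholds, function classes -/

/-- The label `y ∈ {0,1}` as a real number. -/
def lab (y : Bool) : ℝ := if y then 1 else 0

/-- The sign `±1` attached to a Boolean. -/
def sgn (s : Bool) : ℝ := if s then 1 else -1

/-- The threshold function `Th_θ(p) = sgn(θ - p)`, with the convention `sgn 0 = 1`. -/
def thr (θ p : ℝ) : ℝ := if p ≤ θ then 1 else -1

/-- Threshold functions on `[-1,1]`: all of them (`disc = false`), or only those whose threshold is
an integer multiple of `1/T` (`disc = true`, the class `Th^{1/T}`). -/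
def thrClass (T : ℕ) (disc : Bool) : Set (ℝ → ℝ) :=
  {g | ∃ θ ∈ Set.Icc (-1 : ℝ) 1, (disc = true → ∃ j : ℤ, θ = (j : ℝ) / T) ∧ g = thr θ}

/-- The class `G ∘ F` of compositions. -/
def comp {X : Type*} (G : Set (ℝ → ℝ)) (F : Set (X → ℝ)) : Set (X → ℝ) :=
  {f | ∃ g ∈ G, ∃ h ∈ F, f = fun x => g (h x)}

/-- `conv_k(F)`: convex combinations of at most `k` elements of `F`. -/
def convK {X : Type*} (k : ℕ) (F : Set (X → ℝ)) : Set (X → ℝ) :=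
  {f | ∃ (α : Fin k → ℝ) (c : Fin k → X → ℝ), (∀ i, 0 ≤ α i) ∧ ∑ i, α i = 1 ∧ (∀ i, c i ∈ F) ∧
    f = fun x => ∑ i, α i * c i x}

/-- The class `{+,-} · Th ∘ H` of signed thresholds of hypotheses with values in `[0,1]`. -/
def signedThr {X : Type*} (H : Set (X → ℝ)) : Set (X → ℝ) :=
  {f | ∃ h ∈ H, ∃ θ ∈ Set.Icc (0 : ℝ) 1, ∃ s : Bool, f = fun x => sgn s * thr θ (h x)}

/-! ### Rademacher complexity -/

/-- Empirical Rademacher complexity of `F` on the points `x`. -/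
def empRad {X : Type*} {m : ℕ} (F : Set (X → ℝ)) (x : Fin m → X) : ℝ :=
  (∑ σ : Fin m → Bool, ⨆ f : F, (1 / (m : ℝ)) * ∑ i, sgn (σ i) * f.1 (x i)) / 2 ^ m

/-- Statistical Rademacher complexity: expectation of `empRad` over `m` i.i.d. points from `μ`. -/
def rad {X : Type*} [MeasurableSpace X] (m : ℕ) (μ : Measure X) (F : Set (X → ℝ)) : ℝ :=
  ∫ x : Fin m → X, empRad F x ∂(Measure.pi fun _ => μ)

/-- The suprema of signed sums over `F`, as in the Rademacher complexity, are measurable functions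
of the points. -/
def SupMeasurable {X : Type*} [MeasurableSpace X] (F : Set (X → ℝ)) : Prop :=
  ∀ (n : ℕ) (a : Fin n → ℝ), Measurable fun x : Fin n → X => ⨆ f : F, ∑ i, a i * f.1 (x i)

/-! ### Losses, calibration error, multiaccuracy error, omniprediction -/

/-- Expected loss of the action `q` when the label is Bernoulli with parameter `p`. -/
def berLoss (ℓ : ℝ → Bool → ℝ) (p q : ℝ) : ℝ := p * ℓ q true + (1 - p) * ℓ q false

/-- The discrete derivative `Δℓ(p) = ℓ(p,1) - ℓ(p,0)`. -/
def discDeriv (ℓ : ℝ → Bool → ℝ) (p : ℝ) : ℝ := ℓ p true - ℓ p false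

/-- Losses on `[0,1] × {0,1}` with values in `[-1,1]`. -/
def boundedLosses : Set (ℝ → Bool → ℝ) :=
  {ℓ | ∀ p ∈ Set.Icc (0 : ℝ) 1, ∀ y, ℓ p y ∈ Set.Icc (-1 : ℝ) 1}

/-- Proper losses. -/
def properLosses : Set (ℝ → Bool → ℝ) :=
  {ℓ | ℓ ∈ boundedLosses ∧
    ∀ p ∈ Set.Icc (0 : ℝ) 1, ∀ q ∈ Set.Icc (0 : ℝ) 1, berLoss ℓ p p ≤ berLoss ℓ p q}

/-- Losses of bounded variation: the discrete derivative has total variation at most `2`. -/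
def bvLosses : Set (ℝ → Bool → ℝ) :=
  {ℓ | ℓ ∈ boundedLosses ∧ (∀ y, Measurable fun p => ℓ p y) ∧
    eVariationOn (discDeriv ℓ) (Set.Icc 0 1) ≤ 2}

/-- Proper calibration error over `D` of the uniform mixture of the predictors `p 0, …, p (T-1)`. -/
def pcalErr {X : Type*} [MeasurableSpace X] {T : ℕ} (D : Measure (X × Bool))
    (p : Fin T → X → ℝ) : ℝ :=
  ⨆ ℓ : properLosses,
    |(1 / (T : ℝ)) * ∑ t, ∫ z, discDeriv ℓ.1 (p t z.1) * (lab z.2 - p t z.1) ∂D|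

/-- `C`-multiaccuracy error over `D` of the uniform mixture of `p 0, …, p (T-1)`. -/
def maErr {X : Type*} [MeasurableSpace X] {T : ℕ} (D : Measure (X × Bool)) (C : Set (X → ℝ))
    (p : Fin T → X → ℝ) : ℝ :=
  ⨆ c : C, |(1 / (T : ℝ)) * ∑ t, ∫ z, c.1 z.1 * (lab z.2 - p t z.1) ∂D|

/-- `κ : [0,1] → [0,1]` minimizes `q ↦ E_{y ∼ Ber(p)} ℓ(q,y)` up to `τ`, for every `p`
(for `τ = 0`: a selection of the argmin, which need not exist). -/
def IsPostProcessing (τ : ℝ) (ℓ : ℝ → Bool → ℝ) (κ : ℝ → ℝ) : Prop :=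
  ∀ p ∈ Set.Icc (0 : ℝ) 1, κ p ∈ Set.Icc (0 : ℝ) 1 ∧
    ∀ q ∈ Set.Icc (0 : ℝ) 1, berLoss ℓ p (κ p) ≤ berLoss ℓ p q + τ

/-- The uniform mixture of `p 0, …, p (T-1)` is an `(L, H, ε)`-omnipredictor over `D`: for each loss
there is a post-processing (optimal up to `τ`), and every such post-processing of the mixture
competes with every hypothesis. -/
def IsOmnipredictor {X : Type*} [MeasurableSpace X] {T : ℕ} (D : Measure (X × Bool)) (τ : ℝ)
    (L : Set (ℝ → Bool → ℝ)) (H : Set (X → ℝ)) (ε : ℝ) (p : Fin T → X → ℝ) : Prop :=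
  ∀ ℓ ∈ L, (∃ κ, IsPostProcessing τ ℓ κ) ∧ ∀ κ, IsPostProcessing τ ℓ κ → ∀ h ∈ H,
    (1 / (T : ℝ)) * ∑ t, ∫ z, ℓ (κ (p t z.1)) z.2 ∂D ≤ ∫ z, ℓ (h z.1) z.2 ∂D + ε

/-! ### Programs with access to an ERM oracle -/

/-- `O` is an ERM oracle for `C`: on a weighted sample it returns an element of `C` that minimizes
the weighted sum of values over `C`. -/
def IsERMOracle {X : Type*} (C : Set (X → ℝ)) (O : List (X × ℝ) → X → ℝ) : Prop :=
  ∀ S, O S ∈ C ∧ ∀ c ∈ C, (S.map fun s => O S s.1 * s.2).sum ≤ (S.map fun s => c s.1 * s.2).sum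

/-- The returned hypothesis depends measurably on the weighted sample. -/
def MeasurableOracle {X : Type*} [MeasurableSpace X] (O : List (X × ℝ) → X → ℝ) : Prop :=
  ∀ n : ℕ, Measurable fun a : (Fin n → X × ℝ) × X => O (List.ofFn a.1) a.2

/-- A program that returns a value of type `α` and may query an ERM oracle. -/
inductive Prog (X : Type*) (α : Type*) where
  | ret : α → Prog X α
  | ask : List (X × ℝ) → ((X → ℝ) → Prog X α) → Prog X α

/-- Sequential composition. -/
def Prog.bind {X α β : Type*} : Prog X α → (α → Prog X β) → Prog X β
  | .ret a, f => f a
  | .ask S g, f => .ask S fun c => (g c).bind f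

/-- The value returned when queries are answered by `O`. -/
def Prog.run {X α : Type*} (O : List (X × ℝ) → X → ℝ) : Prog X α → α
  | .ret a => a
  | .ask S g => (g (O S)).run O

/-- The number of queries made when they are answered by `O`. -/
def Prog.calls {X α : Type*} (O : List (X × ℝ) → X → ℝ) : Prog X α → ℕ
  | .ret _ => 0
  | .ask S g => (g (O S)).calls O + 1

/-! ### Frank–Wolfe for entropy-regularized ERM -/

/-- The function represented by a list of weights and hypotheses. -/
def combo {X : Type*} (L : List (ℝ × (X → ℝ))) (x : X) : ℝ := (L.map fun a => a.1 * a.2 x).sum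

/-- `n` iterations of Frank–Wolfe for minimizing
`- η ∑ c(xᵢ) zᵢ + ∑ (c(xᵢ)+2) log (c(xᵢ)+2)` over the convex hull of the class; step `t` has step
size `2/(t+1)`. The initial hypothesis is obtained by a query with zero weights. The result is an
explicit convex combination. -/
def frankWolfe {X : Type*} {m : ℕ} (x : Fin m → X) (z : Fin m → ℝ) (η : ℝ) :
    ℕ → Prog X (List (ℝ × (X → ℝ)))
  | 0 => .ask (List.ofFn fun i => (x i, 0)) fun c => .ret [(1, c)]
  | n + 1 => (frankWolfe x z η n).bind fun L =>
      .ask (List.ofFn fun i => (x i, -η * z i + Real.log (combo L (x i) + 2) + 1)) fun s =>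
        .ret ((2 / ((n : ℝ) + 2), s) ::
          L.map fun a => ((1 - 2 / ((n : ℝ) + 2)) * a.1, a.2))

/-- Sampling from an explicit convex combination, by inversion of the cumulative weights at a
uniform `ξ ∈ [0,1]`. -/
def draw {X : Type*} : List (ℝ × (X → ℝ)) → ℝ → X → ℝ
  | [], _ => 0
  | [a], _ => a.2
  | a :: b :: L, ξ => if ξ < a.1 then a.2 else draw (b :: L) (ξ - a.1)

/-! ### Augmented proper calibration -/

/-- The `2T+3` constraints: `some (v, s)` is the calibration constraint with threshold `v/T` and
sign `s`; `none` is the sequential multiaccuracy constraint. -/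
abbrev Constr (T : ℕ) := Option (Fin (T + 1) × Bool)

/-- `f(q, j/T) = w_sma q + ∑_{v,s} w_{v,s} s Th_v(j/T)`. -/
def apcalF (T : ℕ) (w : Constr T → ℝ) (q : ℝ) (j : ℕ) : ℝ :=
  w none * q + ∑ vs : Fin (T + 1) × Bool,
    w (some vs) * sgn vs.2 * thr (((vs.1 : ℕ) : ℝ) / T) ((j : ℝ) / T)

/-- The first zero crossing `(j, lam)` of the piecewise linear interpolation of
`j ↦ f(q, j/T)`: `(0,0)` if `f(q,0) ≤ 0`, and `(T,1)` if there is no sign change. -/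
def minZeroCrossing (T : ℕ) (w : Constr T → ℝ) (q : ℝ) : ℕ × ℝ :=
  if apcalF T w q 0 ≤ 0 then (0, 0)
  else match (List.range T).find? fun j => decide (apcalF T w q j * apcalF T w q (j + 1) ≤ 0) with
    | some j => (j, |apcalF T w q j| / (|apcalF T w q j| + |apcalF T w q (j + 1)|))
    | none => (T, 1)

/-- The random monotone remapping `[-1,1] → {0, 1/T, …, 1}` with seed `ζ`. -/
def remap (T : ℕ) (w : Constr T → ℝ) (ζ : ℝ) (q : ℝ) : ℝ :=
  let c := minZeroCrossing T w q
  if c.2 < ζ then (c.1 : ℝ) / T else ((min (c.1 + 1) T : ℕ) : ℝ) / T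

/-- Payoff vector for input value `q`, prediction `p` and label `y`. -/
def payoff (T : ℕ) (q p y : ℝ) : Constr T → ℝ
  | none => (y - p) * q
  | some vs => sgn vs.2 * (y - p) * thr (((vs.1 : ℕ) : ℝ) / T) p

/-- Exponential weight update. -/
def expUpdate (T : ℕ) (η : ℝ) (w u : Constr T → ℝ) : Constr T → ℝ := fun i =>
  Real.exp (η * u i) * w i / ∑ j, Real.exp (η * u j) * w j

/-! ### The main algorithm -/

/-- Number of hypotheses averaged in each round. -/
def folds (T : ℕ) (δ : ℝ) : ℕ := ⌈(T : ℝ) * Real.log (T / δ)⌉₊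

/-- Number of Frank–Wolfe iterations, for accuracy `1/√T` on `T` points. -/
def fwIters (T : ℕ) : ℕ := ⌈16 * ((T : ℝ) * Real.sqrt T)⌉₊

/-- The hypothesis values handed to the calibrator: unchanged (`disc = false`), or rounded up to
the next integer multiple of `1/T` (`disc = true`). -/
def prep (T : ℕ) (disc : Bool) (a : ℝ) : ℝ := if disc then (⌈a * T⌉ : ℝ) / T else a

/-- A predictor `v ∘ q`, given by its two components. -/
structure Pred (X : Type*) where
  v : ℝ → ℝ
  q : X → ℝ

/-- Evaluation of `v ∘ q`. -/
def Pred.eval {X : Type*} (P : Pred X) (x : X) : ℝ := P.v (P.q x)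

/-- The state of the main loop: weights of the calibrator, cumulative labels
`∑_s r_s(xᵢ,yᵢ)` on the points of the learner, predictors computed so far. -/
structure State (X : Type*) (T : ℕ) where
  w : Constr T → ℝ
  z : Fin T → ℝ
  out : Fin T → Pred X

/-- The internal randomness: one uniform seed per round for the calibrator, and `k` uniform seeds
per round for drawing hypotheses. -/
abbrev Seeds (T k : ℕ) := (Fin T → unitInterval) × (Fin T → Fin k → unitInterval)

/-- One round. The learner computes an approximate minimizer of the entropy-regularized cumulative
loss on its own sample `B` and averages `k` independent draws from it; the calibrator remaps the
result, and is updated with the `t`-th point of its own sample `A`. -/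
def round {X : Type*} {T k : ℕ} (disc : Bool) (A B : Fin T → X × Bool) (r : Seeds T k)
    (t : Fin T) (st : State X T) : Prog X (State X T) :=
  (frankWolfe (fun i => (B i).1) st.z (1 / Real.sqrt T) (fwIters T)).bind fun L =>
    let q : X → ℝ := fun x => (1 / (k : ℝ)) * ∑ i, draw L (r.2 t i) x
    let v : ℝ → ℝ := fun a => remap T st.w (r.1 t) (prep T disc a)
    .ret
      { w := expUpdate T (Real.sqrt (Real.log T / T)) st.w
          (payoff T (prep T disc (q (A t).1)) (v (q (A t).1)) (lab (A t).2))
        z := fun i => st.z i + (lab (B i).2 - v (q (B i).1))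
        out := Function.update st.out t ⟨v, q⟩ }

/-- The first `n` rounds. -/
def loop {X : Type*} {T k : ℕ} (disc : Bool) (A B : Fin T → X × Bool) (r : Seeds T k) :
    (n : ℕ) → n ≤ T → Prog X (State X T)
  | 0, _ => .ret
      { w := fun _ => 1 / (2 * (T : ℝ) + 3)
        z := fun _ => 0
        out := fun _ => ⟨fun _ => 0, fun _ => 0⟩ }
  | n + 1, h => (loop disc A B r n (Nat.le_of_succ_le h)).bind (round disc A B r ⟨n, h⟩)

/-- The whole algorithm on `2T` samples: the first `T` go to the calibrator, the last `T` to the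
learner. -/
def algorithm {X : Type*} {T k : ℕ} (disc : Bool) (S : Fin (T + T) → X × Bool) (r : Seeds T k) :
    Prog X (State X T) :=
  loop disc (fun t => S (Fin.castAdd T t)) (fun i => S (Fin.natAdd T i)) r T le_rfl

/-- Joint law of the `2T` i.i.d. samples and the internal randomness. -/
def law {X : Type*} [MeasurableSpace X] (D : Measure (X × Bool)) (T k : ℕ) :
    Measure ((Fin (T + T) → X × Bool) × Seeds T k) :=
  (Measure.pi fun _ => D).prod volume

end Omni

end

noncomputable section

namespace Omni

set_option linter.unusedSectionVars false

/-! ### Concentration inequalities -/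

theorem measurePreserving_update {ι Z : Type*} [Fintype ι] [DecidableEq ι] [MeasurableSpace Z]
    (ν : Measure Z) [IsProbabilityMeasure ν] (t : ι) :
    MeasurePreserving (fun p : (ι → Z) × Z => Function.update p.1 t p.2)
      ((Measure.pi fun _ => ν).prod ν) (Measure.pi fun _ => ν) := by
  have hm : Measurable (fun p : (ι → Z) × Z => Function.update p.1 t p.2) := by
    refine measurable_pi_lambda _ fun i => ?_
    by_cases h : i = t
    · subst h; simpa using measurable_snd
    · simp only [ne_eq, h, not_false_eq_true, Function.update_of_ne]
      exact (measurable_pi_apply i).comp measurable_fst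
  refine ⟨hm, (Measure.pi_eq fun s hs => ?_).symm⟩
  rw [Measure.map_apply hm (MeasurableSet.univ_pi hs)]
  have : (fun p : (ι → Z) × Z => Function.update p.1 t p.2) ⁻¹' Set.univ.pi s =
      (Set.univ.pi (Function.update s t Set.univ)) ×ˢ s t := by
    ext ⟨w, z⟩
    simp only [Set.mem_preimage, Set.mem_pi, Set.mem_univ, true_imp_iff, Set.mem_prod]
    constructor
    · intro h
      refine ⟨fun i => ?_, by simpa using h t⟩
      by_cases hi : i = t
      · subst hi; simp
      · simpa [hi] using h i
    · rintro ⟨h1, h2⟩ i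
      by_cases hi : i = t
      · subst hi; simpa using h2
      · simpa [hi] using h1 i
  rw [this, Measure.prod_prod, Measure.pi_pi, ← Finset.mul_prod_erase _ _ (Finset.mem_univ t),
    ← Finset.mul_prod_erase _ (fun i => ν (s i)) (Finset.mem_univ t)]
  have h2 : ∏ x ∈ Finset.univ.erase t, ν (Function.update s t Set.univ x) =
      ∏ x ∈ Finset.univ.erase t, ν (s x) :=
    Finset.prod_congr rfl fun i hi => by simp [Finset.ne_of_mem_erase hi]
  rw [h2]
  simp [mul_comm]

theorem measurePreserving_reindex {ι κ Z : Type*} [Fintype ι] [Fintype κ] [MeasurableSpace Z]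
    (ν : Measure Z) [IsProbabilityMeasure ν] (e : κ → ι) (he : Function.Injective e) :
    MeasurePreserving (fun (w : ι → Z) (k : κ) => w (e k))
      (Measure.pi fun _ => ν) (Measure.pi fun _ => ν) := by
  classical
  have hm : Measurable (fun (w : ι → Z) (k : κ) => w (e k)) :=
    measurable_pi_lambda _ fun k => measurable_pi_apply _
  refine ⟨hm, (Measure.pi_eq fun s hs => ?_).symm⟩
  rw [Measure.map_apply hm (MeasurableSet.univ_pi hs)]
  have : (fun (w : ι → Z) (k : κ) => w (e k)) ⁻¹' Set.univ.pi s =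
      Set.univ.pi (Function.extend e s fun _ => Set.univ) := by
    ext w
    simp only [Set.mem_preimage, Set.mem_pi, Set.mem_univ, true_imp_iff]
    constructor
    · intro h i
      by_cases hi : ∃ k, e k = i
      · obtain ⟨k, rfl⟩ := hi
        rw [he.extend_apply]; exact h k
      · rw [Function.extend_apply' _ _ _ hi]; trivial
    · intro h k
      have := h (e k)
      rwa [he.extend_apply] at this
  rw [this, Measure.pi_pi]
  rw [← Finset.prod_subset (Finset.subset_univ (Finset.univ.image e)),
    Finset.prod_image (fun a _ b _ h => he h)]
  · exact Finset.prod_congr rfl fun k _ => by rw [he.extend_apply]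
  · intro i _ hi
    rw [Function.extend_apply' _ _ _ (by simpa using hi)]
    simp

/-- Exponential moments of a sum of adapted increments; adaptedness is expressed by resampling. -/
theorem lintegral_exp_sum_le {Ω V : Type*} [MeasurableSpace Ω] [MeasurableSpace V] {μ : Measure Ω}
    [IsProbabilityMeasure μ] {ν : Measure V} [SFinite ν] (c : ℝ) : ∀ {n : ℕ}
    (R : Fin n → Ω × V → Ω) (_ : ∀ t, MeasurePreserving (R t) (μ.prod ν) μ)
    (h : Fin n → Ω → ℝ) (_ : ∀ t, Measurable (h t))
    (_ : ∀ s t, s < t → ∀ p, h s (R t p) = h s p.1)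
    (_ : ∀ t ω, ∫⁻ v, ENNReal.ofReal (Real.exp (h t (R t (ω, v)))) ∂ν ≤
      ENNReal.ofReal (Real.exp c)),
    ∫⁻ ω, ENNReal.ofReal (Real.exp (∑ t, h t ω)) ∂μ ≤ ENNReal.ofReal (Real.exp (n * c)) := by
  intro n
  induction n with
  | zero => intro R hR h hm hp hc; simp
  | succ n ih =>
    intro R hR h hm hp hc
    have IH := ih (fun t => R t.castSucc) (fun t => hR _) (fun t => h t.castSucc) (fun t => hm _)
      (fun s t hst p => hp _ _ (by simpa using hst) p) (fun t ω => hc _ ω)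
    have hmeas : Measurable fun ω => ENNReal.ofReal (Real.exp (∑ t, h t ω)) := by
      have := fun t => hm t
      fun_prop
    have hmeas2 : Measurable fun ω => ENNReal.ofReal (Real.exp (∑ t : Fin n, h t.castSucc ω)) := by
      have := fun t : Fin n => hm t.castSucc
      fun_prop
    have hmeas3 : Measurable fun ω => ENNReal.ofReal (Real.exp (h (Fin.last n) ω)) := by
      have := hm (Fin.last n)
      fun_prop
    rw [← (hR (Fin.last n)).lintegral_comp hmeas,
      lintegral_prod _ (show Measurable fun p => ENNReal.ofReal (Real.exp
        (∑ t, h t (R (Fin.last n) p))) from hmeas.comp (hR _).measurable).aemeasurable]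
    calc _ = ∫⁻ ω, ENNReal.ofReal (Real.exp (∑ t : Fin n, h t.castSucc ω)) *
          ∫⁻ v, ENNReal.ofReal (Real.exp (h (Fin.last n) (R (Fin.last n) (ω, v)))) ∂ν ∂μ := by
          refine lintegral_congr fun ω => ?_
          rw [← lintegral_const_mul]
          · refine lintegral_congr fun v => ?_
            rw [← ENNReal.ofReal_mul (Real.exp_pos _).le, ← Real.exp_add, Fin.sum_univ_castSucc]
            congr 3
            exact Finset.sum_congr rfl fun t _ => hp _ _ (Fin.castSucc_lt_last t) _
          · exact (hmeas3.comp (hR _).measurable).comp measurable_prodMk_left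
      _ ≤ ∫⁻ ω, ENNReal.ofReal (Real.exp (∑ t : Fin n, h t.castSucc ω)) *
          ENNReal.ofReal (Real.exp c) ∂μ := by
          gcongr with ω; exact hc _ ω
      _ = (∫⁻ ω, ENNReal.ofReal (Real.exp (∑ t : Fin n, h t.castSucc ω)) ∂μ) *
          ENNReal.ofReal (Real.exp c) := lintegral_mul_const _ hmeas2
      _ ≤ ENNReal.ofReal (Real.exp (n * c)) * ENNReal.ofReal (Real.exp c) := by gcongr
      _ = _ := by
          rw [← ENNReal.ofReal_mul (Real.exp_pos _).le, ← Real.exp_add]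
          push_cast; ring_nf

theorem measure_ge_le_of_lintegral_exp_le {Ω : Type*} [MeasurableSpace Ω] {μ : Measure Ω}
    {f : Ω → ℝ} (hf : Measurable f) {C : ℝ}
    (h : ∫⁻ ω, ENNReal.ofReal (Real.exp (f ω)) ∂μ ≤ ENNReal.ofReal (Real.exp C)) (a : ℝ) :
    μ {ω | a ≤ f ω} ≤ ENNReal.ofReal (Real.exp (C - a)) := by
  have h1 := mul_meas_ge_le_lintegral (μ := μ)
    (f := fun ω => ENNReal.ofReal (Real.exp (f ω))) (by fun_prop) (ENNReal.ofReal (Real.exp a))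
  have h2 : {ω | a ≤ f ω} =
      {ω | ENNReal.ofReal (Real.exp a) ≤ ENNReal.ofReal (Real.exp (f ω))} := by
    ext ω
    simp only [Set.mem_ofPred_eq]
    rw [ENNReal.ofReal_le_ofReal_iff (Real.exp_pos _).le, Real.exp_le_exp]
  rw [← h2] at h1
  have h3 : ENNReal.ofReal (Real.exp a) * μ {ω | a ≤ f ω} ≤
      ENNReal.ofReal (Real.exp a) * ENNReal.ofReal (Real.exp (C - a)) := by
    refine (h1.trans h).trans_eq ?_
    rw [← ENNReal.ofReal_mul (Real.exp_pos _).le, ← Real.exp_add]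
    ring_nf
  rwa [ENNReal.mul_le_mul_iff_right (by simp [Real.exp_pos]) (by simp)] at h3

theorem integrable_of_abs_le {Ω : Type*} [MeasurableSpace Ω] {μ : Measure Ω} [IsFiniteMeasure μ]
    {f : Ω → ℝ} (hf : Measurable f) {b : ℝ} (hb : ∀ ω, |f ω| ≤ b) : Integrable f μ :=
  Integrable.of_bound hf.aestronglyMeasurable b (.of_forall fun ω => by simpa using hb ω)

/-- Hoeffding's lemma. -/
theorem integral_exp_mul_sub_le {Ω : Type*} [MeasurableSpace Ω] {μ : Measure Ω}
    [IsProbabilityMeasure μ] {f : Ω → ℝ} (hf : Measurable f) {a b : ℝ} (hb0 : 0 ≤ b)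
    (hb : ∀ ω, |f ω - a| ≤ b) (l : ℝ) :
    ∫ ω, Real.exp (l * (f ω - ∫ ω', f ω' ∂μ)) ∂μ ≤ Real.exp (l ^ 2 * b ^ 2 / 2) := by
  have h := (ProbabilityTheory.hasSubgaussianMGF_of_mem_Icc (μ := μ) (X := f)
    (a := a - b) (b := a + b) hf.aemeasurable
    (.of_forall fun ω => by have := abs_le.1 (hb ω); constructor <;> linarith)).mgf_le l
  refine h.trans_eq ?_
  congr 1
  simp only [NNReal.coe_pow, NNReal.coe_div, coe_nnnorm, NNReal.coe_ofNat, Real.norm_eq_abs]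
  rw [show a + b - (a - b) = 2 * b by ring, abs_of_nonneg (by positivity)]
  ring

theorem lintegral_exp_mul_le {Ω : Type*} [MeasurableSpace Ω] {μ : Measure Ω}
    [IsProbabilityMeasure μ] {f : Ω → ℝ} (hf : Measurable f) {b m l : ℝ} (hb0 : 0 ≤ b)
    (hb : ∀ ω, |f ω| ≤ b) (hm : ∫ ω, f ω ∂μ ≤ m) (hl : 0 ≤ l) :
    ∫⁻ ω, ENNReal.ofReal (Real.exp (l * f ω)) ∂μ ≤
      ENNReal.ofReal (Real.exp (l * m + l ^ 2 * b ^ 2 / 2)) := by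
  have hint : Integrable (fun ω => Real.exp (l * f ω)) μ := by
    refine integrable_of_abs_le (b := Real.exp (l * b)) (by fun_prop) fun ω => ?_
    rw [abs_of_pos (Real.exp_pos _), Real.exp_le_exp]
    gcongr
    exact (abs_le.1 (hb ω)).2
  rw [← ofReal_integral_eq_lintegral_ofReal hint (.of_forall fun ω => (Real.exp_pos _).le)]
  refine ENNReal.ofReal_le_ofReal ?_
  have h := integral_exp_mul_sub_le (μ := μ) hf (a := 0) hb0 (by simpa using hb) l
  have h2 : ∀ ω, Real.exp (l * f ω) =
      Real.exp (l * ∫ ω', f ω' ∂μ) * Real.exp (l * (f ω - ∫ ω', f ω' ∂μ)) := fun ω => by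
    rw [← Real.exp_add]; ring_nf
  simp_rw [h2]
  rw [integral_const_mul, Real.exp_add]
  gcongr

/-- Azuma's inequality for adapted increments. -/
theorem azuma {Ω V : Type*} [MeasurableSpace Ω] [MeasurableSpace V] {μ : Measure Ω}
    [IsProbabilityMeasure μ] {ν : Measure V} [IsProbabilityMeasure ν] {n : ℕ} (hn : 0 < n)
    (R : Fin n → Ω × V → Ω) (hR : ∀ t, MeasurePreserving (R t) (μ.prod ν) μ)
    (h : Fin n → Ω → ℝ) (hm : ∀ t, Measurable (h t))
    (hp : ∀ s t, s < t → ∀ p, h s (R t p) = h s p.1) {b m : ℝ} (hb0 : 0 < b)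
    (hb : ∀ t ω, |h t ω| ≤ b) (hc : ∀ t ω, ∫ v, h t (R t (ω, v)) ∂ν ≤ m) {a : ℝ} (ha : 0 ≤ a) :
    μ {ω | n * m + a ≤ ∑ t, h t ω} ≤ ENNReal.ofReal (Real.exp (-(a ^ 2 / (2 * n * b ^ 2)))) := by
  have hn' : (0 : ℝ) < n := by exact_mod_cast hn
  set l := a / (n * b ^ 2) with hl
  have hl0 : 0 ≤ l := by positivity
  have h1 := lintegral_exp_sum_le (μ := μ) (ν := ν) (l * m + l ^ 2 * b ^ 2 / 2) R hR
    (fun t ω => l * h t ω) (fun t => (hm t).const_mul _) (fun s t hst p => by rw [hp s t hst])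
    (fun t ω => lintegral_exp_mul_le
      ((hm t).comp ((hR t).measurable.comp measurable_prodMk_left)) hb0.le (fun v => hb t _)
      (hc t ω) hl0)
  simp_rw [← Finset.mul_sum] at h1
  have hmeas : Measurable fun ω => l * ∑ t, h t ω := by fun_prop
  refine (measure_mono fun ω hω => ?_).trans ((measure_ge_le_of_lintegral_exp_le hmeas h1
    (l * (n * m + a))).trans_eq ?_)
  · exact mul_le_mul_of_nonneg_left hω hl0
  · congr 2
    rw [hl]
    field_simp
    ring

/-- McDiarmid's inequality, exponential moment form. -/
theorem integral_exp_le_of_bounded_differences {Z : Type*} [MeasurableSpace Z] {ν : Measure Z}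
    [IsProbabilityMeasure ν] {c l : ℝ} (hc : 0 ≤ c) : ∀ {n : ℕ} {F : (Fin n → Z) → ℝ}
    (_ : Measurable F) {M : ℝ} (_ : ∀ z, |F z| ≤ M)
    (_ : ∀ z i a, |F (Function.update z i a) - F z| ≤ c),
    ∫ z, Real.exp (l * (F z - ∫ z', F z' ∂(Measure.pi fun _ => ν))) ∂(Measure.pi fun _ => ν) ≤
      Real.exp (n * (l ^ 2 * c ^ 2 / 2)) := by
  intro n
  induction n with
  | zero =>
    intro F hF M hM hd
    have : ∀ z, F z = F (fun i => i.elim0) := fun z => by congr 1; ext i; exact i.elim0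
    simp_rw [this]
    simp
  | succ n ih =>
    intro F hF M hM hd
    set P : Measure (Fin n → Z) := Measure.pi fun _ => ν
    have hmp := (measurePreserving_piFinSuccAbove (fun _ : Fin (n + 1) => ν) 0).symm
    set e := (MeasurableEquiv.piFinSuccAbove (fun _ : Fin (n + 1) => Z) 0).symm
    have he : ∀ z w, e (z, w) = Fin.cons z w := fun z w => by
      simp [e, MeasurableEquiv.piFinSuccAbove]
      rfl
    have hcons : Measurable fun p : Z × (Fin n → Z) => F (Fin.cons p.1 p.2) := by
      have := hF.comp e.measurable
      simpa [Function.comp_def, he] using this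
    set G : Z → ℝ := fun z => ∫ w, F (Fin.cons z w) ∂P
    have hG : Measurable G := hcons.stronglyMeasurable.integral_prod_right.measurable
    have hGb : ∀ z, |G z| ≤ M := fun z => by
      have := norm_integral_le_of_norm_le_const (μ := P) (f := fun w => F (Fin.cons z w)) (C := M)
        (.of_forall fun w => by simpa using hM _)
      simpa using this
    have hsec : ∀ z, Measurable fun w : Fin n → Z => F (Fin.cons z w) := fun z =>
      hcons.comp measurable_prodMk_left
    have hEF : ∫ z', F z' ∂(Measure.pi fun _ => ν) = ∫ z, G z ∂ν := by
      rw [← hmp.integral_comp e.measurableEmbedding F, integral_prod]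
      · simp only [he]; rfl
      · exact integrable_of_abs_le (hF.comp e.measurable) fun p => hM _
    rw [hEF]
    set m := ∫ z, G z ∂ν
    have hint : ∀ {Ω : Type _} [MeasurableSpace Ω] (Q : Measure Ω) [IsProbabilityMeasure Q]
        (f : Ω → ℝ) (r : ℝ), Measurable f → (∀ ω, |f ω| ≤ M) →
        Integrable (fun ω => Real.exp (l * (f ω - r))) Q := by
      intro Ω _ Q _ f r hf hfb
      refine integrable_of_abs_le (b := Real.exp (|l| * (M + |r|))) (by fun_prop) fun ω => ?_
      rw [abs_of_pos (Real.exp_pos _), Real.exp_le_exp]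
      refine (le_abs_self _).trans ?_
      rw [abs_mul]
      gcongr
      exact (abs_sub _ _).trans (by gcongr; exact hfb ω)
    rw [← hmp.integral_comp e.measurableEmbedding (fun z => Real.exp (l * (F z - m))),
      integral_prod]
    · simp only [he]
      have key : ∀ z, ∫ w, Real.exp (l * (F (Fin.cons z w) - m)) ∂P ≤
          Real.exp (l * (G z - m)) * Real.exp (n * (l ^ 2 * c ^ 2 / 2)) := by
        intro z
        have h1 := ih (hsec z) (fun w => hM _) (fun w i a => by
          have := hd (Fin.cons z w) i.succ a
          rwa [← Fin.cons_update] at this)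
        have h2 : ∀ w, Real.exp (l * (F (Fin.cons z w) - m)) = Real.exp (l * (G z - m)) *
            Real.exp (l * (F (Fin.cons z w) - G z)) := fun w => by
          rw [← Real.exp_add]; ring_nf
        simp_rw [h2]
        rw [integral_const_mul]
        exact mul_le_mul_of_nonneg_left h1 (Real.exp_pos _).le
      have hGd : ∀ z z', |G z - G z'| ≤ c := by
        intro z z'
        have : G z - G z' = ∫ w, (F (Fin.cons z w) - F (Fin.cons z' w)) ∂P := by
          rw [integral_sub]
          · exact integrable_of_abs_le (hsec z) fun w => hM _
          · exact integrable_of_abs_le (hsec z') fun w => hM _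
        rw [this]
        have := norm_integral_le_of_norm_le_const (μ := P)
          (f := fun w => F (Fin.cons z w) - F (Fin.cons z' w)) (C := c)
          (.of_forall fun w => by
            have := hd (Fin.cons z' w) 0 z
            simpa [Fin.update_cons_zero] using this)
        simpa using this
      have hne : Nonempty Z := by
        by_contra h
        rw [not_nonempty_iff] at h
        have := measure_univ (μ := ν)
        simp [Set.univ_eq_empty_iff.2 h] at this
      obtain ⟨z₀⟩ := hne
      calc _ ≤ ∫ z, Real.exp (l * (G z - m)) * Real.exp (n * (l ^ 2 * c ^ 2 / 2)) ∂ν := by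
            refine integral_mono_of_nonneg (.of_forall fun z => integral_nonneg fun w =>
              (Real.exp_pos _).le) ((hint ν G m hG hGb).mul_const _) (.of_forall key)
        _ ≤ Real.exp (l ^ 2 * c ^ 2 / 2) * Real.exp (n * (l ^ 2 * c ^ 2 / 2)) := by
            rw [integral_mul_const]
            gcongr
            exact integral_exp_mul_sub_le hG (a := G z₀) hc (fun z => hGd z z₀) l
        _ = _ := by rw [← Real.exp_add]; push_cast; ring_nf
    · exact hint _ (fun p => F (e p)) m (hF.comp e.measurable) fun p => hM _

/-- McDiarmid's inequality. -/
theorem mcdiarmid {Z : Type*} [MeasurableSpace Z] {ν : Measure Z}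
    [IsProbabilityMeasure ν] {c : ℝ} (hc : 0 < c) {n : ℕ} (hn : 0 < n) {F : (Fin n → Z) → ℝ}
    (hF : Measurable F) {M : ℝ} (hM : ∀ z, |F z| ≤ M)
    (hd : ∀ z i a, |F (Function.update z i a) - F z| ≤ c) {a : ℝ} (ha : 0 ≤ a) :
    (Measure.pi fun _ => ν) {z | (∫ z', F z' ∂(Measure.pi fun _ => ν)) + a ≤ F z} ≤
      ENNReal.ofReal (Real.exp (-(a ^ 2 / (2 * n * c ^ 2)))) := by
  have hn' : (0 : ℝ) < n := by exact_mod_cast hn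
  set l := a / (n * c ^ 2) with hl
  have hl0 : 0 ≤ l := by positivity
  set m := ∫ z', F z' ∂(Measure.pi fun _ => ν)
  have h1 := integral_exp_le_of_bounded_differences (ν := ν) (l := l) hc.le hF hM hd
  have hint : Integrable (fun z => Real.exp (l * (F z - m))) (Measure.pi fun _ : Fin n => ν) := by
    refine integrable_of_abs_le (b := Real.exp (|l| * (M + |m|))) (by fun_prop) fun ω => ?_
    rw [abs_of_pos (Real.exp_pos _), Real.exp_le_exp]
    refine (le_abs_self _).trans ?_
    rw [abs_mul]
    gcongr
    exact (abs_sub _ _).trans (by gcongr; exact hM ω)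
  have h2 := ENNReal.ofReal_le_ofReal h1
  rw [ofReal_integral_eq_lintegral_ofReal hint (.of_forall fun ω => (Real.exp_pos _).le)] at h2
  have hmeas : Measurable fun z => l * (F z - m) := by fun_prop
  refine (measure_mono fun z hz => ?_).trans
    ((measure_ge_le_of_lintegral_exp_le hmeas h2 (l * a)).trans_eq ?_)
  · exact mul_le_mul_of_nonneg_left (by have : m + a ≤ F z := hz; linarith) hl0
  · congr 2
    rw [hl]
    field_simp
    ring

/-! ### Rademacher averages -/

theorem sgn_true : sgn true = 1 := rfl

theorem sgn_false : sgn false = -1 := rfl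

theorem sgn_not (s : Bool) : sgn (!s) = -sgn s := by cases s <;> simp [sgn]

theorem abs_sgn (s : Bool) : |sgn s| = 1 := by cases s <;> simp [sgn]

theorem bddAbove_of_abs_le {ι : Type*} {u : ι → ℝ} {b : ℝ} (h : ∀ i, |u i| ≤ b) :
    BddAbove (Set.range u) := ⟨b, by rintro _ ⟨i, rfl⟩; exact (abs_le.1 (h i)).2⟩

theorem abs_ciSup_le {ι : Type*} [Nonempty ι] {u : ι → ℝ} {b : ℝ} (h : ∀ i, |u i| ≤ b) :
    |⨆ i, u i| ≤ b := by
  obtain ⟨i⟩ := ‹Nonempty ι›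
  exact abs_le.2 ⟨(abs_le.1 (h i)).1.trans (le_ciSup (bddAbove_of_abs_le h) i),
    ciSup_le fun j => (abs_le.1 (h j)).2⟩

theorem abs_ciSup_sub_ciSup_le {ι : Type*} [Nonempty ι] {u v : ι → ℝ} {b c : ℝ}
    (hu : ∀ i, |u i| ≤ b) (hv : ∀ i, |v i| ≤ b) (h : ∀ i, |u i - v i| ≤ c) :
    |(⨆ i, u i) - ⨆ i, v i| ≤ c := by
  refine abs_sub_le_iff.2 ⟨?_, ?_⟩
  · rw [sub_le_iff_le_add]
    refine ciSup_le fun i => ?_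
    have := le_ciSup (bddAbove_of_abs_le hv) i
    have := (abs_sub_le_iff.1 (h i)).1
    linarith
  · rw [sub_le_iff_le_add]
    refine ciSup_le fun i => ?_
    have := le_ciSup (bddAbove_of_abs_le hu) i
    have := (abs_sub_le_iff.1 (h i)).2
    linarith

theorem abs_sum_le_of_abs_le {n : ℕ} {f : Fin n → ℝ} {b : ℝ} (h : ∀ i, |f i| ≤ b) :
    |∑ i, f i| ≤ n * b := by
  refine (Finset.abs_sum_le_sum_abs _ _).trans ((Finset.sum_le_sum fun i _ => h i).trans ?_)
  simp

/-- Comparison of Rademacher averages: a class whose coordinates have smaller increments has the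
smaller average. -/
theorem sum_ciSup_sign_le {ι : Type*} [Nonempty ι] : ∀ {n : ℕ} {a b : ι → Fin n → ℝ} {M : ℝ}
    (_ : ∀ i j, |a i j| ≤ M) (_ : ∀ i j, |b i j| ≤ M)
    (_ : ∀ i k j, |a i j - a k j| ≤ |b i j - b k j|) {A : ι → ℝ} {M' : ℝ} (_ : ∀ i, |A i| ≤ M'),
    ∑ σ : Fin n → Bool, ⨆ i, (A i + ∑ j, sgn (σ j) * a i j) ≤
      ∑ σ : Fin n → Bool, ⨆ i, (A i + ∑ j, sgn (σ j) * b i j) := by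
  intro n
  induction n with
  | zero => intro a b M ha hb hab A M' hA; simp
  | succ n ih =>
    intro a b M ha hb hab A M' hA
    have split : ∀ c : ι → Fin (n + 1) → ℝ,
        ∑ σ : Fin (n + 1) → Bool, ⨆ i, (A i + ∑ j, sgn (σ j) * c i j) =
        ∑ s : Bool, ∑ σ : Fin n → Bool,
          ⨆ i, ((A i + sgn s * c i 0) + ∑ j, sgn (σ j) * c i j.succ) := by
      intro c
      rw [← (Fin.consEquiv fun _ : Fin (n + 1) => Bool).sum_comp, Fintype.sum_prod_type]
      refine Finset.sum_congr rfl fun s _ => Finset.sum_congr rfl fun σ _ => ?_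
      refine congrArg _ (funext fun i => ?_)
      change A i + ∑ j, sgn ((Fin.cons s σ : Fin (n + 1) → Bool) j) * c i j = _
      rw [Fin.sum_univ_succ]
      simp only [Fin.cons_zero, Fin.cons_succ]
      ring
    rw [split a, split b]
    calc _ ≤ ∑ s : Bool, ∑ σ : Fin n → Bool,
          ⨆ i, ((A i + sgn s * a i 0) + ∑ j, sgn (σ j) * b i j.succ) := by
          refine Finset.sum_le_sum fun s _ => ?_
          refine ih (a := fun i j => a i j.succ) (b := fun i j => b i j.succ)
            (A := fun i => A i + sgn s * a i 0) (M := M) (M' := M' + M) (fun i j => ha i j.succ)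
            (fun i j => hb i j.succ) (fun i k j => hab i k j.succ) fun i => ?_
          refine (abs_add_le _ _).trans (add_le_add (hA i) ?_)
          rw [abs_mul, abs_sgn, one_mul]
          exact ha i 0
      _ ≤ _ := by
          rw [Fintype.sum_bool, Fintype.sum_bool, ← Finset.sum_add_distrib,
            ← Finset.sum_add_distrib]
          refine Finset.sum_le_sum fun σ _ => ?_
          simp only [sgn_true, sgn_false, one_mul, neg_one_mul]
          set B : ι → ℝ := fun i => A i + ∑ j, sgn (σ j) * b i j.succ with hB
          have hBb : ∀ i, |B i| ≤ M' + n * M := fun i => by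
            refine (abs_add_le _ _).trans (add_le_add (hA i) (abs_sum_le_of_abs_le fun j => ?_))
            rw [abs_mul, abs_sgn, one_mul]
            exact hb i _
          have e : ∀ (c : ι → ℝ), (⨆ i, (A i + c i + ∑ j, sgn (σ j) * b i j.succ)) =
              ⨆ i, (B i + c i) := fun c => by
            congr 1; ext i; simp only [hB]; ring
          rw [e (fun i => a i 0), e (fun i => -a i 0), e (fun i => b i 0), e (fun i => -b i 0)]
          have b1 : BddAbove (Set.range fun i => B i + b i 0) :=
            bddAbove_of_abs_le (b := M' + n * M + M) fun i =>
              (abs_add_le _ _).trans (add_le_add (hBb i) (hb i 0))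
          have b2 : BddAbove (Set.range fun i => B i + -b i 0) :=
            bddAbove_of_abs_le (b := M' + n * M + M) fun i =>
              (abs_add_le _ _).trans (add_le_add (hBb i) (by rw [abs_neg]; exact hb i 0))
          rw [← le_sub_iff_add_le]
          refine ciSup_le fun i => ?_
          rw [le_sub_comm]
          refine ciSup_le fun k => ?_
          have h1 := le_ciSup b1 i
          have h2 := le_ciSup b2 k
          have h3 := le_ciSup b1 k
          have h4 := le_ciSup b2 i
          have h5 := (le_abs_self _).trans (hab i k 0)
          rcases le_total 0 (b i 0 - b k 0) with h | h
          · rw [abs_of_nonneg h] at h5; linarith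
          · rw [abs_of_nonpos h] at h5; linarith

/-- The Rademacher average of an indexed family on the points `z`. -/
def radAvg {Z ι : Type*} {n : ℕ} (f : ι → Z → ℝ) (z : Fin n → Z) : ℝ :=
  (∑ σ : Fin n → Bool, ⨆ i, (1 / (n : ℝ)) * ∑ j, sgn (σ j) * f i (z j)) / 2 ^ n

theorem radAvg_eq {Z ι : Type*} {n : ℕ} (f : ι → Z → ℝ) (z : Fin n → Z) :
    radAvg f z = (1 / (n : ℝ)) *
      (∑ σ : Fin n → Bool, ⨆ i, ∑ j, sgn (σ j) * f i (z j)) / 2 ^ n := by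
  unfold radAvg
  congr 1
  rw [Finset.mul_sum]
  exact Finset.sum_congr rfl fun σ _ => (Real.mul_iSup_of_nonneg (by positivity) _).symm

theorem radAvg_le_of_abs_sub_le {Z Z' ι : Type*} [Nonempty ι] {n : ℕ} {f : ι → Z → ℝ}
    {g : ι → Z' → ℝ} {z : Fin n → Z} {z' : Fin n → Z'} {M : ℝ} (hf : ∀ i z, |f i z| ≤ M)
    (hg : ∀ i z, |g i z| ≤ M)
    (h : ∀ i k j, |f i (z j) - f k (z j)| ≤ |g i (z' j) - g k (z' j)|) :
    radAvg f z ≤ radAvg g z' := by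
  rw [radAvg_eq, radAvg_eq]
  have := sum_ciSup_sign_le (a := fun i j => f i (z j)) (b := fun i j => g i (z' j)) (M := M)
    (fun i j => hf i _) (fun i j => hg i _) h (A := fun _ => 0) (M' := 0) (by simp)
  simp only [zero_add] at this
  gcongr

theorem abs_sign_sum_le {Z : Type*} {n : ℕ} {f : Z → ℝ} {M : ℝ} (hf : ∀ z, |f z| ≤ M)
    (z : Fin n → Z) (σ : Fin n → Bool) : |∑ j, sgn (σ j) * f (z j)| ≤ n * M :=
  abs_sum_le_of_abs_le fun j => by rw [abs_mul, abs_sgn, one_mul]; exact hf _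

theorem radAvg_add_le {Z ι κ : Type*} [Nonempty ι] [Nonempty κ] {n : ℕ} {f : ι → Z → ℝ}
    {g : κ → Z → ℝ} {M : ℝ} (hf : ∀ i z, |f i z| ≤ M) (hg : ∀ i z, |g i z| ≤ M) (z : Fin n → Z) :
    radAvg (fun (p : ι × κ) z => f p.1 z + g p.2 z) z ≤ radAvg f z + radAvg g z := by
  rw [radAvg_eq, radAvg_eq, radAvg_eq, ← add_div, ← mul_add, ← Finset.sum_add_distrib]
  gcongr with σ
  refine ciSup_le fun p => ?_
  simp only [mul_add, Finset.sum_add_distrib]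
  exact add_le_add (le_ciSup (f := fun i => ∑ j, sgn (σ j) * f i (z j))
      (bddAbove_of_abs_le fun i => abs_sign_sum_le (hf i) z σ) p.1)
    (le_ciSup (f := fun i => ∑ j, sgn (σ j) * g i (z j))
      (bddAbove_of_abs_le fun i => abs_sign_sum_le (hg i) z σ) p.2)

theorem sum_sgn_eq_zero {n : ℕ} (j : Fin n) : ∑ σ : Fin n → Bool, sgn (σ j) = 0 := by
  have h : ∑ σ : Fin n → Bool, sgn (σ j) = ∑ σ : Fin n → Bool, -sgn (σ j) := by
    rw [← (Equiv.arrowCongr (Equiv.refl (Fin n)) Equiv.boolNot).sum_comp]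
    exact Finset.sum_congr rfl fun σ _ => by simp [Equiv.arrowCongr, sgn_not]
  rw [Finset.sum_neg_distrib] at h
  linarith

theorem radAvg_nonneg {Z ι : Type*} [Nonempty ι] {n : ℕ} {f : ι → Z → ℝ}
    {M : ℝ} (hf : ∀ i z, |f i z| ≤ M) (z : Fin n → Z) : 0 ≤ radAvg f z := by
  rw [radAvg_eq]
  obtain ⟨i⟩ := ‹Nonempty ι›
  have : (0 : ℝ) ≤ ∑ σ : Fin n → Bool, ⨆ i, ∑ j, sgn (σ j) * f i (z j) := by
    calc (0 : ℝ) = ∑ σ : Fin n → Bool, ∑ j, sgn (σ j) * f i (z j) := by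
          rw [Finset.sum_comm]
          simp_rw [← Finset.sum_mul, sum_sgn_eq_zero, zero_mul, Finset.sum_const_zero]
      _ ≤ _ := Finset.sum_le_sum fun σ _ =>
          le_ciSup (f := fun i => ∑ j, sgn (σ j) * f i (z j))
            (bddAbove_of_abs_le fun i => abs_sign_sum_le (hf i) z σ) i
  positivity

theorem abs_radAvg_le {Z ι : Type*} [Nonempty ι] {n : ℕ} {f : ι → Z → ℝ}
    {M : ℝ} (hM : 0 ≤ M) (hf : ∀ i z, |f i z| ≤ M) (z : Fin n → Z) : |radAvg f z| ≤ M := by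
  rw [abs_of_nonneg (radAvg_nonneg hf z)]
  unfold radAvg
  rw [div_le_iff₀ (by positivity)]
  refine (Finset.sum_le_sum (g := fun _ => M) fun σ _ => ciSup_le fun i => ?_).trans ?_
  · have := (abs_le.1 (abs_sign_sum_le (hf i) z σ)).2
    rcases Nat.eq_zero_or_pos n with rfl | hn
    · simpa using hM
    · have hn' : (0 : ℝ) < n := by exact_mod_cast hn
      rw [one_div, inv_mul_le_iff₀ hn']
      exact this
  · simp [mul_comm]

theorem measurable_radAvg {Z ι : Type*} [MeasurableSpace Z] {n : ℕ} {f : ι → Z → ℝ}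
    (hsup : ∀ a : Fin n → ℝ, Measurable fun z : Fin n → Z => ⨆ i, ∑ j, a j * f i (z j)) :
    Measurable fun z : Fin n → Z => radAvg f z := by
  simp_rw [radAvg_eq]
  have := fun σ : Fin n → Bool => hsup fun j => sgn (σ j)
  fun_prop

theorem measurePreserving_swap_coords {Z : Type*} [MeasurableSpace Z] (ν : Measure Z)
    [IsProbabilityMeasure ν] {n : ℕ} (σ : Fin n → Bool) :
    MeasurePreserving (fun p : (Fin n → Z) × (Fin n → Z) =>
      ((fun j => if σ j then p.1 j else p.2 j), (fun j => if σ j then p.2 j else p.1 j)))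
      ((Measure.pi fun _ => ν).prod (Measure.pi fun _ => ν))
      ((Measure.pi fun _ => ν).prod (Measure.pi fun _ => ν)) := by
  have h := measurePreserving_arrowProdEquivProdArrow Z Z (Fin n) (fun _ => ν) (fun _ => ν)
  have h2 : MeasurePreserving
      (fun (a : Fin n → Z × Z) j => (if σ j then id else Prod.swap : Z × Z → Z × Z) (a j))
      (Measure.pi fun _ => ν.prod ν) (Measure.pi fun _ => ν.prod ν) := by
    refine measurePreserving_pi _ _ fun j => ?_
    cases σ j
    · simpa using Measure.measurePreserving_swap
    · simpa using MeasurePreserving.id _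
  have h3 := (h.comp h2).comp h.symm
  convert h3 using 1
  ext p j
  · cases hj : σ j <;> simp [MeasurableEquiv.arrowProdEquivProdArrow, Equiv.arrowProdEquivProdArrow, hj]
  · cases hj : σ j <;> simp [MeasurableEquiv.arrowProdEquivProdArrow, Equiv.arrowProdEquivProdArrow, hj]


section UniformConvergence

variable {Z ι : Type*} [MeasurableSpace Z] [Nonempty ι] {ν : Measure Z} [IsProbabilityMeasure ν]
  {f : ι → Z → ℝ} {n : ℕ}

/-- The supremum of the differences of the two sample averages. -/
def ghostSup (f : ι → Z → ℝ) (z' z : Fin n → Z) : ℝ :=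
  ⨆ i, (1 / (n : ℝ)) * ∑ j, (f i (z' j) - f i (z j))

theorem abs_ghost_le (hb : ∀ i z, |f i z| ≤ 1) (z' z : Fin n → Z) (i : ι) :
    |(1 / (n : ℝ)) * ∑ j, (f i (z' j) - f i (z j))| ≤ 2 := by
  have h : |∑ j, (f i (z' j) - f i (z j))| ≤ n * 2 := abs_sum_le_of_abs_le fun j =>
    (abs_sub _ _).trans (by linarith [hb i (z' j), hb i (z j)])
  rw [abs_mul, abs_of_nonneg (by positivity : (0 : ℝ) ≤ 1 / n)]
  rcases Nat.eq_zero_or_pos n with rfl | hn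
  · simp
  · have hn' : (0 : ℝ) < n := by exact_mod_cast hn
    rwa [one_div, inv_mul_le_iff₀ hn']

theorem measurable_ghostSup (hsup : ∀ (n : ℕ) (a : Fin n → ℝ),
      Measurable fun z : Fin n → Z => ⨆ i, ∑ j, a j * f i (z j)) :
    Measurable fun p : (Fin n → Z) × (Fin n → Z) => ghostSup f p.1 p.2 := by
  have hap : Measurable fun p : (Fin n → Z) × (Fin n → Z) => Fin.append p.1 p.2 := by
    refine measurable_pi_lambda _ fun j => ?_
    refine Fin.addCases (fun j => ?_) (fun j => ?_) j
    · simp only [Fin.append_left]; exact (measurable_pi_apply j).comp measurable_fst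
    · simp only [Fin.append_right]; exact (measurable_pi_apply j).comp measurable_snd
  have := (hsup (n + n) (Fin.append (fun _ => 1 / (n : ℝ)) fun _ => -(1 / (n : ℝ)))).comp hap
  convert this using 1
  ext p
  simp only [ghostSup, Function.comp_apply]
  congr 1
  ext i
  simp only [Fin.sum_univ_add, Fin.append_left, Fin.append_right, Finset.mul_sum]
  rw [← Finset.sum_add_distrib]
  exact Finset.sum_congr rfl fun j _ => by ring

theorem integral_ghostSup_le (hb : ∀ i z, |f i z| ≤ 1)
    (hsup : ∀ (n : ℕ) (a : Fin n → ℝ),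
      Measurable fun z : Fin n → Z => ⨆ i, ∑ j, a j * f i (z j)) :
    ∫ p, ghostSup f p.1 p.2 ∂((Measure.pi fun _ : Fin n => ν).prod (Measure.pi fun _ => ν)) ≤
      2 * ∫ z, radAvg f z ∂(Measure.pi fun _ : Fin n => ν) := by
  set P := Measure.pi fun _ : Fin n => ν
  have hms := measurable_ghostSup (n := n) hsup
  have hgb : ∀ z' z : Fin n → Z, |ghostSup f z' z| ≤ 2 := fun z' z =>
    abs_ciSup_le (abs_ghost_le hb z' z)
  set R : (Fin n → Bool) → (Fin n → Z) → ℝ := fun σ z =>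
    ⨆ i, (1 / (n : ℝ)) * ∑ j, sgn (σ j) * f i (z j)
  have hR1 : ∀ (σ : Fin n → Bool) (z : Fin n → Z) (i : ι), |(1 / (n : ℝ)) * ∑ j, sgn (σ j) * f i (z j)| ≤ 1 := by
    intro σ z i
    rw [abs_mul, abs_of_nonneg (by positivity : (0 : ℝ) ≤ 1 / n)]
    have h := abs_sign_sum_le (hb i) z σ
    rcases Nat.eq_zero_or_pos n with rfl | hn
    · simp
    · have hn' : (0 : ℝ) < n := by exact_mod_cast hn
      rwa [one_div, inv_mul_le_iff₀ hn']
  have hRb : ∀ σ z, |R σ z| ≤ 1 := fun σ z => abs_ciSup_le (hR1 σ z)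
  have hRm : ∀ σ, Measurable (R σ) := by
    intro σ
    have := (hsup n fun j => sgn (σ j)).const_mul (1 / (n : ℝ))
    convert this using 1
    ext z
    exact (Real.mul_iSup_of_nonneg (by positivity) _).symm
  have hRi : ∀ σ, Integrable (R σ) P := fun σ => integrable_of_abs_le (hRm σ) (hRb σ)
  have key : ∀ σ : Fin n → Bool, ∫ p, ghostSup f p.1 p.2 ∂(P.prod P) ≤
      (∫ z, R σ z ∂P) + ∫ z, R (fun j => !σ j) z ∂P := by
    intro σ
    have hsw := measurePreserving_swap_coords ν σ
    rw [← hsw.map_eq, integral_map hsw.measurable.aemeasurable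
      hms.aestronglyMeasurable]
    have h2 : (∫ z, R σ z ∂P) + ∫ z, R (fun j => !σ j) z ∂P =
        ∫ p, (R σ p.1 + R (fun j => !σ j) p.2) ∂(P.prod P) := by
      rw [integral_add ((hRi _).comp_fst P) ((hRi _).comp_snd P),
        integral_fun_fst (R σ), integral_fun_snd (R fun j => !σ j)]
      simp
    rw [h2]
    refine integral_mono (integrable_of_abs_le (hms.comp hsw.measurable) fun p => hgb _ _)
      (((hRi _).comp_fst P).add ((hRi _).comp_snd P)) fun p => ?_
    refine ciSup_le fun i => ?_
    have e : (1 / (n : ℝ)) * ∑ j, (f i (if σ j then p.1 j else p.2 j) -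
        f i (if σ j then p.2 j else p.1 j)) = (1 / (n : ℝ)) * ∑ j, sgn (σ j) * f i (p.1 j) +
        (1 / (n : ℝ)) * ∑ j, sgn (!σ j) * f i (p.2 j) := by
      rw [← mul_add, ← Finset.sum_add_distrib]
      congr 1
      refine Finset.sum_congr rfl fun j _ => ?_
      cases σ j <;> simp [sgn] <;> ring
    simp only [e]
    exact add_le_add
      (le_ciSup (f := fun i => (1 / (n : ℝ)) * ∑ j, sgn (σ j) * f i (p.1 j))
        (bddAbove_of_abs_le (hR1 σ p.1)) i)
      (le_ciSup (f := fun i => (1 / (n : ℝ)) * ∑ j, sgn (!σ j) * f i (p.2 j))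
        (bddAbove_of_abs_le (hR1 (fun j => !σ j) p.2)) i)
  have hsum := Finset.sum_le_sum fun σ (_ : σ ∈ (Finset.univ : Finset (Fin n → Bool))) => key σ
  rw [Finset.sum_add_distrib] at hsum
  have hneg : ∑ σ : Fin n → Bool, ∫ z, R (fun j => !σ j) z ∂P = ∑ σ, ∫ z, R σ z ∂P :=
    (Equiv.arrowCongr (Equiv.refl (Fin n)) Equiv.boolNot).sum_comp fun σ => ∫ z, R σ z ∂P
  have hrad : ∫ z, radAvg f z ∂P = (∑ σ, ∫ z, R σ z ∂P) / 2 ^ n := by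
    rw [← integral_finsetSum _ fun σ _ => hRi σ, ← integral_div]
    rfl
  rw [hneg] at hsum
  simp only [Finset.sum_const, Finset.card_univ, Fintype.card_fun, Fintype.card_bool,
    Fintype.card_fin, nsmul_eq_mul, Nat.cast_pow, Nat.cast_ofNat] at hsum
  rw [hrad, ← mul_div_assoc, le_div_iff₀ (by positivity)]
  linarith

/-- The expectation of `ghostSup` over the ghost sample. -/
def ghostMean (ν : Measure Z) (f : ι → Z → ℝ) (z : Fin n → Z) : ℝ :=
  ∫ z', ghostSup f z' z ∂(Measure.pi fun _ : Fin n => ν)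

theorem integrable_ghostSup (hb : ∀ i z, |f i z| ≤ 1)
    (hsup : ∀ (n : ℕ) (a : Fin n → ℝ),
      Measurable fun z : Fin n → Z => ⨆ i, ∑ j, a j * f i (z j)) (z : Fin n → Z) :
    Integrable (fun z' => ghostSup f z' z) (Measure.pi fun _ : Fin n => ν) := by
  have h0 := measurable_ghostSup (f := f) (n := n) hsup
  have h1 : Measurable fun z' : Fin n → Z => (z', z) := measurable_id.prodMk measurable_const
  have h := h0.comp h1
  exact integrable_of_abs_le (b := 2) h fun z' => abs_ciSup_le (abs_ghost_le hb z' z)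

theorem measurable_ghostMean (hsup : ∀ (n : ℕ) (a : Fin n → ℝ),
      Measurable fun z : Fin n → Z => ⨆ i, ∑ j, a j * f i (z j)) :
    Measurable (ghostMean (n := n) ν f) :=
  (measurable_ghostSup hsup).stronglyMeasurable.integral_prod_left'.measurable

theorem abs_ghostMean_le (hb : ∀ i z, |f i z| ≤ 1) (z : Fin n → Z) :
    |ghostMean ν f z| ≤ 2 := by
  have := norm_integral_le_of_norm_le_const (μ := Measure.pi fun _ : Fin n => ν)
    (f := fun z' => ghostSup f z' z) (C := 2)
    (.of_forall fun w => by
      rw [Real.norm_eq_abs]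
      exact abs_ciSup_le (abs_ghost_le hb w z))
  simpa [ghostMean] using this

theorem abs_ghostSup_update_sub_le (hb : ∀ i z, |f i z| ≤ 1) (z' z : Fin n → Z) (i : Fin n)
    (a : Z) : |ghostSup f z' (Function.update z i a) - ghostSup f z' z| ≤ 2 / n := by
  refine abs_ciSup_sub_ciSup_le (abs_ghost_le hb _ _) (abs_ghost_le hb _ _) fun k => ?_
  rw [← mul_sub, ← Finset.sum_sub_distrib,
    Finset.sum_eq_single i (fun j _ hj => by simp [hj]) (by simp), abs_mul,
    abs_of_nonneg (by positivity : (0 : ℝ) ≤ 1 / n), Function.update_self,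
    sub_sub_sub_cancel_left, div_eq_mul_one_div 2 (n : ℝ), mul_comm]
  gcongr
  exact (abs_sub _ _).trans (by linarith [hb k (z i), hb k a])

theorem abs_ghostMean_update_sub_le (hb : ∀ i z, |f i z| ≤ 1)
    (hsup : ∀ (n : ℕ) (a : Fin n → ℝ),
      Measurable fun z : Fin n → Z => ⨆ i, ∑ j, a j * f i (z j)) (z : Fin n → Z) (i : Fin n)
    (a : Z) : |ghostMean ν f (Function.update z i a) - ghostMean ν f z| ≤ 2 / n := by
  unfold ghostMean
  rw [← integral_sub (integrable_ghostSup hb hsup _) (integrable_ghostSup hb hsup _)]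
  have := norm_integral_le_of_norm_le_const (μ := Measure.pi fun _ : Fin n => ν)
    (f := fun z' => ghostSup f z' (Function.update z i a) - ghostSup f z' z) (C := 2 / n)
    (.of_forall fun z' => abs_ghostSup_update_sub_le hb z' z i a)
  simpa using this

theorem integral_sub_average_le_ghostMean (hf : ∀ i, Measurable (f i)) (hb : ∀ i z, |f i z| ≤ 1)
    (hsup : ∀ (n : ℕ) (a : Fin n → ℝ),
      Measurable fun z : Fin n → Z => ⨆ i, ∑ j, a j * f i (z j))
    (hn : 0 < n) (z : Fin n → Z) (i : ι) :
    ∫ z', f i z' ∂ν - (1 / (n : ℝ)) * ∑ j, f i (z j) ≤ ghostMean ν f z := by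
  have hn' : (n : ℝ) ≠ 0 := by positivity
  set P := Measure.pi fun _ : Fin n => ν
  have he : ∫ z' : Fin n → Z, (1 / (n : ℝ)) * ∑ j, (f i (z' j) - f i (z j)) ∂P =
      ∫ z', f i z' ∂ν - (1 / (n : ℝ)) * ∑ j, f i (z j) := by
    have hj : ∀ j : Fin n, Integrable (fun z' : Fin n → Z => f i (z' j)) P := fun j =>
      integrable_of_abs_le ((hf i).comp (measurable_pi_apply j)) fun z' => hb _ _
    have hj2 : ∀ j : Fin n, ∫ z' : Fin n → Z, f i (z' j) ∂P = ∫ z', f i z' ∂ν := by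
      intro j
      have he := measurePreserving_eval (fun _ : Fin n => ν) j
      have := integral_map (μ := P) (f := f i) he.measurable.aemeasurable
        (hf i).aestronglyMeasurable
      rw [he.map_eq] at this
      exact this.symm
    rw [integral_const_mul, integral_finsetSum Finset.univ
      (f := fun j (z' : Fin n → Z) => f i (z' j) - f i (z j))
      fun j _ => (hj j).sub (integrable_const _)]
    have h3 : ∀ j : Fin n, ∫ z' : Fin n → Z, (f i (z' j) - f i (z j)) ∂P =
        ∫ z', f i z' ∂ν - f i (z j) := fun j => by
      rw [integral_sub (hj _) (integrable_const _), hj2]; simp [P]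
    rw [Finset.sum_congr rfl fun j _ => h3 j, Finset.sum_sub_distrib]
    simp only [Finset.sum_const, Finset.card_univ, Fintype.card_fin, nsmul_eq_mul]
    field_simp
  rw [← he]
  refine integral_mono (integrable_of_abs_le (b := 2) ?_
    fun z' => abs_ghost_le hb z' z i) (integrable_ghostSup hb hsup z) fun z' => ?_
  · have := hf i
    fun_prop
  · exact le_ciSup (f := fun i => (1 / (n : ℝ)) * ∑ j, (f i (z' j) - f i (z j)))
      (bddAbove_of_abs_le (abs_ghost_le hb z' z)) i

/-- Uniform convergence: symmetrization and bounded differences. -/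
theorem uniform_convergence (hf : ∀ i, Measurable (f i)) (hb : ∀ i z, |f i z| ≤ 1)
    (hsup : ∀ (n : ℕ) (a : Fin n → ℝ),
      Measurable fun z : Fin n → Z => ⨆ i, ∑ j, a j * f i (z j))
    (hn : 0 < n) {r : ℝ} (hr : ∫ z, radAvg f z ∂(Measure.pi fun _ : Fin n => ν) ≤ r) {a : ℝ}
    (ha : 0 ≤ a) :
    (Measure.pi fun _ : Fin n => ν)
      {z | ¬ ∀ i, ∫ z', f i z' ∂ν - (1 / (n : ℝ)) * ∑ j, f i (z j) ≤ 2 * r + a} ≤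
      ENNReal.ofReal (Real.exp (-(n * a ^ 2 / 8))) := by
  have hn' : (0 : ℝ) < n := by exact_mod_cast hn
  have hmean : ∫ z, ghostMean ν f z ∂(Measure.pi fun _ : Fin n => ν) ≤ 2 * r := by
    have h1 := integral_ghostSup_le (ν := ν) (n := n) hb hsup
    rw [integral_prod_symm _ (integrable_of_abs_le (b := 2) (measurable_ghostSup hsup)
      fun p => abs_ciSup_le (abs_ghost_le hb p.1 p.2))] at h1
    exact h1.trans (by linarith)
  have h := mcdiarmid (ν := ν) (by positivity : (0 : ℝ) < 2 / n) hn
    (measurable_ghostMean (ν := ν) hsup) (abs_ghostMean_le hb)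
    (abs_ghostMean_update_sub_le hb hsup) ha
  refine (measure_mono fun z hz => ?_).trans (h.trans_eq ?_)
  · simp only [Set.mem_ofPred_eq, not_forall, not_le] at hz ⊢
    obtain ⟨i, hi⟩ := hz
    have := integral_sub_average_le_ghostMean hf hb hsup hn (ν := ν) z i
    linarith
  · congr 2
    field_simp
    ring

end UniformConvergence

/-! ### Exponential weights -/

theorem expUpdate_pos {T : ℕ} {η : ℝ} {w u : Constr T → ℝ} (hw : ∀ i, 0 < w i) (i : Constr T) :
    0 < expUpdate T η w u i :=
  div_pos (mul_pos (Real.exp_pos _) (hw i))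
    (Finset.sum_pos (fun j _ => mul_pos (Real.exp_pos _) (hw j)) ⟨i, Finset.mem_univ i⟩)

theorem sum_expUpdate {T : ℕ} {η : ℝ} {w u : Constr T → ℝ} (hw : ∀ i, 0 < w i) :
    ∑ i, expUpdate T η w u i = 1 := by
  unfold expUpdate
  rw [← Finset.sum_div, div_self]
  exact (Finset.sum_pos (fun j _ => mul_pos (Real.exp_pos _) (hw j)) ⟨none, Finset.mem_univ _⟩).ne'

theorem log_sum_exp_le {T : ℕ} {η : ℝ} (hη0 : 0 ≤ η) (hη1 : η ≤ 1) {w u : Constr T → ℝ}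
    (hw : ∀ i, 0 < w i) (hw1 : ∑ i, w i = 1) (hu : ∀ i, |u i| ≤ 1) :
    Real.log (∑ j, Real.exp (η * u j) * w j) ≤ η * ∑ j, w j * u j + η ^ 2 := by
  have h1 : ∑ j, Real.exp (η * u j) * w j ≤ 1 + (η * ∑ j, w j * u j + η ^ 2) := by
    calc _ ≤ ∑ j, (1 + η * u j + η ^ 2) * w j := by
          refine Finset.sum_le_sum fun j _ => mul_le_mul_of_nonneg_right ?_ (hw j).le
          have h2 : |η * u j| ≤ 1 := by
            rw [abs_mul, abs_of_nonneg hη0]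
            exact mul_le_one₀ hη1 (abs_nonneg _) (hu j)
          have h3 := (abs_le.1 (Real.abs_exp_sub_one_sub_id_le h2)).2
          have h4 : (η * u j) ^ 2 ≤ η ^ 2 := by
            rw [mul_pow]
            have : u j ^ 2 ≤ 1 := (sq_le_one_iff_abs_le_one _).2 (hu j)
            nlinarith [sq_nonneg η]
          linarith
      _ = (1 + η ^ 2) * ∑ j, w j + η * ∑ j, w j * u j := by
          rw [Finset.mul_sum, Finset.mul_sum, ← Finset.sum_add_distrib]
          exact Finset.sum_congr rfl fun j _ => by ring
      _ = _ := by rw [hw1]; ring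
  have hpos : 0 < ∑ j, Real.exp (η * u j) * w j :=
    Finset.sum_pos (fun j _ => mul_pos (Real.exp_pos _) (hw j)) ⟨none, Finset.mem_univ _⟩
  linarith [Real.log_le_sub_one_of_pos hpos]

/-- Regret bound of the exponential weights algorithm. -/
theorem expUpdate_regret {T : ℕ} {η : ℝ} (hη0 : 0 < η) (hη1 : η ≤ 1) {w u : ℕ → Constr T → ℝ}
    {N : ℕ} (hw0 : ∀ i, w 0 i = 1 / (2 * (T : ℝ) + 3))
    (hw : ∀ n < N, w (n + 1) = expUpdate T η (w n) (u n)) (hu : ∀ n < N, ∀ i, |u n i| ≤ 1)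
    (i : Constr T) :
    ∑ n ∈ Finset.range N, u n i ≤ ∑ n ∈ Finset.range N, ∑ j, w n j * u n j + η * N +
      Real.log (2 * T + 3) / η := by
  have hinv : ∀ n ≤ N, (∀ i, 0 < w n i) ∧ ∑ i, w n i = 1 := by
    intro n
    induction n with
    | zero =>
      intro _
      refine ⟨fun i => by rw [hw0]; positivity, ?_⟩
      simp only [hw0, Finset.sum_const, Finset.card_univ, Fintype.card_option, Fintype.card_prod,
        Fintype.card_fin, Fintype.card_bool, nsmul_eq_mul]
      push_cast
      field_simp
      ring
    | succ n ih =>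
      intro hn
      have := ih (by omega)
      rw [hw n (by omega)]
      exact ⟨expUpdate_pos this.1, sum_expUpdate this.1⟩
  have key : ∀ n ≤ N, -Real.log (2 * T + 3) + η * ∑ m ∈ Finset.range n, u m i -
      ∑ m ∈ Finset.range n, (η * ∑ j, w m j * u m j + η ^ 2) ≤ Real.log (w n i) := by
    intro n
    induction n with
    | zero => intro _; rw [hw0]; simp
    | succ n ih =>
      intro hn
      have h1 := ih (by omega)
      obtain ⟨hp, hs⟩ := hinv n (by omega)
      have h2 := log_sum_exp_le hη0.le hη1 hp hs (hu n (by omega))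
      have hpos : 0 < ∑ j, Real.exp (η * u n j) * w n j :=
        Finset.sum_pos (fun j _ => mul_pos (Real.exp_pos _) (hp j)) ⟨none, Finset.mem_univ _⟩
      rw [hw n (by omega), expUpdate, Real.log_div (mul_pos (Real.exp_pos _) (hp i)).ne' hpos.ne',
        Real.log_mul (Real.exp_pos _).ne' (hp i).ne', Real.log_exp, Finset.sum_range_succ,
        Finset.sum_range_succ]
      linarith
  have hN := key N le_rfl
  obtain ⟨hp, hs⟩ := hinv N le_rfl
  have hle : w N i ≤ 1 := by
    rw [← hs]; exact Finset.single_le_sum (fun j _ => (hp j).le) (Finset.mem_univ i)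
  have hlog := Real.log_nonpos (hp i).le hle
  rw [Finset.sum_add_distrib, ← Finset.mul_sum] at hN
  simp only [Finset.sum_const, Finset.card_range, nsmul_eq_mul] at hN
  rw [← mul_le_mul_iff_right₀ hη0, mul_add, mul_add, mul_div_cancel₀ _ hη0.ne']
  linarith [sq η]

/-! ### The random remapping -/

theorem abs_thr (θ p : ℝ) : |thr θ p| = 1 := by unfold thr; split_ifs <;> simp

theorem apcalF_mono {T : ℕ} {w : Constr T → ℝ} (hw : 0 ≤ w none) {q q' : ℝ} (h : q ≤ q') (j : ℕ) :
    apcalF T w q j ≤ apcalF T w q' j := by unfold apcalF; gcongr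

theorem abs_apcalF_le {T : ℕ} {w : Constr T → ℝ} (hw : ∀ i, 0 ≤ w i) (hw1 : ∑ i, w i = 1) {q : ℝ}
    (hq : |q| ≤ 1) (j : ℕ) : |apcalF T w q j| ≤ 1 := by
  unfold apcalF
  rw [← hw1, Fintype.sum_option]
  refine (abs_add_le _ _).trans (add_le_add ?_ ((Finset.abs_sum_le_sum_abs _ _).trans
    (Finset.sum_le_sum fun vs _ => ?_)))
  · rw [abs_mul, abs_of_nonneg (hw _)]
    exact mul_le_of_le_one_right (hw _) hq
  · rw [abs_mul, abs_mul, abs_sgn, abs_thr, abs_of_nonneg (hw _)]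
    simp

theorem sum_mul_payoff {T : ℕ} (w : Constr T → ℝ) (q y : ℝ) (j : ℕ) :
    ∑ i, w i * payoff T q ((j : ℝ) / T) y i = (y - (j : ℝ) / T) * apcalF T w q j := by
  unfold apcalF
  rw [Fintype.sum_option, mul_add, Finset.mul_sum]
  simp only [payoff]
  congr 1
  · ring
  · exact Finset.sum_congr rfl fun vs _ => by ring

theorem abs_payoff_le {T : ℕ} {q p y : ℝ} (hq : |q| ≤ 1) (hp : |y - p| ≤ 1) (i : Constr T) :
    |payoff T q p y i| ≤ 1 := by
  rcases i with _ | vs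
  · simp only [payoff, abs_mul]
    exact mul_le_one₀ hp (abs_nonneg _) hq
  · simp only [payoff, abs_mul, abs_sgn, abs_thr]
    simpa using hp

/-- The three possible outcomes of the zero crossing search. -/
theorem minZeroCrossing_cases (T : ℕ) (w : Constr T → ℝ) (q : ℝ) :
    (apcalF T w q 0 ≤ 0 ∧ minZeroCrossing T w q = (0, 0)) ∨
    (∃ j < T, (∀ i ≤ j, 0 < apcalF T w q i) ∧ apcalF T w q (j + 1) ≤ 0 ∧
      minZeroCrossing T w q = (j, apcalF T w q j / (apcalF T w q j - apcalF T w q (j + 1)))) ∨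
    ((∀ i ≤ T, 0 < apcalF T w q i) ∧ minZeroCrossing T w q = (T, 1)) := by
  unfold minZeroCrossing
  by_cases h0 : apcalF T w q 0 ≤ 0
  · exact Or.inl ⟨h0, by simp [h0]⟩
  right
  have hpos : ∀ m, (∀ i < m, ¬ apcalF T w q i * apcalF T w q (i + 1) ≤ 0) →
      ∀ i ≤ m, 0 < apcalF T w q i := by
    intro m hm i
    induction i with
    | zero => intro _; exact not_le.1 h0
    | succ i ih =>
      intro hi
      have h1 := ih (by omega)
      have h2 := not_le.1 (hm i (by omega))
      exact pos_of_mul_pos_right h2 h1.le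
  rcases hf : (List.range T).find?
    (fun j => decide (apcalF T w q j * apcalF T w q (j + 1) ≤ 0)) with _ | j
  · right
    rw [List.find?_range_eq_none] at hf
    refine ⟨hpos T fun i hi => by simpa using hf i hi, by simp [h0]⟩
  · left
    have hf' := hf
    rw [List.find?_range_eq_some] at hf
    obtain ⟨h1, h2, h3⟩ := hf
    have hp := hpos j fun i hi => by simpa using h3 i hi
    have hj := hp j le_rfl
    have hj1 : apcalF T w q (j + 1) ≤ 0 := by
      have h1' : apcalF T w q j * apcalF T w q (j + 1) ≤ 0 := by simpa using h1
      by_contra hc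
      exact absurd h1' (not_le.2 (mul_pos hj (not_le.1 hc)))
    refine ⟨j, List.mem_range.1 h2, hp, hj1, ?_⟩
    rw [if_neg h0]
    change (j, |apcalF T w q j| / (|apcalF T w q j| + |apcalF T w q (j + 1)|)) = _
    rw [abs_of_pos hj, abs_of_nonpos hj1]
    rfl

theorem remap_mem_grid (T : ℕ) (w : Constr T → ℝ) (ζ q : ℝ) :
    ∃ j : ℕ, j ≤ T ∧ remap T w ζ q = (j : ℝ) / T := by
  unfold remap
  simp only
  split_ifs
  · refine ⟨_, ?_, rfl⟩
    rcases minZeroCrossing_cases T w q with h | ⟨j, hj, h⟩ | h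
    · rw [h.2]; exact Nat.zero_le _
    · rw [h.2.2]; exact hj.le
    · rw [h.2]
  · exact ⟨_, min_le_right _ _, rfl⟩

theorem remap_le_of_lex {T : ℕ} {w : Constr T → ℝ} {ζ q q' : ℝ}
    (h : (minZeroCrossing T w q).1 < (minZeroCrossing T w q').1 ∨
      ((minZeroCrossing T w q).1 = (minZeroCrossing T w q').1 ∧
        (minZeroCrossing T w q).2 ≤ (minZeroCrossing T w q').2))
    (hT : (minZeroCrossing T w q').1 ≤ T) : remap T w ζ q ≤ remap T w ζ q' := by
  unfold remap
  simp only
  split_ifs with h1 h2 h2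
  · gcongr; omega
  · gcongr; omega
  · rcases h with h | h
    · gcongr; omega
    · linarith [h.2]
  · gcongr; omega

theorem remap_mono {T : ℕ} {w : Constr T → ℝ} (hw : 0 ≤ w none) {ζ : ℝ} :
    Monotone (remap T w ζ) := by
  intro q q' hq
  have hm := fun j => apcalF_mono hw hq j
  rcases minZeroCrossing_cases T w q with h | ⟨j, hj, h1, h2, h⟩ | ⟨h1, h⟩ <;>
  rcases minZeroCrossing_cases T w q' with h' | ⟨j', hj', h1', h2', h'⟩ | ⟨h1', h'⟩
  · exact remap_le_of_lex (by simp [h, h']) (by simp [h'])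
  · refine remap_le_of_lex ?_ (by rw [h']; exact hj'.le)
    rw [h.2, h']
    have := h1' j' le_rfl
    rcases Nat.eq_zero_or_pos j' with h0 | h0
    · right
      exact ⟨h0.symm, div_nonneg this.le (by linarith)⟩
    · exact Or.inl h0
  · refine remap_le_of_lex ?_ (by rw [h'])
    rw [h.2, h']
    rcases Nat.eq_zero_or_pos T with h0 | h0
    · exact Or.inr ⟨h0.symm, zero_le_one⟩
    · exact Or.inl h0
  · exact absurd (h1 0 (Nat.zero_le _)) (not_lt.2 ((hm 0).trans h'.1))
  · refine remap_le_of_lex ?_ (by rw [h']; exact hj'.le)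
    rw [h, h']
    have hjj : j ≤ j' := by
      by_contra hc
      exact absurd (h1 (j' + 1) (by omega)) (not_lt.2 ((hm _).trans h2'))
    rcases hjj.lt_or_eq with hlt | rfl
    · exact Or.inl hlt
    · right
      refine ⟨rfl, ?_⟩
      have a1 := h1 j le_rfl
      have a2 := hm j
      have a3 := hm (j + 1)
      simp only
      rw [div_le_div_iff₀ (by linarith) (by linarith)]
      nlinarith
  · refine remap_le_of_lex ?_ (by rw [h'])
    rw [h, h']
    exact Or.inl hj
  · exact absurd (h1 0 (Nat.zero_le _)) (not_lt.2 ((hm 0).trans h'.1))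
  · exact absurd (h1 (j' + 1) (by omega)) (not_lt.2 ((hm _).trans h2'))
  · exact remap_le_of_lex (by simp [h, h']) (by simp [h'])

theorem integral_ite_unitInterval {l A B : ℝ} (h0 : 0 ≤ l) (h1 : l ≤ 1) :
    ∫ ζ : unitInterval, (if l < (ζ : ℝ) then A else B) = (1 - l) * A + l * B := by
  have hs : MeasurableSet {ζ : unitInterval | (ζ : ℝ) ≤ l} :=
    measurableSet_le measurable_subtype_coe measurable_const
  have e : ∀ ζ : unitInterval, (if l < (ζ : ℝ) then A else B) =
      A + Set.indicator {ζ : unitInterval | (ζ : ℝ) ≤ l} (fun _ => B - A) ζ := by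
    intro ζ
    by_cases h : l < (ζ : ℝ)
    · rw [if_pos h, Set.indicator_of_notMem (by simpa using h)]; ring
    · rw [if_neg h, Set.indicator_of_mem (by simpa using h)]; ring
  simp_rw [e]
  rw [integral_add (integrable_const _) ((integrable_const _).indicator hs),
    integral_indicator hs, setIntegral_const]
  have hv : (volume : Measure unitInterval).real {ζ : unitInterval | (ζ : ℝ) ≤ l} = l := by
    have : {ζ : unitInterval | (ζ : ℝ) ≤ l} = Set.Iic ⟨l, h0, h1⟩ := by ext; simp [← Subtype.coe_le_coe]
    rw [this, measureReal_def, unitInterval.volume_Iic]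
    simp [h0]
  rw [hv]
  simp
  ring

/-- Against a fixed label, the random remapping has almost no positive expected payoff. -/
theorem integral_payoff_remap_le {T : ℕ} (hT : 0 < T) {w : Constr T → ℝ} (hw : ∀ i, 0 ≤ w i)
    (hw1 : ∑ i, w i = 1) {q : ℝ} (hq : |q| ≤ 1) {y : ℝ} (hy0 : 0 ≤ y) (hy1 : y ≤ 1) :
    ∫ ζ : unitInterval, ∑ i, w i * payoff T q (remap T w ζ q) y i ≤ 1 / T := by
  have hT' : (0 : ℝ) < T := by exact_mod_cast hT
  set c := minZeroCrossing T w q with hc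
  have e : ∀ ζ : unitInterval, ∑ i, w i * payoff T q (remap T w ζ q) y i =
      if c.2 < (ζ : ℝ) then (y - (c.1 : ℝ) / T) * apcalF T w q c.1 else
        (y - ((min (c.1 + 1) T : ℕ) : ℝ) / T) * apcalF T w q (min (c.1 + 1) T) := by
    intro ζ
    rw [← sum_mul_payoff, ← sum_mul_payoff]
    unfold remap
    simp only [← hc]
    split_ifs <;> rfl
  simp_rw [e]
  rcases minZeroCrossing_cases T w q with ⟨h1, h⟩ | ⟨j, hj, h1, h2, h⟩ | ⟨h1, h⟩
  · rw [hc, h, integral_ite_unitInterval le_rfl zero_le_one]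
    simp only [CharP.cast_eq_zero, zero_div, sub_zero, one_mul, zero_mul, add_zero]
    have : 0 ≤ 1 / (T : ℝ) := by positivity
    nlinarith
  · have a1 := h1 j le_rfl
    have hd : 0 < apcalF T w q j - apcalF T w q (j + 1) := by linarith
    rw [hc, h, integral_ite_unitInterval (by simp only; positivity)
      (by simp only; rw [div_le_one hd]; linarith)]
    simp only [min_eq_left (Nat.succ_le_of_lt hj)]
    set l := apcalF T w q j / (apcalF T w q j - apcalF T w q (j + 1)) with hl
    have hl0 : 0 ≤ l := by positivity
    have hl1 : l ≤ 1 := by rw [hl, div_le_one hd]; linarith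
    have h4 : (1 - l) * apcalF T w q j + l * apcalF T w q (j + 1) = 0 := by
      rw [hl]; field_simp; ring
    have h5 := (abs_le.1 (abs_apcalF_le hw hw1 hq (j + 1))).1
    have h6 : (1 - l) * ((y - (j : ℝ) / T) * apcalF T w q j) +
        l * ((y - ((j + 1 : ℕ) : ℝ) / T) * apcalF T w q (j + 1)) =
        (y - (j : ℝ) / T) * ((1 - l) * apcalF T w q j + l * apcalF T w q (j + 1)) +
        l * (-apcalF T w q (j + 1)) * (1 / T) := by push_cast; ring
    rw [h6, h4, mul_zero, zero_add]
    refine mul_le_of_le_one_left (by positivity) ?_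
    exact mul_le_one₀ hl1 (by linarith) (by linarith)
  · rw [hc, h, integral_ite_unitInterval zero_le_one le_rfl]
    have a1 := h1 T le_rfl
    simp only [min_eq_right (Nat.le_succ T)]
    rw [div_self hT'.ne']
    have : 0 ≤ 1 / (T : ℝ) := by positivity
    nlinarith

/-! ### Entropy-regularized minimization -/

/-- The regularized objective. -/
def regObj {m : ℕ} (z : Fin m → ℝ) (η : ℝ) (u : Fin m → ℝ) : ℝ :=
  -η * ∑ i, u i * z i + ∑ i, (u i + 2) * Real.log (u i + 2)

theorem mul_log_le_quadratic {a b : ℝ} (ha : 1 ≤ a) (hb : 0 < b) :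
    b * Real.log b ≤ a * Real.log a + (Real.log a + 1) * (b - a) + (b - a) ^ 2 := by
  have ha0 : 0 < a := by linarith
  have h1 := Real.log_le_sub_one_of_pos (div_pos hb ha0)
  rw [Real.log_div hb.ne' ha0.ne'] at h1
  have h2 : b * (b / a - 1) ≤ (b - a) + (b - a) ^ 2 := by
    have : b * (b / a - 1) = (b - a) + (b - a) ^ 2 / a := by field_simp; ring
    rw [this]
    gcongr
    exact div_le_self (sq_nonneg _) ha
  nlinarith

theorem le_mul_log {a b : ℝ} (ha : 0 < a) (hb : 0 < b) :
    a * Real.log a + (Real.log a + 1) * (b - a) ≤ b * Real.log b := by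
  have h1 := Real.log_le_sub_one_of_pos (div_pos ha hb)
  rw [Real.log_div ha.ne' hb.ne'] at h1
  have h2 : b * (a / b - 1) = a - b := by field_simp
  nlinarith

theorem mul_log_midpoint_le {a b : ℝ} (ha : a ∈ Set.Icc (1 : ℝ) 3) (hb : b ∈ Set.Icc (1 : ℝ) 3) :
    (a + b) / 2 * Real.log ((a + b) / 2) ≤
      (a * Real.log a + b * Real.log b) / 2 - (a - b) ^ 2 / 24 := by
  have hd : ∀ x ∈ interior (Set.Icc (1 : ℝ) 3), x ≠ 0 := fun x hx => by
    rw [interior_Icc] at hx; linarith [hx.1]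
  have d1 : ∀ x, x ≠ 0 → HasDerivAt (fun x : ℝ => x * Real.log x - x ^ 2 / 6)
      (Real.log x + 1 - x / 3) x := by
    intro x hx
    convert! (Real.hasDerivAt_mul_log hx).sub ((hasDerivAt_pow 2 x).div_const 6) using 1
    push_cast; ring
  have hconv : ConvexOn ℝ (Set.Icc (1 : ℝ) 3) fun x => x * Real.log x - x ^ 2 / 6 := by
    refine MonotoneOn.convexOn_of_deriv (convex_Icc _ _) ?_ ?_ ?_
    · exact (Real.continuous_mul_log.sub (by fun_prop)).continuousOn
    · exact fun x hx => (d1 x (hd x hx)).differentiableAt.differentiableWithinAt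
    · intro x hx y hy hxy
      rw [(d1 x (hd x hx)).deriv, (d1 y (hd y hy)).deriv]
      rw [interior_Icc] at hx hy
      have hx0 : 0 < x := by linarith [hx.1]
      have hy0 : 0 < y := by linarith [hy.1]
      have h1 := Real.log_le_sub_one_of_pos (div_pos hx0 hy0)
      rw [Real.log_div hx0.ne' hy0.ne'] at h1
      have h2 : x / y - 1 ≤ (x - y) / 3 := by
        rw [div_sub_one hy0.ne', div_le_div_iff₀ hy0 (by norm_num)]
        nlinarith [hy.2]
      linarith
  have h := hconv.2 ha hb (by norm_num : (0 : ℝ) ≤ 1 / 2) (by norm_num : (0 : ℝ) ≤ 1 / 2)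
    (by norm_num)
  simp only [smul_eq_mul] at h
  rw [show (1 / 2 : ℝ) * a + 1 / 2 * b = (a + b) / 2 by ring] at h
  nlinarith

section Regularized

variable {m : ℕ} {Q : Set (Fin m → ℝ)}

theorem shift_mem {u : Fin m → ℝ} (hQ : ∀ u ∈ Q, ∀ i, u i ∈ Set.Icc (-1 : ℝ) 1) (hu : u ∈ Q)
    (i : Fin m) : u i + 2 ∈ Set.Icc (1 : ℝ) 3 := by
  have := hQ u hu i; constructor <;> linarith [this.1, this.2]

theorem regObj_step_le (hQ : ∀ u ∈ Q, ∀ i, u i ∈ Set.Icc (-1 : ℝ) 1) (hc : Convex ℝ Q)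
    {z : Fin m → ℝ} {η g : ℝ} {u s c : Fin m → ℝ} (hg0 : 0 ≤ g) (hg1 : g ≤ 1) (hu : u ∈ Q)
    (hs : s ∈ Q) (hcQ : c ∈ Q)
    (hopt : ∑ i, s i * (-η * z i + Real.log (u i + 2) + 1) ≤
      ∑ i, c i * (-η * z i + Real.log (u i + 2) + 1)) :
    regObj z η (fun i => g * s i + (1 - g) * u i) - regObj z η c ≤
      (1 - g) * (regObj z η u - regObj z η c) + 4 * m * g ^ 2 := by
  have hmem : (fun i => g * s i + (1 - g) * u i) ∈ Q :=
    hc hs hu hg0 (by linarith) (by ring)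
  have h1 : ∀ i, (g * s i + (1 - g) * u i + 2) * Real.log (g * s i + (1 - g) * u i + 2) ≤
      (u i + 2) * Real.log (u i + 2) + g * ((Real.log (u i + 2) + 1) * (s i - u i)) +
        4 * g ^ 2 := by
    intro i
    have a1 := shift_mem hQ hu i
    have a2 := shift_mem hQ hmem i
    have a3 := mul_log_le_quadratic a1.1 (lt_of_lt_of_le one_pos a2.1)
    have a4 := hQ u hu i
    have a5 := hQ s hs i
    have e : g * s i + (1 - g) * u i + 2 - (u i + 2) = g * (s i - u i) := by ring
    rw [e] at a3
    have a6 : (s i - u i) ^ 2 ≤ 4 := by nlinarith [a4.1, a4.2, a5.1, a5.2]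
    nlinarith [sq_nonneg g]
  have h2 : ∀ i, (u i + 2) * Real.log (u i + 2) + (Real.log (u i + 2) + 1) * (c i - u i) ≤
      (c i + 2) * Real.log (c i + 2) := by
    intro i
    have := le_mul_log (lt_of_lt_of_le one_pos (shift_mem hQ hu i).1)
      (lt_of_lt_of_le one_pos (shift_mem hQ hcQ i).1)
    linarith
  have s1 := Finset.sum_le_sum fun i (_ : i ∈ Finset.univ) => h1 i
  have s2 := Finset.sum_le_sum fun i (_ : i ∈ Finset.univ) => h2 i
  have s3 := mul_le_mul_of_nonneg_left hopt hg0
  have s4 := mul_le_mul_of_nonneg_left s2 hg0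
  unfold regObj
  have e1 : ∑ i, (g * s i + (1 - g) * u i) * z i = g * ∑ i, s i * z i + (1 - g) * ∑ i, u i * z i := by
    rw [Finset.mul_sum, Finset.mul_sum, ← Finset.sum_add_distrib]
    exact Finset.sum_congr rfl fun i _ => by ring
  have e2 : ∀ v : Fin m → ℝ, ∑ i, v i * (-η * z i + Real.log (u i + 2) + 1) =
      -η * ∑ i, v i * z i + ∑ i, (Real.log (u i + 2) + 1) * v i := by
    intro v
    rw [Finset.mul_sum, ← Finset.sum_add_distrib]
    exact Finset.sum_congr rfl fun i _ => by ring
  have e3 : ∀ v : Fin m → ℝ, ∑ i, (Real.log (u i + 2) + 1) * (v i - u i) =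
      ∑ i, (Real.log (u i + 2) + 1) * v i - ∑ i, (Real.log (u i + 2) + 1) * u i := by
    intro v
    rw [← Finset.sum_sub_distrib]
    exact Finset.sum_congr rfl fun i _ => by ring
  rw [e2, e2] at s3
  rw [Finset.sum_add_distrib, Finset.sum_add_distrib, ← Finset.mul_sum, e3] at s1
  rw [Finset.sum_add_distrib, e3] at s4
  simp only [Finset.sum_const, Finset.card_univ, Fintype.card_fin, nsmul_eq_mul] at s1
  rw [e1]
  linarith

/-- Convergence rate of the Frank–Wolfe iteration. -/
theorem frankWolfe_gap (hQ : ∀ u ∈ Q, ∀ i, u i ∈ Set.Icc (-1 : ℝ) 1) (hc : Convex ℝ Q)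
    {z : Fin m → ℝ} {η : ℝ} {u s : ℕ → Fin m → ℝ} (h0 : u 0 ∈ Q) (hs : ∀ n, s n ∈ Q)
    (hstep : ∀ n, u (n + 1) = fun i =>
      2 / ((n : ℝ) + 2) * s n i + (1 - 2 / ((n : ℝ) + 2)) * u n i)
    (hopt : ∀ n, ∀ c ∈ Q, ∑ i, s n i * (-η * z i + Real.log (u n i + 2) + 1) ≤
      ∑ i, c i * (-η * z i + Real.log (u n i + 2) + 1)) (n : ℕ) :
    u n ∈ Q ∧ ∀ c ∈ Q, 1 ≤ n → regObj z η (u n) ≤ regObj z η c + 16 * m / ((n : ℝ) + 2) := by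
  induction n with
  | zero => exact ⟨h0, by simp⟩
  | succ n ih =>
    have hg0 : (0 : ℝ) ≤ 2 / ((n : ℝ) + 2) := by positivity
    have hg1 : 2 / ((n : ℝ) + 2) ≤ 1 := by
      rw [div_le_one (by positivity)]; linarith [(Nat.cast_nonneg n : (0 : ℝ) ≤ n)]
    refine ⟨by rw [hstep]; exact hc (hs n) ih.1 hg0 (by linarith) (by ring), fun c hcQ _ => ?_⟩
    have h1 := regObj_step_le hQ hc hg0 hg1 ih.1 (hs n) hcQ (hopt n c hcQ)
    rw [← hstep] at h1
    rcases Nat.eq_zero_or_pos n with rfl | hn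
    · norm_num at h1 ⊢
      have : (0 : ℝ) ≤ m := Nat.cast_nonneg m
      linarith
    · have h2 := ih.2 c hcQ hn
      have h3 : (1 - 2 / ((n : ℝ) + 2)) * (regObj z η (u n) - regObj z η c) ≤
          (1 - 2 / ((n : ℝ) + 2)) * (16 * m / ((n : ℝ) + 2)) :=
        mul_le_mul_of_nonneg_left (by linarith) (by linarith)
      have h4 : (1 - 2 / ((n : ℝ) + 2)) * (16 * m / ((n : ℝ) + 2)) +
          4 * m * (2 / ((n : ℝ) + 2)) ^ 2 ≤ 16 * m / (((n + 1 : ℕ) : ℝ) + 2) := by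
        have e : (1 - 2 / ((n : ℝ) + 2)) * (16 * m / ((n : ℝ) + 2)) +
          4 * m * (2 / ((n : ℝ) + 2)) ^ 2 = 16 * m * ((n + 1) / ((n : ℝ) + 2) ^ 2) := by
          field_simp; ring
        rw [e, div_eq_mul_one_div (16 * (m : ℝ))]
        refine mul_le_mul_of_nonneg_left ?_ (by positivity)
        rw [div_le_div_iff₀ (by positivity) (by positivity)]
        push_cast
        nlinarith [(Nat.cast_nonneg n : (0 : ℝ) ≤ n)]
      linarith

theorem regObj_add_le_of_near_min (hQ : ∀ u ∈ Q, ∀ i, u i ∈ Set.Icc (-1 : ℝ) 1)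
    (hc : Convex ℝ Q) {z : Fin m → ℝ} {η τ : ℝ} {u c : Fin m → ℝ} (hu : u ∈ Q) (hcQ : c ∈ Q)
    (hmin : ∀ c ∈ Q, regObj z η u ≤ regObj z η c + τ) :
    regObj z η u + (∑ i, (c i - u i) ^ 2) / 12 ≤ regObj z η c + 2 * τ := by
  have hmid : (fun i => (c i + u i) / 2) ∈ Q := by
    have := hc hcQ hu (by norm_num : (0 : ℝ) ≤ 1 / 2) (by norm_num : (0 : ℝ) ≤ 1 / 2) (by norm_num)
    convert! this using 1
    ext i; simp; ring
  have h1 := hmin _ hmid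
  have h2 : ∀ i, ((c i + u i) / 2 + 2) * Real.log ((c i + u i) / 2 + 2) ≤
      ((c i + 2) * Real.log (c i + 2) + (u i + 2) * Real.log (u i + 2)) / 2 -
        (c i - u i) ^ 2 / 24 := by
    intro i
    have := mul_log_midpoint_le (shift_mem hQ hcQ i) (shift_mem hQ hu i)
    rw [show (c i + 2 + (u i + 2)) / 2 = (c i + u i) / 2 + 2 by ring,
      show c i + 2 - (u i + 2) = c i - u i by ring] at this
    exact this
  have s2 := Finset.sum_le_sum fun i (_ : i ∈ Finset.univ) => h2 i
  rw [Finset.sum_sub_distrib, ← Finset.sum_div, ← Finset.sum_div, Finset.sum_add_distrib] at s2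
  have e1 : ∑ i, (c i + u i) / 2 * z i = (∑ i, c i * z i + ∑ i, u i * z i) / 2 := by
    rw [← Finset.sum_add_distrib, Finset.sum_div]
    exact Finset.sum_congr rfl fun i _ => by ring
  unfold regObj at h1 ⊢
  rw [e1] at h1
  linarith

/-- Regret of following an approximate minimizer of the regularized objective. -/
theorem regularized_regret (hQ : ∀ u ∈ Q, ∀ i, u i ∈ Set.Icc (-1 : ℝ) 1) (hc : Convex ℝ Q)
    {η : ℝ} {z u r : ℕ → Fin m → ℝ} {N : ℕ} (hz0 : z 0 = 0)
    (hz : ∀ n < N, z (n + 1) = z n + r n) (hr : ∀ n < N, ∀ i, |r n i| ≤ 1)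
    (hu : ∀ n < N, u n ∈ Q)
    (hmin : ∀ n < N, ∀ c ∈ Q, regObj (z n) η (u n) ≤ regObj (z n) η c + 1)
    {c : Fin m → ℝ} (hcQ : c ∈ Q) :
    η * (∑ n ∈ Finset.range N, ∑ i, c i * r n i - ∑ n ∈ Finset.range N, ∑ i, u n i * r n i) ≤
      6 * m + N * (2 + 3 * η ^ 2 * m) := by
  have hz' : ∀ n ≤ N, ∀ v : Fin m → ℝ,
      ∑ i, v i * z n i = ∑ k ∈ Finset.range n, ∑ i, v i * r k i := by
    intro n
    induction n with
    | zero => intro _ v; simp [hz0]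
    | succ n ih =>
      intro hn v
      rw [hz n (by omega), Finset.sum_range_succ, ← ih (by omega) v, ← Finset.sum_add_distrib]
      exact Finset.sum_congr rfl fun i _ => by simp [mul_add]
  have key : ∀ n ≤ N, ∀ c ∈ Q, -(η * ∑ k ∈ Finset.range n, ∑ i, u k i * r k i) -
      n * (2 + 3 * η ^ 2 * m) ≤ regObj (z n) η c := by
    intro n
    induction n with
    | zero =>
      intro _ c hcQ
      simp only [regObj, hz0, Pi.zero_apply, mul_zero, Finset.sum_const_zero, Finset.range_zero,
        Finset.sum_empty, Nat.cast_zero, zero_mul, neg_zero, sub_zero, zero_add]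
      refine Finset.sum_nonneg fun i _ => ?_
      have := shift_mem hQ hcQ i
      exact mul_nonneg (by linarith [this.1]) (Real.log_nonneg this.1)
    | succ n ih =>
      intro hn c hcQ
      have h1 := ih (by omega) (u n) (hu n (by omega))
      have h2 := regObj_add_le_of_near_min hQ hc (hu n (by omega)) hcQ (hmin n (by omega))
      have h3 : regObj (z (n + 1)) η c = regObj (z n) η c - η * ∑ i, c i * r n i := by
        unfold regObj
        rw [hz n (by omega)]
        have : ∑ i, c i * (z n + r n) i = ∑ i, c i * z n i + ∑ i, c i * r n i := by
          rw [← Finset.sum_add_distrib]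
          exact Finset.sum_congr rfl fun i _ => by simp [mul_add]
        rw [this]; ring
      have h4 : η * ∑ i, c i * r n i ≤ η * ∑ i, u n i * r n i + (∑ i, (c i - u n i) ^ 2) / 12 +
          m * (3 * η ^ 2) := by
        have : ∀ i, η * (c i * r n i) ≤ η * (u n i * r n i) + (c i - u n i) ^ 2 / 12 +
            3 * η ^ 2 := by
          intro i
          have hr2 : r n i ^ 2 ≤ 1 := (sq_le_one_iff_abs_le_one _).2 (hr n (by omega) i)
          nlinarith [sq_nonneg ((c i - u n i) - 6 * η * r n i), sq_nonneg η]
        have s := Finset.sum_le_sum fun i (_ : i ∈ Finset.univ) => this i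
        simpa [Finset.sum_add_distrib, ← Finset.mul_sum, ← Finset.sum_div] using s
      rw [h3, Finset.sum_range_succ]
      push_cast
      linarith
  have h1 := key N le_rfl c hcQ
  have h2 : regObj (z N) η c ≤ -(η * ∑ n ∈ Finset.range N, ∑ i, c i * r n i) + m * 6 := by
    unfold regObj
    rw [hz' N le_rfl c]
    have : ∑ i, (c i + 2) * Real.log (c i + 2) ≤ m * 6 := by
      refine (Finset.sum_le_sum (g := fun _ => (6 : ℝ)) fun i _ => ?_).trans (by simp)
      have := shift_mem hQ hcQ i
      have h3 := Real.log_le_sub_one_of_pos (lt_of_lt_of_le one_pos this.1)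
      have h4 := Real.log_nonneg this.1
      nlinarith [this.1, this.2]
    linarith
  linarith

end Regularized

/-! ### Running the algorithm -/

theorem Prog.run_bind {X α β : Type*} (O : List (X × ℝ) → X → ℝ) (P : Prog X α)
    (f : α → Prog X β) : (P.bind f).run O = (f (P.run O)).run O := by
  induction P with
  | ret a => rfl
  | ask S g ih => exact ih (O S)

theorem Prog.calls_bind {X α β : Type*} (O : List (X × ℝ) → X → ℝ) (P : Prog X α)
    (f : α → Prog X β) : (P.bind f).calls O = P.calls O + (f (P.run O)).calls O := by
  induction P with
  | ret a => simp [Prog.bind, Prog.calls, Prog.run]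
  | ask S g ih =>
    change ((g (O S)).bind f).calls O + 1 = (g (O S)).calls O + 1 + (f ((g (O S)).run O)).calls O
    rw [ih]; ring

section FrankWolfe

variable {X : Type*} {m : ℕ}

/-- The convex combination found by `n` steps of Frank–Wolfe. -/
def fwList (O : List (X × ℝ) → X → ℝ) (x : Fin m → X) (z : Fin m → ℝ) (η : ℝ) (n : ℕ) :
    List (ℝ × (X → ℝ)) := (frankWolfe x z η n).run O

/-- The answer to the query of step `n + 1` of Frank–Wolfe. -/
def fwAnswer (O : List (X × ℝ) → X → ℝ) (x : Fin m → X) (z : Fin m → ℝ) (η : ℝ) (n : ℕ) : X → ℝ :=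
  O (List.ofFn fun i => (x i, -η * z i + Real.log (combo (fwList O x z η n) (x i) + 2) + 1))

variable (O : List (X × ℝ) → X → ℝ) (x : Fin m → X) (z : Fin m → ℝ) (η : ℝ)

theorem fwList_zero : fwList O x z η 0 = [(1, O (List.ofFn fun i => (x i, 0)))] := rfl

theorem fwList_succ (n : ℕ) : fwList O x z η (n + 1) =
    (2 / ((n : ℝ) + 2), fwAnswer O x z η n) ::
      (fwList O x z η n).map fun a => ((1 - 2 / ((n : ℝ) + 2)) * a.1, a.2) := by
  unfold fwList
  rw [frankWolfe, Prog.run_bind]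
  rfl

theorem frankWolfe_calls (n : ℕ) : (frankWolfe x z η n).calls O = n + 1 := by
  induction n with
  | zero => rfl
  | succ n ih =>
    rw [frankWolfe, Prog.calls_bind, ih]
    rfl

theorem combo_scale (L : List (ℝ × (X → ℝ))) (c : ℝ) (y : X) :
    combo (L.map fun a => (c * a.1, a.2)) y = c * combo L y := by
  induction L with
  | nil => simp [combo]
  | cons a L ih =>
    simp only [combo, List.map_cons, List.sum_cons] at ih ⊢
    rw [ih]; ring

theorem combo_fwList_succ (n : ℕ) (y : X) : combo (fwList O x z η (n + 1)) y =
    2 / ((n : ℝ) + 2) * fwAnswer O x z η n y +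
      (1 - 2 / ((n : ℝ) + 2)) * combo (fwList O x z η n) y := by
  rw [fwList_succ, ← combo_scale]
  simp [combo]

/-- Explicit convex combinations of elements of `C`. -/
def IsConvList (C : Set (X → ℝ)) (L : List (ℝ × (X → ℝ))) : Prop :=
  L ≠ [] ∧ (∀ a ∈ L, 0 ≤ a.1 ∧ a.2 ∈ C) ∧ (L.map Prod.fst).sum = 1

variable {O} {C : Set (X → ℝ)}

theorem isConvList_fwList (hO : IsERMOracle C O) (n : ℕ) : IsConvList C (fwList O x z η n) := by
  induction n with
  | zero =>
    rw [fwList_zero]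
    exact ⟨by simp, by simp [(hO _).1], by simp⟩
  | succ n ih =>
    have hg1 : 2 / ((n : ℝ) + 2) ≤ 1 := by
      rw [div_le_one (by positivity)]; linarith [(Nat.cast_nonneg n : (0 : ℝ) ≤ n)]
    rw [fwList_succ]
    refine ⟨by simp, ?_, ?_⟩
    · simp only [List.mem_cons, List.mem_map]
      rintro a (rfl | ⟨b, hb, rfl⟩)
      · exact ⟨by positivity, (hO _).1⟩
      · exact ⟨mul_nonneg (by linarith) (ih.2.1 b hb).1, (ih.2.1 b hb).2⟩
    · have : ∀ (c : ℝ) (L : List (ℝ × (X → ℝ))),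
          ((L.map fun a => (c * a.1, a.2)).map Prod.fst).sum = c * (L.map Prod.fst).sum := by
        intro c L
        induction L with
        | nil => simp
        | cons a L ih' =>
          simp only [List.map_cons, List.sum_cons] at ih' ⊢
          rw [ih']; ring
      rw [List.map_cons, List.sum_cons, this, ih.2.2]
      ring

theorem draw_mem {L : List (ℝ × (X → ℝ))} (hne : L ≠ []) (hL : ∀ a ∈ L, a.2 ∈ C) (ξ : ℝ) :
    draw L ξ ∈ C := by
  induction L generalizing ξ with
  | nil => exact absurd rfl hne
  | cons a L ih =>
    cases L with
    | nil => exact hL a (by simp)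
    | cons b L =>
      rw [draw]
      split_ifs
      · exact hL a (by simp)
      · exact ih (by simp) (fun c hc => hL c (List.mem_cons_of_mem _ hc)) _

/-- The values of `C` on the points `x`, convexified. -/
def hullOn (C : Set (X → ℝ)) (x : Fin m → X) : Set (Fin m → ℝ) :=
  convexHull ℝ ((fun c i => c (x i)) '' C)

variable {x}

theorem hullOn_bounds (hC : ∀ c ∈ C, ∀ y, c y ∈ Set.Icc (-1 : ℝ) 1) {u : Fin m → ℝ}
    (hu : u ∈ hullOn C x) (i : Fin m) : u i ∈ Set.Icc (-1 : ℝ) 1 := by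
  have h1 : hullOn C x ⊆ Set.univ.pi fun _ => Set.Icc (-1 : ℝ) 1 := by
    refine convexHull_min ?_ (convex_pi fun i _ => convex_Icc _ _)
    rintro _ ⟨c, hc, rfl⟩ i _
    exact hC c hc _
  exact h1 hu i (Set.mem_univ i)

theorem oracle_le_of_mem_hullOn (hO : IsERMOracle C O) (g : Fin m → ℝ) {u : Fin m → ℝ}
    (hu : u ∈ hullOn C x) :
    ∑ i, O (List.ofFn fun i => (x i, g i)) (x i) * g i ≤ ∑ i, u i * g i := by
  have hconv : Convex ℝ {u : Fin m → ℝ |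
      ∑ i, O (List.ofFn fun i => (x i, g i)) (x i) * g i ≤ ∑ i, u i * g i} := by
    refine convex_halfSpace_ge ⟨fun u v => ?_, fun c u => ?_⟩ _
    · rw [← Finset.sum_add_distrib]
      exact Finset.sum_congr rfl fun i _ => by simp [add_mul]
    · rw [smul_eq_mul, Finset.mul_sum]
      exact Finset.sum_congr rfl fun i _ => by simp [mul_assoc]
  refine convexHull_min ?_ hconv hu
  rintro _ ⟨c, hc, rfl⟩
  have := (hO (List.ofFn fun i => (x i, g i))).2 c hc
  simpa [List.map_ofFn, List.sum_ofFn, Function.comp_def] using this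

variable (x)

theorem fwList_near_min (hC : ∀ c ∈ C, ∀ y, c y ∈ Set.Icc (-1 : ℝ) 1) (hO : IsERMOracle C O)
    {n : ℕ} (hn : 1 ≤ n) (hmn : 16 * m ≤ n) :
    (fun i => combo (fwList O x z η n) (x i)) ∈ hullOn C x ∧
    ∀ c ∈ hullOn C x, regObj z η (fun i => combo (fwList O x z η n) (x i)) ≤
      regObj z η c + 1 := by
  have hmem : ∀ c ∈ C, (fun i => c (x i)) ∈ hullOn C x := fun c hc =>
    subset_convexHull _ _ ⟨c, hc, rfl⟩
  have h := frankWolfe_gap (Q := hullOn C x) (fun u hu i => hullOn_bounds hC hu i)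
    (convex_convexHull _ _) (z := z) (η := η)
    (u := fun n i => combo (fwList O x z η n) (x i)) (s := fun n i => fwAnswer O x z η n (x i))
    (by
      rw [fwList_zero]
      simpa [combo] using hmem _ (hO (List.ofFn fun i => (x i, 0))).1)
    (fun n => hmem _ (hO _).1)
    (fun n => funext fun i => combo_fwList_succ O x z η n (x i))
    (fun n c hc => oracle_le_of_mem_hullOn hO _ hc) n
  refine ⟨h.1, fun c hc => (h.2 c hc hn).trans ?_⟩
  have hmn' : 16 * (m : ℝ) ≤ n := by exact_mod_cast hmn
  have : 16 * (m : ℝ) / ((n : ℝ) + 2) ≤ 1 := by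
    rw [div_le_one (by positivity)]; linarith
  linarith

end FrankWolfe

section MainLoop

variable {X : Type*} {T k : ℕ} (O : List (X × ℝ) → X → ℝ) (disc : Bool)

/-- The runs of the algorithm: samples and seeds. -/
abbrev Runs (X : Type*) (T k : ℕ) := (Fin (T + T) → X × Bool) × Seeds T k

/-- The calibrator's sample. -/
def calPt (ω : Runs X T k) (t : Fin T) : X × Bool := ω.1 (Fin.castAdd T t)

/-- The learner's sample. -/
def lrnPt (ω : Runs X T k) (i : Fin T) : X × Bool := ω.1 (Fin.natAdd T i)

/-- The state after `n` rounds. -/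
def stAt (ω : Runs X T k) : ℕ → State X T
  | 0 =>
    { w := fun _ => 1 / (2 * (T : ℝ) + 3)
      z := fun _ => 0
      out := fun _ => ⟨fun _ => 0, fun _ => 0⟩ }
  | n + 1 =>
    if h : n < T then (round disc (calPt ω) (lrnPt ω) ω.2 ⟨n, h⟩ (stAt ω n)).run O else stAt ω n

/-- The convex combination computed by the learner in round `t`. -/
def mixList (ω : Runs X T k) (t : ℕ) : List (ℝ × (X → ℝ)) :=
  fwList O (fun i => (lrnPt ω i).1) (stAt O disc ω t).z (1 / Real.sqrt T) (fwIters T)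

/-- The average of the hypotheses drawn in round `t`. -/
def hyp (ω : Runs X T k) (t : Fin T) (x : X) : ℝ :=
  (1 / (k : ℝ)) * ∑ i, draw (mixList O disc ω t) (ω.2.2 t i) x

/-- The remapping of round `t`. -/
def link (ω : Runs X T k) (t : Fin T) (a : ℝ) : ℝ :=
  remap T (stAt O disc ω t).w (ω.2.1 t) (prep T disc a)

/-- The predictor of round `t`. -/
def pred (ω : Runs X T k) (t : Fin T) (x : X) : ℝ := link O disc ω t (hyp O disc ω t x)

/-- The payoff vector of round `t`. -/
def roundPayoff (ω : Runs X T k) (t : Fin T) : Constr T → ℝ :=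
  payoff T (prep T disc (hyp O disc ω t (calPt ω t).1)) (pred O disc ω t (calPt ω t).1)
    (lab (calPt ω t).2)

theorem stAt_succ (ω : Runs X T k) (t : Fin T) : stAt O disc ω (t + 1) =
    { w := expUpdate T (Real.sqrt (Real.log T / T)) (stAt O disc ω t).w (roundPayoff O disc ω t)
      z := fun i => (stAt O disc ω t).z i + (lab (lrnPt ω i).2 - pred O disc ω t (lrnPt ω i).1)
      out := Function.update (stAt O disc ω t).out t ⟨link O disc ω t, hyp O disc ω t⟩ } := by
  rw [stAt, dif_pos t.2, round, Prog.run_bind]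
  rfl

theorem loop_run (ω : Runs X T k) (n : ℕ) (h : n ≤ T) :
    (loop disc (calPt ω) (lrnPt ω) ω.2 n h).run O = stAt O disc ω n := by
  induction n with
  | zero => rfl
  | succ n ih =>
    rw [loop, Prog.run_bind, ih (Nat.le_of_succ_le h), stAt, dif_pos (Nat.lt_of_succ_le h)]

theorem loop_calls (ω : Runs X T k) (n : ℕ) (h : n ≤ T) :
    (loop disc (calPt ω) (lrnPt ω) ω.2 n h).calls O = n * (fwIters T + 1) := by
  induction n with
  | zero => simp [loop, Prog.calls]
  | succ n ih =>
    rw [loop, Prog.calls_bind, ih (Nat.le_of_succ_le h), round, Prog.calls_bind, frankWolfe_calls]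
    simp only [Prog.calls]
    ring

theorem algorithm_run (ω : Runs X T k) :
    (algorithm disc ω.1 ω.2).run O = stAt O disc ω T := loop_run O disc ω T le_rfl

theorem algorithm_calls (ω : Runs X T k) :
    (algorithm disc ω.1 ω.2).calls O = T * (fwIters T + 1) := loop_calls O disc ω T le_rfl

theorem stAt_out (ω : Runs X T k) (t : Fin T) :
    (stAt O disc ω T).out t = ⟨link O disc ω t, hyp O disc ω t⟩ := by
  have : ∀ n ≤ T, (t : ℕ) < n → (stAt O disc ω n).out t = ⟨link O disc ω t, hyp O disc ω t⟩ := by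
    intro n
    induction n with
    | zero => intro _ h; omega
    | succ n ih =>
      intro hn ht
      rw [stAt_succ O disc ω ⟨n, hn⟩]
      change Function.update (stAt O disc ω n).out ⟨n, hn⟩ _ t = _
      rcases Nat.lt_succ_iff_lt_or_eq.1 ht with h | h
      · rw [Function.update_of_ne (by simp [Fin.ext_iff, h.ne])]
        exact ih (by omega) h
      · have : t = ⟨n, hn⟩ := Fin.ext h
        subst this
        rw [Function.update_self]
  exact this T le_rfl t.2

/-- Two runs that agree on the learner's sample and on the first `n` rounds. -/
def Agree (n : ℕ) (ω ω' : Runs X T k) : Prop :=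
  lrnPt ω = lrnPt ω' ∧ ∀ t : Fin T, (t : ℕ) < n →
    calPt ω t = calPt ω' t ∧ ω.2.1 t = ω'.2.1 t ∧ ω.2.2 t = ω'.2.2 t

theorem stAt_congr {n : ℕ} {ω ω' : Runs X T k} (h : Agree n ω ω') :
    stAt O disc ω n = stAt O disc ω' n := by
  induction n with
  | zero => rfl
  | succ n ih =>
    have ih' := ih ⟨h.1, fun t ht => h.2 t (by omega)⟩
    rw [stAt, stAt, ih']
    split_ifs with hn
    · obtain ⟨h1, h2, h3⟩ := h.2 ⟨n, hn⟩ (Nat.lt_succ_self n)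
      rw [round, round, Prog.run_bind, Prog.run_bind, h.1, h1, h2, h3]
    · rfl

theorem mixList_congr {n : ℕ} {ω ω' : Runs X T k} (h : Agree n ω ω') :
    mixList O disc ω n = mixList O disc ω' n := by
  unfold mixList
  rw [stAt_congr O disc h, h.1]

theorem hyp_congr {t : Fin T} {ω ω' : Runs X T k} (h : Agree t ω ω')
    (h2 : ω.2.2 t = ω'.2.2 t) : hyp O disc ω t = hyp O disc ω' t := by
  funext x
  unfold hyp
  rw [mixList_congr O disc h, h2]

theorem link_congr {t : Fin T} {ω ω' : Runs X T k} (h : Agree t ω ω')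
    (h1 : ω.2.1 t = ω'.2.1 t) : link O disc ω t = link O disc ω' t := by
  funext x
  unfold link
  rw [stAt_congr O disc h, h1]

theorem pred_congr {t : Fin T} {ω ω' : Runs X T k} (h : Agree t ω ω')
    (h1 : ω.2.1 t = ω'.2.1 t) (h2 : ω.2.2 t = ω'.2.2 t) :
    pred O disc ω t = pred O disc ω' t := by
  funext x
  unfold pred
  rw [link_congr O disc h h1, hyp_congr O disc h h2]

theorem roundPayoff_congr {t : Fin T} {ω ω' : Runs X T k} (h : Agree (t + 1) ω ω') :
    roundPayoff O disc ω t = roundPayoff O disc ω' t := by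
  obtain ⟨h1, h2, h3⟩ := h.2 t (Nat.lt_succ_self _)
  have h' : Agree t ω ω' := ⟨h.1, fun s hs => h.2 s (by omega)⟩
  unfold roundPayoff
  rw [pred_congr O disc h' h2 h3, hyp_congr O disc h' h3, h1]

theorem stAt_w_pos (ω : Runs X T k) (n : ℕ) (i : Constr T) : 0 < (stAt O disc ω n).w i := by
  induction n generalizing i with
  | zero => simp only [stAt]; positivity
  | succ n ih =>
    by_cases hn : n < T
    · rw [stAt_succ O disc ω ⟨n, hn⟩]
      exact expUpdate_pos ih i
    · rw [stAt, dif_neg hn]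
      exact ih i

theorem sum_stAt_w (ω : Runs X T k) (n : ℕ) : ∑ i, (stAt O disc ω n).w i = 1 := by
  induction n with
  | zero =>
    simp only [stAt, Finset.sum_const, Finset.card_univ, Fintype.card_option, Fintype.card_prod,
      Fintype.card_fin, Fintype.card_bool, nsmul_eq_mul]
    push_cast
    field_simp
    ring
  | succ n ih =>
    by_cases hn : n < T
    · rw [stAt_succ O disc ω ⟨n, hn⟩]
      exact sum_expUpdate fun i => stAt_w_pos O disc ω n i
    · rw [stAt, dif_neg hn]
      exact ih

variable {O disc}

theorem pred_mem_grid (ω : Runs X T k) (t : Fin T) (x : X) :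
    ∃ j : ℕ, j ≤ T ∧ pred O disc ω t x = (j : ℝ) / T := remap_mem_grid _ _ _ _

theorem prep_mono : Monotone (prep T disc) := by
  intro a b hab
  unfold prep
  split_ifs
  · gcongr
  · exact hab

theorem link_mono (ω : Runs X T k) (t : Fin T) : Monotone (link O disc ω t) := fun _ _ h =>
  remap_mono (stAt_w_pos O disc ω t _).le (prep_mono h)

variable {C : Set (X → ℝ)}

theorem hyp_mem_convK (hk : 0 < k) (hO : IsERMOracle C O) (ω : Runs X T k) (t : Fin T) :
    hyp O disc ω t ∈ convK k C := by
  have h := isConvList_fwList (fun i => (lrnPt ω i).1) (stAt O disc ω t).z (1 / Real.sqrt T) hO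
    (fwIters T)
  refine ⟨fun _ => 1 / k, fun i => draw (mixList O disc ω t) (ω.2.2 t i), fun _ => by positivity,
    ?_, fun i => draw_mem h.1 (fun a ha => (h.2.1 a ha).2) _, ?_⟩
  · simp only [Finset.sum_const, Finset.card_univ, Fintype.card_fin, nsmul_eq_mul]
    have : (k : ℝ) ≠ 0 := by positivity
    field_simp
  · funext x
    rw [hyp, Finset.mul_sum]

theorem convK_bounds (hC : ∀ c ∈ C, ∀ y, c y ∈ Set.Icc (-1 : ℝ) 1) {q : X → ℝ}
    (hq : q ∈ convK k C) (x : X) : q x ∈ Set.Icc (-1 : ℝ) 1 := by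
  obtain ⟨α, c, hα, hα1, hc, rfl⟩ := hq
  have h := (convex_Icc (-1 : ℝ) 1).sum_mem (t := Finset.univ) (w := α) (z := fun i => c i x)
    (fun i _ => hα i) hα1 fun i _ => hC _ (hc i) x
  simpa using h

theorem prep_mem_Icc (hT : 0 < T) {a : ℝ} (ha : a ∈ Set.Icc (-1 : ℝ) 1) :
    prep T disc a ∈ Set.Icc (-1 : ℝ) 1 := by
  have hT' : (0 : ℝ) < T := by exact_mod_cast hT
  unfold prep
  split_ifs
  · constructor
    · rw [le_div_iff₀ hT']
      refine le_trans ?_ (Int.le_ceil _)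
      exact mul_le_mul_of_nonneg_right ha.1 hT'.le
    · rw [div_le_one hT']
      have : ⌈a * T⌉ ≤ (T : ℤ) := Int.ceil_le.2 (by
        push_cast; exact mul_le_of_le_one_left hT'.le ha.2)
      exact_mod_cast this
  · exact ha

theorem abs_prep_sub_le (hT : 0 < T) (a : ℝ) : |prep T disc a - a| ≤ 1 / T := by
  have hT' : (0 : ℝ) < T := by exact_mod_cast hT
  unfold prep
  split_ifs
  · have h1 := Int.le_ceil (a * T)
    have h2 := Int.ceil_lt_add_one (a * T)
    have e : (⌈a * T⌉ : ℝ) / T - a = (⌈a * T⌉ - a * T) / T := by field_simp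
    rw [e, abs_of_nonneg (div_nonneg (by linarith) hT'.le)]
    gcongr
    linarith
  · simp

theorem lab_mem_Icc (y : Bool) : lab y ∈ Set.Icc (0 : ℝ) 1 := by cases y <;> simp [lab]

theorem pred_mem_Icc (ω : Runs X T k) (t : Fin T) (x : X) :
    pred O disc ω t x ∈ Set.Icc (0 : ℝ) 1 := by
  obtain ⟨j, hj, h⟩ := pred_mem_grid (O := O) (disc := disc) ω t x
  rw [h]
  exact ⟨by positivity, div_le_one_of_le₀ (by exact_mod_cast hj) (by positivity)⟩

theorem abs_residual_le (ω : Runs X T k) (t : Fin T) (z : X × Bool) :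
    |lab z.2 - pred O disc ω t z.1| ≤ 1 := by
  have h1 := lab_mem_Icc z.2
  have h2 := pred_mem_Icc (O := O) (disc := disc) ω t z.1
  exact abs_le.2 ⟨by linarith [h1.1, h2.2], by linarith [h1.2, h2.1]⟩

end MainLoop

/-! ### Measurability of the algorithm -/

/-- Lists of weighted hypotheses with constant weights and jointly measurable hypotheses. -/
def MeasurableList {Ω X : Type*} [MeasurableSpace Ω] [MeasurableSpace X]
    (L : Ω → List (ℝ × (X → ℝ))) : Prop :=
  ∃ L' : List (ℝ × (Ω → X → ℝ)), (∀ a ∈ L', Measurable fun p : Ω × X => a.2 p.1 p.2) ∧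
    ∀ ω, L ω = L'.map fun a => (a.1, a.2 ω)

theorem measurable_of_countable_cases {Ω α β : Type*} [MeasurableSpace Ω] [MeasurableSpace β]
    [Countable α] {o : Ω → α} (ho : ∀ a, MeasurableSet {ω | o ω = a}) {G : α → Ω → β}
    (hG : ∀ a, Measurable (G a)) : Measurable fun ω => G (o ω) ω := by
  intro s hs
  have : (fun ω => G (o ω) ω) ⁻¹' s = ⋃ a, {ω | o ω = a} ∩ G a ⁻¹' s := by
    ext ω
    simp
  rw [this]
  exact MeasurableSet.iUnion fun a => (ho a).inter (hG a hs)

section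

variable {Ω X : Type*} [MeasurableSpace Ω] [MeasurableSpace X] {L : Ω → List (ℝ × (X → ℝ))}

theorem MeasurableList.combo (hL : MeasurableList L) :
    Measurable fun p : Ω × X => combo (L p.1) p.2 := by
  obtain ⟨L', hm, hL'⟩ := hL
  have h : Measurable fun p : Ω × X => (L'.map fun a => a.1 * a.2 p.1 p.2).sum := by
    clear hL'
    induction L' with
    | nil => simp
    | cons a L' ih =>
      simp only [List.map_cons, List.sum_cons]
      exact ((hm a (by simp)).const_mul _).add (ih fun b hb => hm b (List.mem_cons_of_mem _ hb))
  convert h using 2 with p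
  simp [Omni.combo, hL', Function.comp_def]

theorem MeasurableList.draw (hL : MeasurableList L) {ξ : Ω → ℝ} (hξ : Measurable ξ) :
    Measurable fun p : Ω × X => draw (L p.1) (ξ p.1) p.2 := by
  obtain ⟨L', hm, hL'⟩ := hL
  simp only [hL']
  clear hL'
  induction L' generalizing ξ with
  | nil => simp [Omni.draw]
  | cons a L' ih =>
    cases L' with
    | nil => simpa [Omni.draw] using hm a (by simp)
    | cons b L' =>
      simp only [List.map_cons, Omni.draw]
      have h1 := ih (ξ := fun ω => ξ ω - a.1) (hξ.sub_const _)
        fun c hc => hm c (List.mem_cons_of_mem _ hc)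
      have e : (fun p : Ω × X => (if ξ p.1 < a.1 then a.2 p.1 else
          Omni.draw ((b.1, b.2 p.1) :: L'.map fun a => (a.1, a.2 p.1)) (ξ p.1 - a.1)) p.2) =
          fun p => if ξ p.1 < a.1 then a.2 p.1 p.2 else
            Omni.draw ((b :: L').map fun a => (a.1, a.2 p.1)) (ξ p.1 - a.1) p.2 := by
        funext p
        split_ifs <;> rfl
      rw [e]
      exact Measurable.ite (measurableSet_lt (hξ.comp measurable_fst) measurable_const)
        (hm a (by simp)) h1

theorem measurableList_fwList {O : List (X × ℝ) → X → ℝ} (hO : MeasurableOracle O) {m : ℕ}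
    {x : Ω → Fin m → X} {z : Ω → Fin m → ℝ} (hx : Measurable x) (hz : Measurable z) (η : ℝ)
    (n : ℕ) : MeasurableList fun ω => fwList O (x ω) (z ω) η n := by
  have hq : ∀ w : Ω → Fin m → ℝ, (∀ i, Measurable fun ω => w ω i) →
      Measurable fun p : Ω × X => O (List.ofFn fun i => (x p.1 i, w p.1 i)) p.2 := by
    intro w hw
    have h1 : Measurable fun p : Ω × X => ((fun i => (x p.1 i, w p.1 i) : Fin m → X × ℝ), p.2) := by
      refine Measurable.prodMk (measurable_pi_lambda _ fun i => ?_) measurable_snd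
      exact (((measurable_pi_apply i).comp hx).comp measurable_fst).prodMk
        ((hw i).comp measurable_fst)
    exact (hO m).comp h1
  induction n with
  | zero =>
    simp only [fwList_zero]
    exact ⟨[(1, fun ω => O (List.ofFn fun i => (x ω i, 0)))],
      by simpa using hq (fun _ _ => 0) (fun _ => measurable_const), fun ω => rfl⟩
  | succ n ih =>
    have hw : ∀ i, Measurable fun ω =>
        -η * z ω i + Real.log (combo (fwList O (x ω) (z ω) η n) (x ω i) + 2) + 1 := by
      intro i
      have h1 : Measurable fun ω => combo (fwList O (x ω) (z ω) η n) (x ω i) :=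
        ih.combo.comp (measurable_id.prodMk ((measurable_pi_apply i).comp hx))
      have h2 : Measurable fun ω => z ω i := (measurable_pi_apply i).comp hz
      fun_prop
    obtain ⟨L', hm, hL'⟩ := ih
    refine ⟨(2 / ((n : ℝ) + 2), fun ω => fwAnswer O (x ω) (z ω) η n) ::
      L'.map fun a => ((1 - 2 / ((n : ℝ) + 2)) * a.1, a.2), ?_, fun ω => ?_⟩
    · simp only [List.mem_cons, List.mem_map]
      rintro a (rfl | ⟨b, hb, rfl⟩)
      · exact hq _ hw
      · exact hm b hb
    · have h := hL' ω
      simp only at h ⊢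
      rw [fwList_succ, h]
      simp [Function.comp_def]

end

theorem measurable_lab : Measurable lab := measurable_of_countable _

theorem measurable_thr (θ : ℝ) : Measurable (thr θ) :=
  Measurable.ite measurableSet_Iic measurable_const measurable_const

section

variable {Ω : Type*} [MeasurableSpace Ω] {T : ℕ}

theorem measurable_apcalF {w : Ω → Constr T → ℝ} (hw : ∀ i, Measurable fun ω => w ω i) {q : Ω → ℝ}
    (hq : Measurable q) (j : ℕ) : Measurable fun ω => apcalF T (w ω) (q ω) j := by
  unfold apcalF
  fun_prop

theorem measurable_remap {w : Ω → Constr T → ℝ} (hw : ∀ i, Measurable fun ω => w ω i) {q ζ : Ω → ℝ}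
    (hq : Measurable q) (hζ : Measurable ζ) : Measurable fun ω => remap T (w ω) (ζ ω) (q ω) := by
  have hf := fun j => measurable_apcalF hw hq j
  set o : Ω → Option ℕ := fun ω => (List.range T).find?
    fun j => decide (apcalF T (w ω) (q ω) j * apcalF T (w ω) (q ω) (j + 1) ≤ 0) with ho
  have hp : ∀ j, MeasurableSet {ω | apcalF T (w ω) (q ω) j * apcalF T (w ω) (q ω) (j + 1) ≤ 0} :=
    fun j => measurableSet_le ((hf j).mul (hf (j + 1))) measurable_const
  have hom : ∀ a, MeasurableSet {ω | o ω = a} := by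
    rintro (_ | j)
    · have : {ω | o ω = none} = ⋂ j ∈ Finset.range T,
          {ω | apcalF T (w ω) (q ω) j * apcalF T (w ω) (q ω) (j + 1) ≤ 0}ᶜ := by
        ext ω
        simp [ho]
      rw [this]
      exact Finset.measurableSet_biInter _ fun j _ => (hp j).compl
    · have : {ω | o ω = some j} = {ω | apcalF T (w ω) (q ω) j * apcalF T (w ω) (q ω) (j + 1) ≤ 0} ∩
          ({ω | j ∈ List.range T} ∩ ⋂ i ∈ Finset.range j,
            {ω | apcalF T (w ω) (q ω) i * apcalF T (w ω) (q ω) (i + 1) ≤ 0}ᶜ) := by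
        ext ω
        simp [ho, List.find?_range_eq_some]
      rw [this]
      exact (hp j).inter ((MeasurableSet.const _).inter
        (Finset.measurableSet_biInter _ fun j _ => (hp j).compl))
  set G : Option ℕ → Ω → ℝ := fun a ω => match a with
    | some j => if |apcalF T (w ω) (q ω) j| / (|apcalF T (w ω) (q ω) j| +
        |apcalF T (w ω) (q ω) (j + 1)|) < ζ ω then (j : ℝ) / T else ((min (j + 1) T : ℕ) : ℝ) / T
    | none => if 1 < ζ ω then (T : ℝ) / T else ((min (T + 1) T : ℕ) : ℝ) / T with hGdef
  have hmz : ∀ a : Option ℕ, Measurable (G a) := by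
    rintro (_ | j)
    · exact Measurable.ite (measurableSet_lt measurable_const hζ) measurable_const measurable_const
    · have h1 := hf j
      have h2 := hf (j + 1)
      refine Measurable.ite (measurableSet_lt ?_ hζ) measurable_const measurable_const
      simp only [← Real.norm_eq_abs]
      fun_prop
  have e : (fun ω => remap T (w ω) (ζ ω) (q ω)) = fun ω => if apcalF T (w ω) (q ω) 0 ≤ 0 then
      (if 0 < ζ ω then ((0 : ℕ) : ℝ) / T else ((min (0 + 1) T : ℕ) : ℝ) / T) else G (o ω) ω := by
    funext ω
    unfold remap minZeroCrossing
    by_cases h0 : apcalF T (w ω) (q ω) 0 ≤ 0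
    · simp only [h0, if_true]
    · simp only [h0, if_false, ho, hGdef]
      cases (List.range T).find?
        fun j => decide (apcalF T (w ω) (q ω) j * apcalF T (w ω) (q ω) (j + 1) ≤ 0) <;> rfl
  rw [e]
  exact Measurable.ite (measurableSet_le (hf 0) measurable_const)
    (Measurable.ite (measurableSet_lt measurable_const hζ) measurable_const measurable_const)
    (measurable_of_countable_cases hom hmz)

end

section

variable {X : Type*} [MeasurableSpace X] {T k : ℕ} {O : List (X × ℝ) → X → ℝ} {disc : Bool}

theorem measurable_prep : Measurable (prep T disc) := by
  cases disc
  · exact measurable_id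
  · change Measurable fun a : ℝ => ((⌈a * T⌉ : ℤ) : ℝ) / T
    exact (measurable_from_top.comp (Int.measurable_ceil.comp (measurable_id.mul_const _))).div_const _

theorem measurable_calPt (t : Fin T) : Measurable fun ω : Runs X T k => calPt ω t :=
  (measurable_pi_apply _).comp measurable_fst

theorem measurable_lrnPt (t : Fin T) : Measurable fun ω : Runs X T k => lrnPt ω t :=
  (measurable_pi_apply _).comp measurable_fst

theorem measurable_fst_lrnPt : Measurable fun (ω : Runs X T k) i => (lrnPt ω i).1 :=
  measurable_pi_lambda _ fun i => measurable_fst.comp (measurable_lrnPt i)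

theorem measurableList_mixList (hO : MeasurableOracle O) {n : ℕ}
    (hz : ∀ i, Measurable fun ω : Runs X T k => (stAt O disc ω n).z i) :
    MeasurableList fun ω : Runs X T k => mixList O disc ω n :=
  measurableList_fwList hO measurable_fst_lrnPt (measurable_pi_lambda _ hz) _ _

theorem measurable_hyp_of_state (hO : MeasurableOracle O) {t : Fin T}
    (hz : ∀ i, Measurable fun ω : Runs X T k => (stAt O disc ω t).z i) :
    Measurable fun p : Runs X T k × X => hyp O disc p.1 t p.2 := by
  unfold hyp
  refine (Finset.measurable_sum _ fun i _ => ?_).const_mul _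
  exact (measurableList_mixList hO hz).draw (ξ := fun ω => (ω.2.2 t i : ℝ))
    (measurable_subtype_coe.comp ((measurable_pi_apply i).comp ((measurable_pi_apply t).comp
      (measurable_snd.comp measurable_snd))))

theorem measurable_pred_of_state (hO : MeasurableOracle O) {t : Fin T}
    (hw : ∀ i, Measurable fun ω : Runs X T k => (stAt O disc ω t).w i)
    (hz : ∀ i, Measurable fun ω : Runs X T k => (stAt O disc ω t).z i) :
    Measurable fun p : Runs X T k × X => pred O disc p.1 t p.2 :=
  measurable_remap (fun i => (hw i).comp measurable_fst)
    (measurable_prep.comp (measurable_hyp_of_state hO hz))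
    (measurable_subtype_coe.comp ((measurable_pi_apply t).comp
      (measurable_fst.comp (measurable_snd.comp measurable_fst))))

theorem measurable_payoff {Ω : Type*} [MeasurableSpace Ω] {q p y : Ω → ℝ} (hq : Measurable q)
    (hp : Measurable p) (hy : Measurable y) (i : Constr T) :
    Measurable fun ω => payoff T (q ω) (p ω) (y ω) i := by
  rcases i with _ | vs
  · exact (hy.sub hp).mul hq
  · exact ((hy.sub hp).const_mul _).mul ((measurable_thr _).comp hp)

theorem measurable_stAt (hO : MeasurableOracle O) (n : ℕ) :
    (∀ i, Measurable fun ω : Runs X T k => (stAt O disc ω n).w i) ∧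
    ∀ i, Measurable fun ω : Runs X T k => (stAt O disc ω n).z i := by
  induction n with
  | zero => exact ⟨fun i => measurable_const, fun i => measurable_const⟩
  | succ n ih =>
    by_cases hn : n < T
    · have hh := measurable_hyp_of_state (t := ⟨n, hn⟩) hO ih.2
      have hp := measurable_pred_of_state (t := ⟨n, hn⟩) hO ih.1 ih.2
      have e := fun ω : Runs X T k => stAt_succ O disc ω ⟨n, hn⟩
      simp only at e
      simp only [e]
      constructor
      · intro i
        have hpay : ∀ j, Measurable fun ω : Runs X T k => roundPayoff O disc ω ⟨n, hn⟩ j := by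
          intro j
          have hA := measurable_calPt (X := X) (k := k) (⟨n, hn⟩ : Fin T)
          exact measurable_payoff
            (measurable_prep.comp (hh.comp (measurable_id.prodMk (measurable_fst.comp hA))))
            (hp.comp (measurable_id.prodMk (measurable_fst.comp hA)))
            (measurable_lab.comp (measurable_snd.comp hA)) j
        have hw := ih.1
        unfold expUpdate
        fun_prop
      · intro i
        exact (ih.2 i).add ((measurable_lab.comp (measurable_snd.comp (measurable_lrnPt i))).sub
          (hp.comp (measurable_id.prodMk (measurable_fst.comp (measurable_lrnPt i)))))
    · simp only [stAt, dif_neg hn]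
      exact ih

theorem measurable_hyp (hO : MeasurableOracle O) (t : Fin T) :
    Measurable fun p : Runs X T k × X => hyp O disc p.1 t p.2 :=
  measurable_hyp_of_state hO (measurable_stAt hO t).2

theorem measurable_pred (hO : MeasurableOracle O) (t : Fin T) :
    Measurable fun p : Runs X T k × X => pred O disc p.1 t p.2 :=
  measurable_pred_of_state hO (measurable_stAt hO t).1 (measurable_stAt hO t).2

theorem measurable_mix (hO : MeasurableOracle O) (t : Fin T) :
    Measurable fun p : Runs X T k × X => combo (mixList O disc p.1 t) p.2 :=
  (measurableList_mixList hO (measurable_stAt hO t).2).combo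

theorem measurable_roundPayoff (hO : MeasurableOracle O) (t : Fin T) (j : Constr T) :
    Measurable fun ω : Runs X T k => roundPayoff O disc ω t j := by
  have hA := measurable_calPt (X := X) (k := k) t
  exact measurable_payoff
    (measurable_prep.comp ((measurable_hyp hO t).comp
      (measurable_id.prodMk (measurable_fst.comp hA))))
    ((measurable_pred hO t).comp (measurable_id.prodMk (measurable_fst.comp hA)))
    (measurable_lab.comp (measurable_snd.comp hA)) j

end

/-! ### Sampling from an explicit convex combination -/

theorem measurable_draw_seed {X : Type*} (L : List (ℝ × (X → ℝ))) (x : X) :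
    Measurable fun ξ => draw L ξ x := by
  induction L with
  | nil => exact measurable_const
  | cons a L ih =>
    cases L with
    | nil => exact measurable_const
    | cons b L =>
      have e : (fun ξ => draw (a :: b :: L) ξ x) =
          fun ξ => if ξ < a.1 then a.2 x else draw (b :: L) (ξ - a.1) x := by
        funext ξ
        rw [draw]
        split_ifs <;> rfl
      rw [e]
      exact Measurable.ite measurableSet_Iio measurable_const
        (ih.comp (measurable_id.sub_const a.1))

theorem abs_draw_le {X : Type*} {L : List (ℝ × (X → ℝ))} {x : X} (hL : ∀ a ∈ L, |a.2 x| ≤ 1)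
    (ξ : ℝ) : |draw L ξ x| ≤ 1 := by
  induction L generalizing ξ with
  | nil => simp [draw]
  | cons a L ih =>
    cases L with
    | nil => exact hL a (by simp)
    | cons b L =>
      simp only [draw]
      split_ifs
      · exact hL a (by simp)
      · exact ih (fun c hc => hL c (List.mem_cons_of_mem _ hc)) _

theorem intervalIntegrable_draw {X : Type*} {L : List (ℝ × (X → ℝ))} {x : X}
    (hL : ∀ a ∈ L, |a.2 x| ≤ 1) (a b : ℝ) :
    IntervalIntegrable (fun ξ => draw L ξ x) volume a b := by
  rw [intervalIntegrable_iff]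
  have : IsFiniteMeasure (volume.restrict (Set.uIoc a b)) := ⟨by simp [Set.uIoc]⟩
  exact integrable_of_abs_le (measurable_draw_seed L x) (abs_draw_le hL)

theorem integral_draw {X : Type*} {L : List (ℝ × (X → ℝ))} {x : X} (hne : L ≠ [])
    (hL : ∀ a ∈ L, 0 ≤ a.1 ∧ |a.2 x| ≤ 1) :
    ∫ ξ in (0 : ℝ)..(L.map Prod.fst).sum, draw L ξ x = combo L x := by
  induction L with
  | nil => exact absurd rfl hne
  | cons a L ih =>
    cases L with
    | nil => simp [draw, combo]
    | cons b L =>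
      have hL' : ∀ c ∈ b :: L, 0 ≤ c.1 ∧ |c.2 x| ≤ 1 := fun c hc =>
        hL c (List.mem_cons_of_mem _ hc)
      have ih' := ih (by simp) hL'
      set s := ((b :: L).map Prod.fst).sum with hs
      have hs0 : 0 ≤ s := List.sum_nonneg (by
        simp only [List.mem_map]
        rintro _ ⟨c, hc, rfl⟩
        exact (hL' c hc).1)
      have ha := (hL a (by simp)).1
      rw [List.map_cons, List.sum_cons, ← hs,
        ← intervalIntegral.integral_add_adjacent_intervals (b := a.1)
          (intervalIntegrable_draw (fun c hc => (hL c hc).2) _ _)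
          (intervalIntegrable_draw (fun c hc => (hL c hc).2) _ _)]
      have h1 : ∫ ξ in (0 : ℝ)..a.1, draw (a :: b :: L) ξ x = a.1 * a.2 x := by
        rw [intervalIntegral.integral_congr_ae (g := fun _ => a.2 x)]
        · simp
        · have : ∀ᵐ ξ : ℝ, ξ ≠ a.1 := by simp [ae_iff]
          filter_upwards [this] with ξ hξ hmem
          rw [Set.uIoc_of_le ha] at hmem
          simp [draw, lt_of_le_of_ne hmem.2 hξ]
      have h2 : ∫ ξ in a.1..(a.1 + s), draw (a :: b :: L) ξ x = combo (b :: L) x := by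
        rw [intervalIntegral.integral_congr (g := fun ξ => draw (b :: L) (ξ - a.1) x),
          intervalIntegral.integral_comp_sub_right fun ξ => draw (b :: L) ξ x]
        · simpa using ih'
        · intro ξ hξ
          rw [Set.uIcc_of_le (by linarith)] at hξ
          simp [draw, not_lt.2 hξ.1]
      rw [h1, h2]
      simp [combo]

theorem integral_draw_unitInterval {X : Type*} {C : Set (X → ℝ)} {L : List (ℝ × (X → ℝ))} {x : X}
    (hL : IsConvList C L) (hC : ∀ c ∈ C, |c x| ≤ 1) :
    ∫ ξ : unitInterval, draw L ξ x = combo L x := by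
  rw [← integral_draw (x := x) hL.1 fun a ha => ⟨(hL.2.1 a ha).1, hC _ (hL.2.1 a ha).2⟩, hL.2.2,
    intervalIntegral.integral_of_le zero_le_one, ← integral_Icc_eq_integral_Ioc]
  exact unitInterval.measurePreserving_coe.integral_comp
    (MeasurableEmbedding.subtype_coe measurableSet_Icc) fun ξ => draw L ξ x

/-! ### Resampling one coordinate of a run -/

theorem measurePreserving_resample_snd {α β V : Type*} [MeasurableSpace α] [MeasurableSpace β]
    [MeasurableSpace V] (μ : Measure α) {ρ : Measure β} {ν : Measure V} [SFinite μ] [SFinite ρ]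
    [SFinite ν] {f : β × V → β} (hf : MeasurePreserving f (ρ.prod ν) ρ) :
    MeasurePreserving (fun p : (α × β) × V => (p.1.1, f (p.1.2, p.2))) ((μ.prod ρ).prod ν)
      (μ.prod ρ) :=
  ((MeasurePreserving.id μ).prod hf).comp (measurePreserving_prodAssoc μ ρ ν)

theorem measurePreserving_resample_fst {α β V : Type*} [MeasurableSpace α] [MeasurableSpace β]
    [MeasurableSpace V] {μ : Measure α} (ρ : Measure β) {ν : Measure V} [SFinite μ] [SFinite ρ]
    [SFinite ν] {f : α × V → α} (hf : MeasurePreserving f (μ.prod ν) μ) :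
    MeasurePreserving (fun p : (α × β) × V => (f (p.1.1, p.2), p.1.2)) ((μ.prod ρ).prod ν)
      (μ.prod ρ) :=
  (Measure.measurePreserving_swap.comp (measurePreserving_resample_snd ρ hf)).comp
    ((Measure.measurePreserving_swap (μ := μ) (ν := ρ)).prod (MeasurePreserving.id ν))

section Resample

variable {X : Type*} [MeasurableSpace X] {T k : ℕ}

/-- Replace the `t`-th point of the calibrator. -/
def setCal (t : Fin T) (p : Runs X T k × (X × Bool)) : Runs X T k :=
  (Function.update p.1.1 (Fin.castAdd T t) p.2, p.1.2)

/-- Replace the `t`-th seed of the calibrator. -/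
def setSeed (t : Fin T) (p : Runs X T k × unitInterval) : Runs X T k :=
  (p.1.1, (Function.update p.1.2.1 t p.2, p.1.2.2))

/-- Replace the `t`-th seeds of the learner. -/
def setDraws (t : Fin T) (p : Runs X T k × (Fin k → unitInterval)) : Runs X T k :=
  (p.1.1, (p.1.2.1, Function.update p.1.2.2 t p.2))

variable (D : Measure (X × Bool)) [IsProbabilityMeasure D]

instance : IsProbabilityMeasure (law D T k) := by unfold law; infer_instance

theorem measurePreserving_setCal (t : Fin T) :
    MeasurePreserving (setCal (X := X) (k := k) t) ((law D T k).prod D) (law D T k) :=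
  measurePreserving_resample_fst _ (measurePreserving_update D (Fin.castAdd T t))

theorem measurePreserving_setSeed (t : Fin T) :
    MeasurePreserving (setSeed (X := X) (k := k) t) ((law D T k).prod volume) (law D T k) :=
  measurePreserving_resample_snd _ (measurePreserving_resample_fst _
    (measurePreserving_update (volume : Measure unitInterval) t))

theorem measurePreserving_setDraws (t : Fin T) :
    MeasurePreserving (setDraws (X := X) (k := k) t) ((law D T k).prod volume) (law D T k) :=
  measurePreserving_resample_snd _ (measurePreserving_resample_snd _
    (measurePreserving_update (volume : Measure (Fin k → unitInterval)) t))

theorem lrnPt_setCal (t : Fin T) (p : Runs X T k × (X × Bool)) :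
    lrnPt (setCal t p) = lrnPt p.1 := by
  funext i
  refine Function.update_of_ne ?_ _ _
  simp only [ne_eq, Fin.ext_iff, Fin.val_natAdd, Fin.val_castAdd]
  omega

theorem calPt_setCal_self (t : Fin T) (p : Runs X T k × (X × Bool)) :
    calPt (setCal t p) t = p.2 := Function.update_self _ _ _

theorem calPt_setCal_of_ne {s t : Fin T} (h : s ≠ t) (p : Runs X T k × (X × Bool)) :
    calPt (setCal t p) s = calPt p.1 s := by
  refine Function.update_of_ne ?_ _ _
  simpa [Fin.ext_iff] using h

theorem agree_setCal (t : Fin T) (p : Runs X T k × (X × Bool)) :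
    Agree t (setCal t p) p.1 :=
  ⟨lrnPt_setCal t p, fun _ hs =>
    ⟨calPt_setCal_of_ne (by rintro rfl; exact lt_irrefl _ hs) p, rfl, rfl⟩⟩

theorem agree_setSeed (t : Fin T) (p : Runs X T k × unitInterval) :
    Agree t (setSeed t p) p.1 :=
  ⟨rfl, fun _ hs =>
    ⟨rfl, Function.update_of_ne (by rintro rfl; exact lt_irrefl _ hs) _ _, rfl⟩⟩

theorem agree_setDraws (t : Fin T) (p : Runs X T k × (Fin k → unitInterval)) :
    Agree t (setDraws t p) p.1 :=
  ⟨rfl, fun _ hs =>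
    ⟨rfl, rfl, Function.update_of_ne (by rintro rfl; exact lt_irrefl _ hs) _ _⟩⟩

theorem Agree.mono {n m : ℕ} {ω ω' : Runs X T k} (h : Agree n ω ω') (hmn : m ≤ n) :
    Agree m ω ω' := ⟨h.1, fun t ht => h.2 t (ht.trans_le hmn)⟩

end Resample

section Events

variable {X : Type*} [MeasurableSpace X] {T k : ℕ} {O : List (X × ℝ) → X → ℝ} {disc : Bool}
  {D : Measure (X × Bool)} [IsProbabilityMeasure D] {C : Set (X → ℝ)}

/-- Expectations of tests that do not depend on the fresh sample point are close to the observed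
values. -/
theorem measure_test_deviation_le (hT : 0 < T) {g : Fin T → Runs X T k → X × Bool → ℝ}
    (hg : ∀ t, Measurable fun p : Runs X T k × (X × Bool) => g t p.1 p.2)
    (hb : ∀ t ω z, |g t ω z| ≤ 1)
    (hcongr : ∀ (t : Fin T) ω ω', Agree t ω ω' → ω.2.1 t = ω'.2.1 t → ω.2.2 t = ω'.2.2 t → g t ω = g t ω')
    {a : ℝ} (ha : 0 ≤ a) :
    law D T k {ω | a ≤ ∑ t, (∫ z, g t ω z ∂D - g t ω (calPt ω t))} ≤
      ENNReal.ofReal (Real.exp (-(a ^ 2 / (8 * T)))) := by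
  have hself : ∀ t p, g t (setCal t p) = g t p.1 := fun t p =>
    hcongr t _ _ (agree_setCal t p) rfl rfl
  have hint : ∀ t ω, |∫ z, g t ω z ∂D| ≤ 1 := fun t ω => by
    have := norm_integral_le_of_norm_le_const (μ := D) (f := g t ω) (C := 1)
      (.of_forall fun z => by rw [Real.norm_eq_abs]; exact hb t ω z)
    simpa using this
  have h := azuma (μ := law D T k) (ν := D) hT (fun t => setCal t)
    (measurePreserving_setCal D)
    (fun t ω => ∫ z, g t ω z ∂D - g t ω (calPt ω t))
    (fun t => (hg t).stronglyMeasurable.integral_prod_right.measurable.sub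
      ((hg t).comp (measurable_id.prodMk (measurable_calPt t))))
    (fun s t hst p => by
      have hne : s ≠ t := hst.ne
      have e : g s (setCal t p) = g s p.1 := hcongr s _ _
        ((agree_setCal t p).mono hst.le) rfl rfl
      simp only [e, calPt_setCal_of_ne hne])
    (b := 2) (m := 0) two_pos
    (fun t ω => (abs_sub _ _).trans (by linarith [hint t ω, hb t ω (calPt ω t)]))
    (fun t ω => by
      have hm : Measurable (g t ω) := (hg t).comp measurable_prodMk_left
      simp only [hself, calPt_setCal_self]
      rw [integral_sub (integrable_const _) (integrable_of_abs_le hm (hb t ω))]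
      simp) ha
  simp only [mul_zero, zero_add] at h
  refine h.trans_eq ?_
  congr 4
  ring

theorem convK_abs_le (hC : ∀ c ∈ C, Measurable c ∧ ∀ x, c x ∈ Set.Icc (-1 : ℝ) 1)
    (hO : IsERMOracle C O) (hk : 0 < k) (ω : Runs X T k) (t : Fin T) (x : X) :
    |hyp O disc ω t x| ≤ 1 :=
  abs_le.2 (convK_bounds (fun c hc => (hC c hc).2) (hyp_mem_convK hk hO ω t) x)

/-- The payoff of the randomized remapping against the current weights. -/
theorem measure_mixed_payoff_le (hT : 0 < T) (hk : 0 < k)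
    (hC : ∀ c ∈ C, Measurable c ∧ ∀ x, c x ∈ Set.Icc (-1 : ℝ) 1)
    (hO : IsERMOracle C O) (hOm : MeasurableOracle O) {a : ℝ} (ha : 0 ≤ a) :
    law D T k {ω | 1 + a ≤ ∑ t : Fin T, ∑ i, (stAt O disc ω t).w i * roundPayoff O disc ω t i} ≤
      ENNReal.ofReal (Real.exp (-(a ^ 2 / (2 * T)))) := by
  have hT' : (T : ℝ) ≠ 0 := by positivity
  have hq : ∀ (ω : Runs X T k) t x, |prep T disc (hyp O disc ω t x)| ≤ 1 := fun ω t x =>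
    abs_le.2 (prep_mem_Icc hT (abs_le.1 (convK_abs_le hC hO hk ω t x)))
  have h := azuma (μ := law D T k) (ν := (volume : Measure unitInterval)) hT (fun t => setSeed t)
    (measurePreserving_setSeed D)
    (fun t ω => ∑ i, (stAt O disc ω t).w i * roundPayoff O disc ω t i)
    (fun t => Finset.measurable_sum _ fun i _ =>
      ((measurable_stAt hOm t).1 i).mul (measurable_roundPayoff hOm t i))
    (fun s t hst p => by
      have hag := agree_setSeed t p
      simp only [stAt_congr O disc (hag.mono hst.le),
        roundPayoff_congr O disc (hag.mono (Nat.succ_le_of_lt hst))])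
    (b := 1) (m := 1 / T) one_pos
    (fun t ω => by
      rw [← sum_stAt_w O disc ω t]
      refine (Finset.abs_sum_le_sum_abs _ _).trans (Finset.sum_le_sum fun i _ => ?_)
      rw [abs_mul, abs_of_pos (stAt_w_pos O disc ω t i)]
      exact mul_le_of_le_one_right (stAt_w_pos O disc ω t i).le
        (abs_payoff_le (hq ω t _) (abs_residual_le ω t (calPt ω t)) i))
    (fun t ω => by
      have e : ∀ ζ, ∑ i, (stAt O disc (setSeed t (ω, ζ)) t).w i *
          roundPayoff O disc (setSeed t (ω, ζ)) t i =
          ∑ i, (stAt O disc ω t).w i * payoff T (prep T disc (hyp O disc ω t (calPt ω t).1))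
            (remap T (stAt O disc ω t).w ζ (prep T disc (hyp O disc ω t (calPt ω t).1)))
            (lab (calPt ω t).2) i := by
        intro ζ
        have hag := agree_setSeed t (ω, ζ)
        have e1 := stAt_congr O disc hag
        have e2 := hyp_congr O disc hag rfl
        simp only [roundPayoff, pred, link, e1, e2]
        have e3 : (setSeed t (ω, ζ)).2.1 t = ζ := Function.update_self _ _ _
        rw [e3]
        rfl
      simp only [e]
      exact integral_payoff_remap_le hT (fun i => (stAt_w_pos O disc ω t i).le)
        (sum_stAt_w O disc ω t) (hq ω t _) (lab_mem_Icc _).1 (lab_mem_Icc _).2) ha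
  rw [mul_one_div_cancel hT'] at h
  simpa using h

/-- Average distance, on the learner's sample, between the drawn average and the mixture. -/
def drawError (O : List (X × ℝ) → X → ℝ) (disc : Bool) (ω : Runs X T k) (t : Fin T) : ℝ :=
  (1 / (T : ℝ)) * ∑ i, |hyp O disc ω t (lrnPt ω i).1 - combo (mixList O disc ω t) (lrnPt ω i).1|

theorem integral_exp_draw_le (hk : 0 < k) {L : List (ℝ × (X → ℝ))} (hL : IsConvList C L) {x : X}
    (hC : ∀ c ∈ C, |c x| ≤ 1) (l : ℝ) :
    ∫ ξ : Fin k → unitInterval,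
      Real.exp (l * ((1 / (k : ℝ)) * ∑ i, draw L (ξ i) x - combo L x)) ≤
      Real.exp (2 * l ^ 2 / k) := by
  have hk' : (0 : ℝ) < k := by exact_mod_cast hk
  have hd1 : ∀ ξ : ℝ, |draw L ξ x| ≤ 1 := abs_draw_le fun a ha => hC _ (hL.2.1 a ha).2
  have hdm : Measurable fun ξ : unitInterval => draw L ξ x :=
    (measurable_draw_seed L x).comp measurable_subtype_coe
  have hdi : ∀ i : Fin k, Measurable fun ξ : Fin k → unitInterval => draw L (ξ i) x :=
    fun i => hdm.comp (measurable_pi_apply i)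
  set F : (Fin k → unitInterval) → ℝ := fun ξ => (1 / (k : ℝ)) * ∑ i, draw L (ξ i) x
  have hFm : Measurable F := by fun_prop
  have hFb : ∀ ξ, |F ξ| ≤ 1 := fun ξ => by
    rw [abs_mul, abs_of_pos (by positivity : (0 : ℝ) < 1 / k), one_div, inv_mul_le_iff₀ hk']
    exact abs_sum_le_of_abs_le fun i => hd1 _
  have hFd : ∀ ξ i a, |F (Function.update ξ i a) - F ξ| ≤ 2 / k := by
    intro ξ i a
    simp only [F]
    rw [← mul_sub, ← Finset.sum_sub_distrib,
      Finset.sum_eq_single i (fun j _ hj => by simp [hj]) (by simp), abs_mul,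
      abs_of_pos (by positivity : (0 : ℝ) < 1 / k), Function.update_self,
      div_eq_mul_one_div 2 (k : ℝ), mul_comm]
    gcongr
    exact (abs_sub _ _).trans (by linarith [hd1 a, hd1 (ξ i)])
  have hmean : ∫ ξ, F ξ = combo L x := by
    have hj : ∀ i : Fin k, ∫ ξ : Fin k → unitInterval, draw L (ξ i) x = combo L x := by
      intro i
      have he := measurePreserving_eval (fun _ : Fin k => (volume : Measure unitInterval)) i
      have := integral_map (μ := Measure.pi fun _ : Fin k => (volume : Measure unitInterval))
        (f := fun ξ : unitInterval => draw L ξ x) he.measurable.aemeasurable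
        hdm.aestronglyMeasurable
      rw [he.map_eq, integral_draw_unitInterval hL hC] at this
      exact this.symm
    simp only [F]
    rw [integral_const_mul, integral_finsetSum Finset.univ
      (f := fun i (ξ : Fin k → unitInterval) => draw L (ξ i) x)
      fun i _ => integrable_of_abs_le (hdi i) fun ξ => hd1 _]
    rw [Finset.sum_congr rfl fun i _ => hj i]
    simp only [Finset.sum_const, Finset.card_univ, Fintype.card_fin, nsmul_eq_mul]
    field_simp
  have h := integral_exp_le_of_bounded_differences (ν := (volume : Measure unitInterval)) (l := l)
    (by positivity : (0 : ℝ) ≤ 2 / k) hFm hFb hFd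
  rw [← volume_pi, hmean] at h
  refine h.trans_eq ?_
  congr 1
  field_simp

theorem lintegral_exp_abs_draw_le (hk : 0 < k) {L : List (ℝ × (X → ℝ))} (hL : IsConvList C L)
    {x : X} (hC : ∀ c ∈ C, |c x| ≤ 1) :
    ∫⁻ ξ : Fin k → unitInterval, ENNReal.ofReal (Real.exp (Real.sqrt k *
      |(1 / (k : ℝ)) * ∑ i, draw L (ξ i) x - combo L x|)) ≤ ENNReal.ofReal (Real.exp 3) := by
  have hk' : (0 : ℝ) < k := by exact_mod_cast hk
  have hdi : ∀ i : Fin k, Measurable fun ξ : Fin k → unitInterval => draw L (ξ i) x :=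
    fun i => (measurable_draw_seed L x).comp
      (measurable_subtype_coe.comp (measurable_pi_apply i))
  set G : (Fin k → unitInterval) → ℝ := fun ξ => (1 / (k : ℝ)) * ∑ i, draw L (ξ i) x - combo L x
  have hGm : Measurable G := by fun_prop
  have hd1 : ∀ ξ : ℝ, |draw L ξ x| ≤ 1 := abs_draw_le fun a ha => hC _ (hL.2.1 a ha).2
  have hGb : ∀ ξ, |G ξ| ≤ 1 + |combo L x| := fun ξ => by
    refine (abs_sub _ _).trans (add_le_add ?_ le_rfl)
    rw [abs_mul, abs_of_pos (by positivity : (0 : ℝ) < 1 / k), one_div, inv_mul_le_iff₀ hk']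
    exact abs_sum_le_of_abs_le fun i => hd1 _
  have hi : ∀ l : ℝ, Integrable (fun ξ => Real.exp (l * G ξ))
      (volume : Measure (Fin k → unitInterval)) := fun l => by
    refine integrable_of_abs_le (b := Real.exp (|l| * (1 + |combo L x|))) (by fun_prop) fun ξ => ?_
    rw [abs_of_pos (Real.exp_pos _), Real.exp_le_exp]
    refine (le_abs_self _).trans ?_
    rw [abs_mul]
    gcongr
    exact hGb ξ
  have hle : ∀ ξ, Real.exp (Real.sqrt k * |G ξ|) ≤
      Real.exp (Real.sqrt k * G ξ) + Real.exp (-Real.sqrt k * G ξ) := by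
    intro ξ
    rcases abs_cases (G ξ) with ⟨h, _⟩ | ⟨h, _⟩
    · rw [h]; linarith [Real.exp_pos (-Real.sqrt k * G ξ)]
    · rw [h, mul_neg, ← neg_mul]; linarith [Real.exp_pos (Real.sqrt k * G ξ)]
  have h2 : ∀ l : ℝ, l ^ 2 = k → ∫ ξ, Real.exp (l * G ξ) ≤ Real.exp 2 := by
    intro l hl
    have := integral_exp_draw_le hk hL hC l
    rwa [hl, mul_div_assoc, div_self hk'.ne', mul_one] at this
  have hs : Real.sqrt k ^ 2 = k := Real.sq_sqrt hk'.le
  calc _ ≤ ∫⁻ ξ, ENNReal.ofReal (Real.exp (Real.sqrt k * G ξ) + Real.exp (-Real.sqrt k * G ξ)) :=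
        lintegral_mono fun ξ => ENNReal.ofReal_le_ofReal (hle ξ)
    _ = ENNReal.ofReal (∫ ξ, (Real.exp (Real.sqrt k * G ξ) + Real.exp (-Real.sqrt k * G ξ))) := by
        rw [ofReal_integral_eq_lintegral_ofReal (f := fun ξ => Real.exp (Real.sqrt k * G ξ) +
          Real.exp (-Real.sqrt k * G ξ)) ((hi _).add (hi _))
          (.of_forall fun ξ => by simp only [Pi.zero_apply]; positivity)]
    _ ≤ _ := by
        refine ENNReal.ofReal_le_ofReal ?_
        rw [integral_add (hi _) (hi _)]
        have h3 : (2 : ℝ) * Real.exp 2 ≤ Real.exp 3 := by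
          rw [show (3 : ℝ) = 1 + 2 by norm_num, Real.exp_add]
          gcongr
          linarith [Real.add_one_le_exp (1 : ℝ)]
        linarith [h2 _ hs, h2 (-Real.sqrt k) (by rw [neg_sq, hs])]

theorem measurable_drawError (hOm : MeasurableOracle O) (t : Fin T) :
    Measurable fun ω : Runs X T k => drawError O disc ω t := by
  unfold drawError
  refine (Finset.measurable_sum _ fun i _ => ?_).const_mul _
  have hx : Measurable fun ω : Runs X T k => (ω, (lrnPt ω i).1) :=
    measurable_id.prodMk (measurable_fst.comp (measurable_lrnPt i))
  exact (((measurable_hyp hOm t).comp hx).sub ((measurable_mix hOm t).comp hx)).abs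

theorem drawError_congr {s : Fin T} {ω ω' : Runs X T k} (h : Agree (s + 1) ω ω') :
    drawError O disc ω s = drawError O disc ω' s := by
  have h' : Agree s ω ω' := h.mono (Nat.le_succ _)
  unfold drawError
  rw [hyp_congr O disc h' (h.2 s (Nat.lt_succ_self _)).2.2, mixList_congr O disc h', h.1]

theorem measure_drawError_le (hT : 0 < T) (hk : 0 < k)
    (hC : ∀ c ∈ C, Measurable c ∧ ∀ x, c x ∈ Set.Icc (-1 : ℝ) 1)
    (hO : IsERMOracle C O) (hOm : MeasurableOracle O) (a : ℝ) :
    law D T k {ω | a ≤ ∑ t, drawError O disc ω t} ≤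
      ENNReal.ofReal (Real.exp (3 * T - Real.sqrt k * a)) := by
  have hT' : (0 : ℝ) < T := by exact_mod_cast hT
  have h := lintegral_exp_sum_le (μ := law D T k)
    (ν := (volume : Measure (Fin k → unitInterval))) 3 (fun t => setDraws t)
    (measurePreserving_setDraws D)
    (fun t ω => Real.sqrt k * drawError O disc ω t)
    (fun t => (measurable_drawError hOm t).const_mul _)
    (fun s t hst p => by
      simp only [drawError_congr ((agree_setDraws t p).mono (Nat.succ_le_of_lt hst))])
    (fun t ω => by
      have hL : IsConvList C (mixList O disc ω t) := isConvList_fwList _ _ _ hO _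
      have hag := fun ξ => agree_setDraws t (ω, ξ)
      set d : Fin T → (Fin k → unitInterval) → ℝ := fun i ξ =>
        |(1 / (k : ℝ)) * ∑ j, draw (mixList O disc ω t) (ξ j) (lrnPt ω i).1 -
          combo (mixList O disc ω t) (lrnPt ω i).1| with hd
      have e : ∀ ξ, drawError O disc (setDraws t (ω, ξ)) t = ∑ i, (1 / (T : ℝ)) * d i ξ := by
        intro ξ
        simp only [drawError, hyp, mixList_congr O disc (hag ξ), (hag ξ).1, Finset.mul_sum, hd]
        have e3 : (setDraws t (ω, ξ)).2.2 t = ξ := Function.update_self _ _ _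
        rw [e3]
      have hj : ∀ ξ, Real.exp (Real.sqrt k * ∑ i, (1 / (T : ℝ)) * d i ξ) ≤
          ∑ i, (1 / (T : ℝ)) * Real.exp (Real.sqrt k * d i ξ) := by
        intro ξ
        have := convexOn_exp.map_sum_le (t := Finset.univ) (w := fun _ : Fin T => 1 / (T : ℝ))
          (p := fun i => Real.sqrt k * d i ξ) (fun _ _ => by positivity)
          (by simp [hT'.ne']) (fun _ _ => Set.mem_univ _)
        simp only [smul_eq_mul] at this
        refine le_trans (le_of_eq ?_) this
        rw [Finset.mul_sum]
        exact congrArg _ (Finset.sum_congr rfl fun i _ => by ring)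
      have hdm : ∀ i, Measurable (d i) := by
        intro i
        have := fun j : Fin k => (measurable_draw_seed (mixList O disc ω t) (lrnPt ω i).1).comp
          (measurable_subtype_coe.comp (measurable_pi_apply (X := fun _ => unitInterval) j))
        simp only [Function.comp_def] at this
        simp only [hd, ← Real.norm_eq_abs]
        fun_prop
      simp only [e]
      calc _ ≤ ∫⁻ ξ, ∑ i, ENNReal.ofReal (1 / (T : ℝ)) *
            ENNReal.ofReal (Real.exp (Real.sqrt k * d i ξ)) := by
            refine lintegral_mono fun ξ => (ENNReal.ofReal_le_ofReal (hj ξ)).trans_eq ?_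
            rw [ENNReal.ofReal_sum_of_nonneg fun i _ => by positivity]
            exact Finset.sum_congr rfl fun i _ => ENNReal.ofReal_mul (by positivity)
        _ = ∑ i, ENNReal.ofReal (1 / (T : ℝ)) *
            ∫⁻ ξ, ENNReal.ofReal (Real.exp (Real.sqrt k * d i ξ)) := by
            rw [lintegral_finsetSum _ fun i _ => by have := hdm i; fun_prop]
            refine Finset.sum_congr rfl fun i _ => lintegral_const_mul _ ?_
            have := hdm i
            fun_prop
        _ ≤ ∑ i : Fin T, ENNReal.ofReal (1 / (T : ℝ)) * ENNReal.ofReal (Real.exp 3) := by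
            gcongr with i
            exact lintegral_exp_abs_draw_le hk hL fun c hc => abs_le.2 ((hC c hc).2 _)
        _ = _ := by
            rw [← Finset.sum_mul, ← ENNReal.ofReal_sum_of_nonneg fun i _ => by positivity]
            simp [hT'.ne'])
  simp only [← Finset.mul_sum] at h
  have hm : Measurable fun ω : Runs X T k => Real.sqrt k * ∑ t, drawError O disc ω t :=
    (Finset.measurable_sum _ fun t _ => measurable_drawError hOm t).const_mul _
  refine (measure_mono fun ω hω => ?_).trans ((measure_ge_le_of_lintegral_exp_le hm h
    (Real.sqrt k * a)).trans_eq (by rw [mul_comm (T : ℝ) 3]))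
  exact mul_le_mul_of_nonneg_left hω (Real.sqrt_nonneg _)

end Events

/-! ### Uniform convergence on the learner's sample -/

section Uniform

variable {X : Type*} [MeasurableSpace X] {O : List (X × ℝ) → X → ℝ} {C F : Set (X → ℝ)}

theorem abs_weighted_sum_le {n : ℕ} (a : Fin n → ℝ) {f : Fin n → ℝ} (hf : ∀ j, |f j| ≤ 1) :
    |∑ j, a j * f j| ≤ ∑ j, |a j| := by
  refine (Finset.abs_sum_le_sum_abs _ _).trans (Finset.sum_le_sum fun j _ => ?_)
  rw [abs_mul]
  exact mul_le_of_le_one_right (abs_nonneg _) (hf j)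

theorem measurable_ciSup_oracle (hC : ∀ c ∈ C, ∀ x, |c x| ≤ 1) (hO : IsERMOracle C O)
    (hOm : MeasurableOracle O) {W : Type*} [MeasurableSpace W] {n : ℕ} {b : Fin n → W → ℝ}
    {x : Fin n → W → X} (hb : ∀ j, Measurable (b j)) (hx : ∀ j, Measurable (x j)) :
    Measurable fun w => ⨆ c : C, ∑ j, b j w * c.1 (x j w) := by
  have e : (fun w => ⨆ c : C, ∑ j, b j w * c.1 (x j w)) = fun w =>
      ∑ j, b j w * O (List.ofFn fun i => (x i w, -b i w)) (x j w) := by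
    funext w
    have h := hO (List.ofFn fun i => (x i w, -b i w))
    have : Nonempty C := ⟨⟨_, h.1⟩⟩
    refine le_antisymm (ciSup_le fun c => ?_) ?_
    · have := h.2 c.1 c.2
      simp only [List.map_ofFn, List.sum_ofFn, Function.comp_def, mul_neg,
        Finset.sum_neg_distrib] at this
      simp only [mul_comm (b _ w)]
      linarith
    · exact le_ciSup (f := fun c : C => ∑ j, b j w * c.1 (x j w))
        (bddAbove_of_abs_le fun c => abs_weighted_sum_le _ fun j => hC _ c.2 _) ⟨_, h.1⟩
  rw [e]
  refine Finset.measurable_sum _ fun j _ => (hb j).mul ?_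
  have hq : Measurable fun w => ((fun i => (x i w, -b i w) : Fin n → X × ℝ), x j w) :=
    (measurable_pi_lambda _ fun i => (hx i).prodMk (hb i).neg).prodMk (hx j)
  exact (hOm n).comp hq

/-- Products of hypotheses and sign functions. -/
def prodFam (C F : Set (X → ℝ)) (p : C × F) (z : X × Bool) : ℝ := p.1.1 z.1 * p.2.1 z.1

/-- Products of hypotheses and labels. -/
def labFam (C : Set (X → ℝ)) (c : C) (z : X × Bool) : ℝ := c.1 z.1 * lab z.2

theorem abs_prodFam_le (hC : ∀ c ∈ C, ∀ x, |c x| ≤ 1) (hF : ∀ g ∈ F, ∀ x, g x = 1 ∨ g x = -1)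
    (p : C × F) (z : X × Bool) : |prodFam C F p z| ≤ 1 := by
  unfold prodFam
  rcases hF _ p.2.2 z.1 with h | h <;> rw [h] <;> simpa using hC _ p.1.2 z.1

theorem abs_labFam_le (hC : ∀ c ∈ C, ∀ x, |c x| ≤ 1) (c : C) (z : X × Bool) :
    |labFam C c z| ≤ 1 := by
  unfold labFam
  rw [abs_mul]
  have := lab_mem_Icc z.2
  exact mul_le_one₀ (hC _ c.2 _) (abs_nonneg _) (abs_le.2 ⟨by linarith [this.1], this.2⟩)

theorem measurable_ciSup_labFam (hC : ∀ c ∈ C, ∀ x, |c x| ≤ 1) (hO : IsERMOracle C O)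
    (hOm : MeasurableOracle O) (n : ℕ) (a : Fin n → ℝ) :
    Measurable fun z : Fin n → X × Bool => ⨆ c, ∑ j, a j * labFam C c (z j) := by
  have := measurable_ciSup_oracle hC hO hOm
    (b := fun j (z : Fin n → X × Bool) => a j * lab (z j).2)
    (x := fun j (z : Fin n → X × Bool) => (z j).1)
    (fun j => (measurable_lab.comp (measurable_snd.comp (measurable_pi_apply j))).const_mul _)
    (fun j => measurable_fst.comp (measurable_pi_apply j))
  have e : (fun z : Fin n → X × Bool => ⨆ c, ∑ j, a j * labFam C c (z j)) =
      fun z => ⨆ c : C, ∑ j, a j * lab (z j).2 * c.1 (z j).1 := by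
    funext z
    refine iSup_congr fun c => Finset.sum_congr rfl fun j _ => ?_
    unfold labFam
    ring
  rw [e]
  exact this

theorem measurable_ciSup_prodFam (hC : ∀ c ∈ C, ∀ x, |c x| ≤ 1) (hO : IsERMOracle C O)
    (hOm : MeasurableOracle O) (hF : ∀ g ∈ F, ∀ x, g x = 1 ∨ g x = -1) (hF0 : F.Nonempty)
    (hFsup : SupMeasurable F) (n : ℕ) (a : Fin n → ℝ) :
    Measurable fun z : Fin n → X × Bool => ⨆ p, ∑ j, a j * prodFam C F p (z j) := by
  have : Nonempty C := ⟨⟨_, (hO []).1⟩⟩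
  have : Nonempty F := hF0.to_subtype
  have hFb : ∀ g ∈ F, ∀ x, |g x| ≤ 1 := fun g hg x => by
    rcases hF g hg x with h | h <;> simp [h]
  have hx : Measurable fun (z : Fin n → X × Bool) j => (z j).1 :=
    measurable_pi_lambda _ fun j => measurable_fst.comp (measurable_pi_apply j)
  refine measurable_of_Ioi fun r => ?_
  have e : (fun z : Fin n → X × Bool => ⨆ p, ∑ j, a j * prodFam C F p (z j)) ⁻¹' Set.Ioi r =
      ⋃ s : Fin n → Bool, {z | (n : ℝ) - 1 < ⨆ g : F, ∑ j, sgn (s j) * g.1 (z j).1} ∩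
        {z | r < ⨆ c : C, ∑ j, (a j * sgn (s j)) * c.1 (z j).1} := by
    ext z
    simp only [Set.mem_preimage, Set.mem_Ioi, Set.mem_iUnion, Set.mem_inter_iff, Set.mem_ofPred_eq]
    rw [lt_ciSup_iff (bddAbove_of_abs_le fun p => abs_weighted_sum_le a fun j =>
      abs_prodFam_le hC hF p (z j))]
    constructor
    · rintro ⟨p, hp⟩
      have hs : ∀ j, ∃ s : Bool, p.2.1 (z j).1 = sgn s := fun j => by
        rcases hF _ p.2.2 (z j).1 with h | h
        · exact ⟨true, h⟩
        · exact ⟨false, h⟩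
      choose s hs using hs
      refine ⟨s, (lt_ciSup_iff (bddAbove_of_abs_le fun g : F => abs_weighted_sum_le
        (fun j => sgn (s j)) fun j => hFb _ g.2 (z j).1)).2 ⟨p.2, ?_⟩,
        (lt_ciSup_iff (bddAbove_of_abs_le fun c : C => abs_weighted_sum_le
        (fun j => a j * sgn (s j)) fun j => hC _ c.2 (z j).1)).2 ⟨p.1, ?_⟩⟩
      · have : ∀ j, sgn (s j) * p.2.1 (z j).1 = 1 := fun j => by
          rw [hs]; cases s j <;> simp [sgn]
        simp [this]
      · refine hp.trans_eq (Finset.sum_congr rfl fun j _ => ?_)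
        rw [prodFam, hs]; ring
    · rintro ⟨s, h1, h2⟩
      obtain ⟨g, hg⟩ := exists_lt_of_lt_ciSup h1
      obtain ⟨c, hc⟩ := exists_lt_of_lt_ciSup h2
      have hle : ∀ j, sgn (s j) * g.1 (z j).1 ≤ 1 := fun j => by
        refine (le_abs_self _).trans ?_
        rw [abs_mul, abs_sgn, one_mul]
        exact hFb _ g.2 _
      have heq : ∀ j, g.1 (z j).1 = sgn (s j) := by
        intro j
        by_contra hne
        have hj : sgn (s j) * g.1 (z j).1 = -1 := by
          rcases hF _ g.2 (z j).1 with h | h <;> cases hs : s j <;> simp_all [sgn]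
        have hsum : ∑ i, sgn (s i) * g.1 (z i).1 ≤ ∑ i : Fin n, (if i = j then -1 else 1 : ℝ) :=
          Finset.sum_le_sum fun i _ => by
            split_ifs with hi
            · rw [hi, hj]
            · exact hle i
        have h3 : ∑ i : Fin n, (if i = j then -1 else 1 : ℝ) = n - 2 := by
          have : ∀ i : Fin n, (if i = j then -1 else 1 : ℝ) = 1 - if i = j then 2 else 0 := by
            intro i; split_ifs <;> norm_num
          simp [this, Finset.sum_sub_distrib]
        linarith
      refine ⟨(c, g), hc.trans_eq (Finset.sum_congr rfl fun j _ => ?_)⟩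
      rw [prodFam, heq]; ring
  rw [e]
  refine MeasurableSet.iUnion fun s => (measurableSet_lt measurable_const ?_).inter
    (measurableSet_lt measurable_const ?_)
  · exact (hFsup n fun j => sgn (s j)).comp hx
  · exact measurable_ciSup_oracle hC hO hOm (b := fun j (_ : Fin n → X × Bool) => a j * sgn (s j))
      (x := fun j (z : Fin n → X × Bool) => (z j).1) (fun _ => measurable_const)
      (fun j => measurable_fst.comp (measurable_pi_apply j))

theorem integral_radAvg_marginal {T : ℕ} (D : Measure (X × Bool)) [IsProbabilityMeasure D]
    (hFsup : SupMeasurable F) :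
    ∫ z : Fin T → X × Bool, radAvg (fun (f : F) x => f.1 x) (fun j => (z j).1)
      ∂(Measure.pi fun _ => D) = rad T (D.map Prod.fst) F := by
  have : IsProbabilityMeasure (D.map Prod.fst) :=
    Measure.isProbabilityMeasure_map measurable_fst.aemeasurable
  have hmp : MeasurePreserving (fun (z : Fin T → X × Bool) j => (z j).1)
      (Measure.pi fun _ => D) (Measure.pi fun _ => D.map Prod.fst) :=
    measurePreserving_pi _ _ fun _ => ⟨measurable_fst, rfl⟩
  unfold rad
  rw [← hmp.map_eq, integral_map hmp.measurable.aemeasurable]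
  · rfl
  · exact (measurable_radAvg (hFsup T)).aestronglyMeasurable

theorem supMeasurable_of_oracle (hC : ∀ c ∈ C, ∀ x, |c x| ≤ 1) (hO : IsERMOracle C O)
    (hOm : MeasurableOracle O) : SupMeasurable C := by
  intro n a
  have h := measurable_ciSup_oracle hC hO hOm (b := fun j (_ : Fin n → X) => a j)
    (x := fun j (x : Fin n → X) => x j) (fun _ => measurable_const)
    (fun j => measurable_pi_apply j)
  exact h

theorem integrable_radAvg_marginal {T : ℕ} (D : Measure (X × Bool)) [IsProbabilityMeasure D]
    (hF0 : F.Nonempty) (hF : ∀ f ∈ F, ∀ x, |f x| ≤ 1) (hFsup : SupMeasurable F) :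
    Integrable (fun z : Fin T → X × Bool => radAvg (fun (f : F) x => f.1 x) fun j => (z j).1)
      (Measure.pi fun _ => D) := by
  have : Nonempty F := hF0.to_subtype
  have hx : Measurable fun (z : Fin T → X × Bool) j => (z j).1 :=
    measurable_pi_lambda _ fun j => measurable_fst.comp (measurable_pi_apply j)
  exact integrable_of_abs_le ((measurable_radAvg (hFsup T)).comp hx)
    fun z => abs_radAvg_le zero_le_one (fun f x => hF _ f.2 x) _

theorem rad_nonneg {T : ℕ} (μ : Measure X) (hF0 : F.Nonempty) (hF : ∀ f ∈ F, ∀ x, |f x| ≤ 1) :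
    0 ≤ rad T μ F := by
  have : Nonempty F := hF0.to_subtype
  exact integral_nonneg fun x =>
    radAvg_nonneg (f := fun (f : F) x => f.1 x) (fun f x => hF _ f.2 x) x

theorem integral_radAvg_labFam_le {T : ℕ} (D : Measure (X × Bool)) [IsProbabilityMeasure D]
    (hC : ∀ c ∈ C, ∀ x, |c x| ≤ 1) (hO : IsERMOracle C O) (hOm : MeasurableOracle O) :
    ∫ z : Fin T → X × Bool, radAvg (labFam C) z ∂(Measure.pi fun _ => D) ≤
      rad T (D.map Prod.fst) C := by
  have hC0 : C.Nonempty := ⟨_, (hO []).1⟩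
  have : Nonempty C := hC0.to_subtype
  rw [← integral_radAvg_marginal D (supMeasurable_of_oracle hC hO hOm)]
  refine integral_mono (integrable_of_abs_le (measurable_radAvg
      (measurable_ciSup_labFam hC hO hOm T)) fun z =>
      abs_radAvg_le zero_le_one (abs_labFam_le hC) z)
    (integrable_radAvg_marginal D hC0 hC (supMeasurable_of_oracle hC hO hOm)) fun z => ?_
  refine radAvg_le_of_abs_sub_le (M := 1) (abs_labFam_le hC) (fun c x => hC _ c.2 x)
    fun c d j => ?_
  unfold labFam
  rw [← sub_mul, abs_mul]
  have := lab_mem_Icc (z j).2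
  exact mul_le_of_le_one_right (abs_nonneg _) (abs_le.2 ⟨by linarith [this.1], this.2⟩)

theorem abs_mul_sub_mul_le_of_sign {c c' g g' : ℝ} (hc : |c| ≤ 1) (hc' : |c'| ≤ 1)
    (hg : g = 1 ∨ g = -1) (hg' : g' = 1 ∨ g' = -1) :
    |c * g - c' * g'| ≤ |c + g - (c' + g')| := by
  rw [abs_le] at hc hc'
  rcases hg with rfl | rfl <;> rcases hg' with rfl | rfl
  · simp
  · rw [abs_of_nonneg (by linarith : 0 ≤ c + 1 - (c' + -1)), abs_le]
    constructor <;> linarith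
  · rw [abs_of_nonpos (by linarith : c + -1 - (c' + 1) ≤ 0), abs_le]
    constructor <;> linarith
  · rw [show c * -1 - c' * -1 = -(c - c') by ring, abs_neg]
    simp

theorem integral_radAvg_prodFam_le {T : ℕ} (D : Measure (X × Bool)) [IsProbabilityMeasure D]
    (hC : ∀ c ∈ C, ∀ x, |c x| ≤ 1) (hO : IsERMOracle C O) (hOm : MeasurableOracle O)
    (hF : ∀ g ∈ F, ∀ x, g x = 1 ∨ g x = -1) (hF0 : F.Nonempty) (hFsup : SupMeasurable F) :
    ∫ z : Fin T → X × Bool, radAvg (prodFam C F) z ∂(Measure.pi fun _ => D) ≤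
      rad T (D.map Prod.fst) C + rad T (D.map Prod.fst) F := by
  have hC0 : C.Nonempty := ⟨_, (hO []).1⟩
  have : Nonempty C := hC0.to_subtype
  have : Nonempty F := hF0.to_subtype
  have hFb : ∀ g ∈ F, ∀ x, |g x| ≤ 1 := fun g hg x => by
    rcases hF g hg x with h | h <;> simp [h]
  have i1 := integrable_radAvg_marginal (T := T) D hC0 hC (supMeasurable_of_oracle hC hO hOm)
  have i2 := integrable_radAvg_marginal (T := T) D hF0 hFb hFsup
  rw [← integral_radAvg_marginal D (supMeasurable_of_oracle hC hO hOm),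
    ← integral_radAvg_marginal D hFsup, ← integral_add i1 i2]
  refine integral_mono (integrable_of_abs_le (measurable_radAvg
      (measurable_ciSup_prodFam hC hO hOm hF hF0 hFsup T)) fun z =>
      abs_radAvg_le zero_le_one (abs_prodFam_le hC hF) z) (i1.add i2) fun z => ?_
  refine le_trans ?_ (radAvg_add_le (M := 1) (f := fun (c : C) x => c.1 x)
    (g := fun (g : F) x => g.1 x) (fun c x => hC _ c.2 x) (fun g x => hFb _ g.2 x) _)
  refine radAvg_le_of_abs_sub_le (M := 2) (fun p z => (abs_prodFam_le hC hF p z).trans one_le_two)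
    (fun p x => (abs_add_le _ _).trans (by linarith [hC _ p.1.2 x, hFb _ p.2.2 x]))
    fun p p' j => abs_mul_sub_mul_le_of_sign (hC _ p.1.2 _) (hC _ p'.1.2 _) (hF _ p.2.2 _)
      (hF _ p'.2.2 _)

variable {T k : ℕ} {D : Measure (X × Bool)} [IsProbabilityMeasure D]

theorem measurePreserving_lrnPt :
    MeasurePreserving (fun (ω : Runs X T k) => lrnPt ω) (law D T k) (Measure.pi fun _ => D) :=
  (measurePreserving_reindex D (Fin.natAdd T) (Fin.natAdd_injective T T)).comp
    measurePreserving_fst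

theorem measure_lrnPt_le {s : Set (Fin T → X × Bool)} {b : ENNReal}
    (h : (Measure.pi fun _ => D) s ≤ b) : law D T k {ω | lrnPt ω ∈ s} ≤ b := by
  refine le_trans ?_ h
  exact (measurePreserving_lrnPt (k := k)).measure_preimage_le s

theorem measure_uniform_prod_le (hT : 0 < T)
    (hC : ∀ c ∈ C, Measurable c ∧ ∀ x, c x ∈ Set.Icc (-1 : ℝ) 1) (hO : IsERMOracle C O)
    (hOm : MeasurableOracle O) (hF : ∀ g ∈ F, ∀ x, g x = 1 ∨ g x = -1)
    (hFm : ∀ g ∈ F, Measurable g) (hF0 : F.Nonempty) (hFsup : SupMeasurable F) {a : ℝ}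
    (ha : 0 ≤ a) :
    law D T k {ω | ¬ ∀ c ∈ C, ∀ g ∈ F, ∫ z, c z.1 * g z.1 ∂D -
      (1 / (T : ℝ)) * ∑ i, c (lrnPt ω i).1 * g (lrnPt ω i).1 ≤
        2 * (rad T (D.map Prod.fst) C + rad T (D.map Prod.fst) F) + a} ≤
      ENNReal.ofReal (Real.exp (-(T * a ^ 2 / 8))) := by
  have hC' : ∀ c ∈ C, ∀ x, |c x| ≤ 1 := fun c hc x => abs_le.2 ((hC c hc).2 x)
  have : Nonempty C := ⟨⟨_, (hO []).1⟩⟩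
  have : Nonempty F := hF0.to_subtype
  have h := uniform_convergence (ν := D) (f := prodFam C F) (n := T)
    (fun p => ((hC _ p.1.2).1.comp measurable_fst).mul ((hFm _ p.2.2).comp measurable_fst))
    (abs_prodFam_le hC' hF) (measurable_ciSup_prodFam hC' hO hOm hF hF0 hFsup) hT
    (integral_radAvg_prodFam_le D hC' hO hOm hF hF0 hFsup) ha
  refine (measure_mono fun ω hω => ?_).trans (measure_lrnPt_le (k := k) h)
  exact fun hall => hω fun c hc g hg => hall (⟨c, hc⟩, ⟨g, hg⟩)

theorem measure_uniform_lab_le (hT : 0 < T)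
    (hC : ∀ c ∈ C, Measurable c ∧ ∀ x, c x ∈ Set.Icc (-1 : ℝ) 1) (hO : IsERMOracle C O)
    (hOm : MeasurableOracle O) {a : ℝ} (ha : 0 ≤ a) :
    law D T k {ω | ¬ ∀ c ∈ C, ∫ z, c z.1 * lab z.2 ∂D -
      (1 / (T : ℝ)) * ∑ i, c (lrnPt ω i).1 * lab (lrnPt ω i).2 ≤
        2 * rad T (D.map Prod.fst) C + a} ≤
      ENNReal.ofReal (Real.exp (-(T * a ^ 2 / 8))) := by
  have hC' : ∀ c ∈ C, ∀ x, |c x| ≤ 1 := fun c hc x => abs_le.2 ((hC c hc).2 x)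
  have : Nonempty C := ⟨⟨_, (hO []).1⟩⟩
  have h := uniform_convergence (ν := D) (f := labFam C) (n := T)
    (fun c => ((hC _ c.2).1.comp measurable_fst).mul (measurable_lab.comp measurable_snd))
    (abs_labFam_le hC') (measurable_ciSup_labFam hC' hO hOm) hT
    (integral_radAvg_labFam_le D hC' hO hOm) ha
  refine (measure_mono fun ω hω => ?_).trans (measure_lrnPt_le (k := k) h)
  exact fun hall => hω fun c hc => hall ⟨c, hc⟩

end Uniform

/-! ### From thresholds to monotone functions -/

section Pairing

variable {X : Type*} [MeasurableSpace X] {m : ℕ}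

/-- Integration against a bounded weight, minus a finite weighted sum. -/
def pairing (D : Measure (X × Bool)) (w : X × Bool → ℝ) (x : Fin m → X) (b : Fin m → ℝ)
    (φ : X → ℝ) : ℝ := ∫ z, φ z.1 * w z ∂D - ∑ i, b i * φ (x i)

variable {D : Measure (X × Bool)} [IsProbabilityMeasure D] {w : X × Bool → ℝ} {x : Fin m → X}
  {b : Fin m → ℝ}

theorem integrable_pairing (hw : Measurable w) {W : ℝ} (hwb : ∀ z, |w z| ≤ W) {φ : X → ℝ}
    (hφ : Measurable φ) {M : ℝ} (hM : ∀ x, |φ x| ≤ M) : Integrable (fun z => φ z.1 * w z) D := by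
  refine integrable_of_abs_le (b := M * W) ((hφ.comp measurable_fst).mul hw) fun z => ?_
  rw [abs_mul]
  exact mul_le_mul (hM _) (hwb z) (abs_nonneg _) ((abs_nonneg _).trans (hM z.1))

theorem pairing_add (hw : Measurable w) {W : ℝ} (hwb : ∀ z, |w z| ≤ W) {φ ψ : X → ℝ}
    (hφ : Measurable φ) {M : ℝ} (hM : ∀ x, |φ x| ≤ M) (hψ : Measurable ψ) {M' : ℝ}
    (hM' : ∀ x, |ψ x| ≤ M') :
    pairing D w x b (fun x => φ x + ψ x) = pairing D w x b φ + pairing D w x b ψ := by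
  unfold pairing
  simp only [add_mul, mul_add, Finset.sum_add_distrib]
  rw [integral_add (integrable_pairing hw hwb hφ hM) (integrable_pairing hw hwb hψ hM')]
  ring

theorem pairing_const_mul (r : ℝ) (φ : X → ℝ) :
    pairing D w x b (fun x => r * φ x) = r * pairing D w x b φ := by
  unfold pairing
  rw [mul_sub, Finset.mul_sum, ← integral_const_mul]
  congr 1
  · exact integral_congr_ae (.of_forall fun z => mul_assoc _ _ _)
  · exact Finset.sum_congr rfl fun i _ => by ring

theorem pairing_sum (hw : Measurable w) {W : ℝ} (hwb : ∀ z, |w z| ≤ W) {ι : Type*} (s : Finset ι)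
    {φ : ι → X → ℝ} (hφ : ∀ j, Measurable (φ j)) {M : ℝ} (hM : ∀ j x, |φ j x| ≤ M) :
    pairing D w x b (fun x => ∑ j ∈ s, φ j x) = ∑ j ∈ s, pairing D w x b (φ j) := by
  unfold pairing
  simp only [Finset.sum_mul, Finset.mul_sum]
  rw [integral_finsetSum s fun j _ => integrable_pairing hw hwb (hφ j) (hM j),
    Finset.sum_sub_distrib, Finset.sum_comm]

theorem tendsto_pairing (hw : Measurable w) {W : ℝ} (hwb : ∀ z, |w z| ≤ W) {φ : ℕ → X → ℝ}
    (hφ : ∀ n, Measurable (φ n)) {M : ℝ} (hM : ∀ n x, |φ n x| ≤ M) {ψ : X → ℝ}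
    (h : ∀ x, ∀ᶠ n in Filter.atTop, φ n x = ψ x) :
    Filter.Tendsto (fun n => pairing D w x b (φ n)) Filter.atTop (nhds (pairing D w x b ψ)) := by
  have ht : ∀ x, Filter.Tendsto (fun n => φ n x) Filter.atTop (nhds (ψ x)) := fun x =>
    tendsto_const_nhds.congr' ((h x).mono fun n hn => hn.symm)
  unfold pairing
  refine Filter.Tendsto.sub ?_ (tendsto_finsetSum _ fun i _ => (ht _).const_mul _)
  refine tendsto_integral_of_dominated_convergence (fun _ => M * W)
    (fun n => (((hφ n).comp measurable_fst).mul hw).aestronglyMeasurable) (integrable_const _)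
    (fun n => .of_forall fun z => ?_) (.of_forall fun z => (ht z.1).mul_const _)
  rw [Real.norm_eq_abs, abs_mul]
  exact mul_le_mul (hM n _) (hwb z) (abs_nonneg _) ((abs_nonneg _).trans (hM n z.1))

theorem prep_prep {T : ℕ} {disc : Bool} (hT : 0 < T) (a : ℝ) :
    prep T disc (prep T disc a) = prep T disc a := by
  have hT' : (T : ℝ) ≠ 0 := by positivity
  cases disc
  · rfl
  · simp only [prep, if_true]
    rw [div_mul_cancel₀ _ hT', Int.ceil_intCast]

theorem le_prep {T : ℕ} {disc : Bool} (hT : 0 < T) (a : ℝ) : a ≤ prep T disc a := by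
  have hT' : (0 : ℝ) < T := by exact_mod_cast hT
  cases disc
  · exact le_rfl
  · simp only [prep, if_true]
    rw [le_div_iff₀ hT']
    exact Int.le_ceil _

/-- An upper set that is not everything is a limit of open half-lines. -/
theorem exists_thresholds {T : ℕ} {disc : Bool} (hT : 0 < T) {lo : ℝ} (hlo : lo ≤ 1)
    (hprep : ∀ a ∈ Set.Icc lo 1, prep T disc a ∈ Set.Icc lo 1) {U : Set ℝ} (hU : IsUpperSet U)
    (hUp : ∀ a, prep T disc a ∈ U → a ∈ U) (hloU : lo ∉ U) :
    ∃ θ : ℕ → ℝ, (∀ n, θ n ∈ Set.Icc lo 1 ∧ (disc = true → ∃ j : ℤ, θ n = (j : ℝ) / T)) ∧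
      ∀ a ∈ Set.Icc lo 1, ∀ᶠ n in Filter.atTop,
        (1 / 2) * (1 - thr (θ n) a) = Set.indicator U (fun _ => (1 : ℝ)) a := by
  set S : Set ℝ := {a | a ∈ Set.Icc lo 1 ∧ a ∉ U} with hS
  have hS0 : S.Nonempty := ⟨lo, ⟨le_rfl, hlo⟩, hloU⟩
  have hSb : BddAbove S := ⟨1, fun a ha => ha.1.2⟩
  have hseq : ∃ τ : ℕ → ℝ, (∀ n, τ n ∈ S) ∧ ∀ a ∈ S, ∀ᶠ n in Filter.atTop, a ≤ τ n := by
    by_cases hmax : sSup S ∈ S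
    · exact ⟨fun _ => sSup S, fun _ => hmax, fun a ha => .of_forall fun _ => le_csSup hSb ha⟩
    · obtain ⟨u, _, htend, hu⟩ := exists_seq_tendsto_sSup hS0 hSb
      refine ⟨u, hu, fun a ha => ?_⟩
      have hlt : a < sSup S := lt_of_le_of_ne (le_csSup hSb ha) fun h => hmax (h ▸ ha)
      exact (htend.eventually (lt_mem_nhds hlt)).mono fun n hn => hn.le
  obtain ⟨τ, hτ, hev⟩ := hseq
  refine ⟨fun n => prep T disc (τ n), fun n => ⟨hprep _ (hτ n).1, fun hd => ?_⟩, fun a ha => ?_⟩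
  · subst hd
    exact ⟨⌈τ n * T⌉, by simp [prep]⟩
  · by_cases haU : a ∈ U
    · refine .of_forall fun n => ?_
      have hlt : prep T disc (τ n) < a := by
        by_contra hle
        exact (hτ n).2 (hUp _ (hU (not_lt.1 hle) haU))
      rw [Set.indicator_of_mem haU, thr, if_neg (not_le.2 hlt)]
      norm_num
    · refine (hev a ⟨ha, haU⟩).mono fun n hn => ?_
      rw [Set.indicator_of_notMem haU, thr, if_pos (hn.trans (le_prep hT _))]
      norm_num

variable {T : ℕ} {disc : Bool} {lo : ℝ}

/-- If the pairing is small on thresholds of `q`, then it is small on upper level sets of `q`. -/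
theorem abs_pairing_indicator_le (hT : 0 < T) (hlo : lo ≤ 1)
    (hprep : ∀ a ∈ Set.Icc lo 1, prep T disc a ∈ Set.Icc lo 1) (hw : Measurable w) {W : ℝ}
    (hwb : ∀ z, |w z| ≤ W) {q : X → ℝ} (hq : Measurable q) (hqb : ∀ x, q x ∈ Set.Icc lo 1) {e : ℝ}
    (he : ∀ θ ∈ Set.Icc lo 1, (disc = true → ∃ j : ℤ, θ = (j : ℝ) / T) →
      |pairing D w x b fun x => thr θ (q x)| ≤ e) {U : Set ℝ} (hU : IsUpperSet U)
    (hUp : ∀ a, prep T disc a ∈ U → a ∈ U) :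
    |pairing D w x b fun x => Set.indicator U (fun _ => (1 : ℝ)) (q x)| ≤ e := by
  have hT' : (T : ℝ) ≠ 0 := by positivity
  have hone : |pairing D w x b fun _ => 1| ≤ e := by
    have h := he 1 ⟨hlo, le_rfl⟩ fun _ => ⟨T, by push_cast; rw [div_self hT']⟩
    have e1 : (fun x => thr 1 (q x)) = fun _ => (1 : ℝ) :=
      funext fun x => if_pos (hqb x).2
    rwa [e1] at h
  by_cases hloU : lo ∈ U
  · have e1 : (fun x => Set.indicator U (fun _ => (1 : ℝ)) (q x)) = fun _ => 1 :=
      funext fun x => Set.indicator_of_mem (hU (hqb x).1 hloU) _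
    rwa [e1]
  · obtain ⟨θ, hθ, hlim⟩ := exists_thresholds hT hlo hprep hU hUp hloU
    have hm : ∀ n, Measurable fun x => thr (θ n) (q x) := fun n => (measurable_thr _).comp hq
    have hthr1 : ∀ n x, |-thr (θ n) (q x)| ≤ 1 := fun n x => by rw [abs_neg, abs_thr]
    have ht := tendsto_pairing (D := D) (x := x) (b := b) hw hwb
      (φ := fun n x => (1 / 2) * (1 + -thr (θ n) (q x))) (M := 1)
      (fun n => ((hm n).neg.const_add _).const_mul _)
      (fun n x => by
        rw [abs_mul]
        have := (abs_add_le 1 (-thr (θ n) (q x))).trans (add_le_add le_rfl (hthr1 n x))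
        rw [abs_of_pos (by norm_num : (0 : ℝ) < 1 / 2)]
        simp only [abs_one] at this
        linarith)
      (fun x => by simpa only [← sub_eq_add_neg] using hlim (q x) (hqb x))
    refine le_of_tendsto ht.abs (.of_forall fun n => ?_)
    rw [pairing_const_mul, pairing_add (φ := fun _ => 1) (ψ := fun x => -thr (θ n) (q x)) hw hwb
      measurable_const (M := 1) (fun _ => abs_one.le) (hm n).neg (hthr1 n)]
    have hneg : pairing D w x b (fun x => -thr (θ n) (q x)) =
        -pairing D w x b fun x => thr (θ n) (q x) := by
      have := pairing_const_mul (D := D) (w := w) (x := x) (b := b) (-1) fun x => thr (θ n) (q x)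
      simpa only [neg_one_mul] using this
    rw [hneg, abs_mul, abs_of_pos (by norm_num : (0 : ℝ) < 1 / 2)]
    have h1 := he (θ n) (hθ n).1 (hθ n).2
    have h2 := abs_add_le (pairing D w x b fun _ => 1) (-pairing D w x b fun x => thr (θ n) (q x))
    rw [abs_neg] at h2
    linarith

theorem sum_indicator_eq_floor {n : ℕ} (hn : 0 < n) {s : ℝ} (hs0 : 0 ≤ s) (hs1 : s ≤ 1) :
    ∑ j ∈ Finset.range n, (if ((j : ℝ) + 1) / n ≤ s then 1 else 0 : ℝ) = ⌊n * s⌋₊ := by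
  have hn' : (0 : ℝ) < n := by exact_mod_cast hn
  rw [Finset.sum_boole]
  have : (Finset.range n).filter (fun j : ℕ => ((j : ℝ) + 1) / n ≤ s) =
      Finset.range ⌊n * s⌋₊ := by
    ext j
    simp only [Finset.mem_filter, Finset.mem_range]
    have h1 : ((j : ℝ) + 1) / n ≤ s ↔ j + 1 ≤ ⌊n * s⌋₊ := by
      rw [Nat.le_floor_iff (by positivity), div_le_iff₀ hn', mul_comm s]
      push_cast
      rfl
    rw [h1]
    constructor
    · exact fun h => h.2
    · intro h
      refine ⟨lt_of_lt_of_le (Nat.lt_of_succ_le h) ?_, h⟩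
      have : ⌊n * s⌋₊ ≤ ⌊(n : ℝ)⌋₊ := Nat.floor_le_floor (mul_le_of_le_one_right hn'.le hs1)
      simpa using this
  rw [this, Finset.card_range]

/-- If the pairing is small on thresholds of `q`, then it is small on discretized monotone functions
of `q`. -/
theorem abs_pairing_floor_le (hT : 0 < T) (hlo : lo ≤ 1)
    (hprep : ∀ a ∈ Set.Icc lo 1, prep T disc a ∈ Set.Icc lo 1) (hw : Measurable w) {W : ℝ}
    (hwb : ∀ z, |w z| ≤ W) {q : X → ℝ} (hq : Measurable q) (hqb : ∀ x, q x ∈ Set.Icc lo 1) {e : ℝ}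
    (he : ∀ θ ∈ Set.Icc lo 1, (disc = true → ∃ j : ℤ, θ = (j : ℝ) / T) →
      |pairing D w x b fun x => thr θ (q x)| ≤ e) {φ : ℝ → ℝ} (hφ : Monotone φ)
    (hφb : ∀ a, φ a ∈ Set.Icc (0 : ℝ) 1) (hφp : ∀ a, φ (prep T disc a) = φ a) {n : ℕ} (hn : 0 < n) :
    Measurable (fun x => (1 / (n : ℝ)) * (⌊n * φ (q x)⌋₊ : ℝ)) ∧
    |pairing D w x b fun x => (1 / (n : ℝ)) * (⌊n * φ (q x)⌋₊ : ℝ)| ≤ e := by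
  have hn' : (0 : ℝ) < n := by exact_mod_cast hn
  set U : ℕ → Set ℝ := fun j => {a | ((j : ℝ) + 1) / n ≤ φ a} with hUdef
  have hU : ∀ j, IsUpperSet (U j) := fun j a b hab ha => le_trans ha (hφ hab)
  have hUm : ∀ j, Measurable fun x => Set.indicator (U j) (fun _ => (1 : ℝ)) (q x) := fun j =>
    (measurable_const.indicator (measurableSet_le measurable_const hφ.measurable)).comp hq
  have e1 : (fun x => (1 / (n : ℝ)) * (⌊n * φ (q x)⌋₊ : ℝ)) = fun x =>
      (1 / (n : ℝ)) * ∑ j ∈ Finset.range n, Set.indicator (U j) (fun _ => (1 : ℝ)) (q x) := by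
    funext x
    rw [← sum_indicator_eq_floor hn (hφb _).1 (hφb _).2]
    congr 1
  rw [e1]
  refine ⟨(Finset.measurable_sum _ fun j _ => hUm j).const_mul _, ?_⟩
  rw [pairing_const_mul, pairing_sum hw hwb _ hUm (M := 1) fun j x => by
    by_cases h : q x ∈ U j <;> simp [h], abs_mul, abs_of_pos (by positivity : (0 : ℝ) < 1 / n),
    one_div, inv_mul_le_iff₀ hn']
  refine (Finset.abs_sum_le_sum_abs _ _).trans ((Finset.sum_le_sum fun j _ =>
    abs_pairing_indicator_le hT hlo hprep hw hwb hq hqb he (hU j) fun a ha => ?_).trans ?_)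
  · simpa only [hUdef, Set.mem_ofPred_eq, hφp] using ha
  · simp

end Pairing

/-! ### Functions on the grid as combinations of thresholds -/

theorem thr_grid {T : ℕ} (hT : 0 < T) (v j : ℕ) :
    thr ((v : ℝ) / T) ((j : ℝ) / T) = if j ≤ v then 1 else -1 := by
  have hT' : (0 : ℝ) < T := by exact_mod_cast hT
  unfold thr
  simp only [div_le_div_iff_of_pos_right hT', Nat.cast_le]

theorem sum_thr_grid {T : ℕ} (hT : 0 < T) (g : ℕ → ℝ) (j n : ℕ) :
    ∑ v ∈ Finset.range n, (g v - g (v + 1)) / 2 * thr ((v : ℝ) / T) ((j : ℝ) / T) =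
      if n ≤ j then (g n - g 0) / 2 else g j - (g 0 + g n) / 2 := by
  induction n with
  | zero => simp
  | succ n ih =>
    rw [Finset.sum_range_succ, ih, thr_grid hT]
    rcases lt_trichotomy n j with h | rfl | h
    · rw [if_pos h.le, if_neg (by omega), if_pos (by omega)]; ring
    · rw [if_pos le_rfl, if_pos le_rfl, if_neg (by omega)]; ring
    · rw [if_neg (by omega), if_pos h.le, if_neg (by omega)]; ring

/-- Coefficients of the expansion of a function on the grid in thresholds. -/
def thrCoef (T : ℕ) (g : ℕ → ℝ) (v : ℕ) : ℝ :=
  if v = T then (g 0 + g T) / 2 else (g v - g (v + 1)) / 2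

theorem sum_thrCoef_mul {T : ℕ} (hT : 0 < T) (g : ℕ → ℝ) {j : ℕ} (hj : j ≤ T) :
    ∑ v ∈ Finset.range (T + 1), thrCoef T g v * thr ((v : ℝ) / T) ((j : ℝ) / T) = g j := by
  have h : ∑ v ∈ Finset.range T, thrCoef T g v * thr ((v : ℝ) / T) ((j : ℝ) / T) =
      ∑ v ∈ Finset.range T, (g v - g (v + 1)) / 2 * thr ((v : ℝ) / T) ((j : ℝ) / T) :=
    Finset.sum_congr rfl fun v hv => by
      rw [thrCoef, if_neg (Finset.mem_range.1 hv).ne]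
  rw [Finset.sum_range_succ, h, sum_thr_grid hT, thr_grid hT, if_pos hj, thrCoef, if_pos rfl]
  rcases hj.eq_or_lt with rfl | hj
  · rw [if_pos le_rfl]; ring
  · rw [if_neg (by omega)]; ring

theorem sum_abs_thrCoef_le {T : ℕ} (hT : 0 < T) {g : ℕ → ℝ} (hg : ∀ j ≤ T, |g j| ≤ 2)
    (hinc : ∀ v < T, g (v + 1) ≤ g v + 2 / T) :
    ∑ v ∈ Finset.range (T + 1), |thrCoef T g v| ≤ 6 := by
  have hT' : (0 : ℝ) < T := by exact_mod_cast hT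
  have h : ∑ v ∈ Finset.range T, |thrCoef T g v| ≤
      ∑ v ∈ Finset.range T, ((g v - g (v + 1)) / 2 + 2 / T) :=
    Finset.sum_le_sum fun v hv => by
      have hv' := Finset.mem_range.1 hv
      rw [thrCoef, if_neg hv'.ne, abs_le]
      have := hinc v hv'
      have h2 : (0 : ℝ) ≤ 2 / T := by positivity
      constructor <;> linarith
  have htel : ∑ v ∈ Finset.range T, ((g v - g (v + 1)) / 2 + 2 / T) = (g 0 - g T) / 2 + 2 := by
    rw [Finset.sum_add_distrib, ← Finset.sum_div, Finset.sum_range_sub']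
    simp only [Finset.sum_const, Finset.card_range, nsmul_eq_mul]
    field_simp
  have h0 := abs_le.1 (hg 0 (Nat.zero_le _))
  have h1 := abs_le.1 (hg T le_rfl)
  have hc : |thrCoef T g T| ≤ 2 := by
    rw [thrCoef, if_pos rfl, abs_le]
    constructor <;> linarith
  rw [Finset.sum_range_succ]
  linarith

/-! ### Post-processing -/

theorem berLoss_eq (ℓ : ℝ → Bool → ℝ) (p q : ℝ) :
    berLoss ℓ p q = ℓ q false + p * discDeriv ℓ q := by
  unfold berLoss discDeriv; ring

theorem loss_eq (ℓ : ℝ → Bool → ℝ) (q : ℝ) (y : Bool) :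
    ℓ q y = ℓ q false + lab y * discDeriv ℓ q := by
  cases y <;> simp [lab, discDeriv]

theorem abs_discDeriv_le {ℓ : ℝ → Bool → ℝ} (hℓ : ℓ ∈ boundedLosses) {p : ℝ}
    (hp : p ∈ Set.Icc (0 : ℝ) 1) : |discDeriv ℓ p| ≤ 2 := by
  have h1 := hℓ p hp true
  have h2 := hℓ p hp false
  unfold discDeriv
  exact abs_le.2 ⟨by linarith [h1.1, h2.2], by linarith [h1.2, h2.1]⟩

theorem IsPostProcessing.discDeriv_le {τ : ℝ} {ℓ : ℝ → Bool → ℝ} {κ : ℝ → ℝ}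
    (h : IsPostProcessing τ ℓ κ) {p q : ℝ} (hp : p ∈ Set.Icc (0 : ℝ) 1)
    (hq : q ∈ Set.Icc (0 : ℝ) 1) :
    (q - p) * (discDeriv ℓ (κ q) - discDeriv ℓ (κ p)) ≤ 2 * τ := by
  have h1 := (h p hp).2 (κ q) (h q hq).1
  have h2 := (h q hq).2 (κ p) (h p hp).1
  simp only [berLoss_eq] at h1 h2
  nlinarith

theorem isPostProcessing_id {ℓ : ℝ → Bool → ℝ} (hℓ : ℓ ∈ properLosses) {τ : ℝ} (hτ : 0 ≤ τ) :
    IsPostProcessing τ ℓ id := fun p hp =>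
  ⟨hp, fun q hq => (hℓ.2 p hp q hq).trans (by linarith)⟩

theorem exists_isPostProcessing {ℓ : ℝ → Bool → ℝ} (hℓ : ℓ ∈ boundedLosses) {τ : ℝ} (hτ : 0 < τ) :
    ∃ κ, IsPostProcessing τ ℓ κ := by
  have h : ∀ p : ℝ, ∃ a : ℝ, p ∈ Set.Icc (0 : ℝ) 1 → a ∈ Set.Icc (0 : ℝ) 1 ∧
      ∀ q ∈ Set.Icc (0 : ℝ) 1, berLoss ℓ p a ≤ berLoss ℓ p q + τ := by
    intro p
    by_cases hp : p ∈ Set.Icc (0 : ℝ) 1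
    · have hne : (berLoss ℓ p '' Set.Icc 0 1).Nonempty := ⟨_, 0, by simp, rfl⟩
      have hbd : BddBelow (berLoss ℓ p '' Set.Icc 0 1) := by
        refine ⟨-1, ?_⟩
        rintro _ ⟨q, hq, rfl⟩
        have h1 := (hℓ q hq true).1
        have h2 := (hℓ q hq false).1
        unfold berLoss
        nlinarith [hp.1, hp.2]
      obtain ⟨_, ⟨a, ha, rfl⟩, hlt⟩ := Real.lt_sInf_add_pos hne hτ
      refine ⟨a, fun _ => ⟨ha, fun q hq => hlt.le.trans ?_⟩⟩
      have := csInf_le hbd ⟨q, hq, rfl⟩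
      linarith
    · exact ⟨0, fun h => absurd h hp⟩
  choose κ hκ using h
  exact ⟨κ, fun p hp => hκ p hp⟩

/-! ### Mixtures of predictors with values in the grid -/

section Mixture

variable {X : Type*} [MeasurableSpace X] {T : ℕ} {D : Measure (X × Bool)} [IsProbabilityMeasure D]
  {p : Fin T → X → ℝ}

/-- Average correlation of the residuals of the predictors with a test `f t`. -/
def resCorr (D : Measure (X × Bool)) (p : Fin T → X → ℝ) (f : Fin T → X → ℝ) : ℝ :=
  (1 / (T : ℝ)) * ∑ t, ∫ z, f t z.1 * (lab z.2 - p t z.1) ∂D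

theorem abs_lab_sub_le {a : ℝ} (ha : a ∈ Set.Icc (0 : ℝ) 1) (y : Bool) : |lab y - a| ≤ 1 := by
  have h := lab_mem_Icc y
  exact abs_le.2 ⟨by linarith [h.1, ha.2], by linarith [h.2, ha.1]⟩

theorem measurable_residual {f : X → ℝ} (hf : Measurable f) :
    Measurable fun z : X × Bool => lab z.2 - f z.1 :=
  (measurable_lab.comp measurable_snd).sub (hf.comp measurable_fst)

theorem integrable_mul_residual {f g : X → ℝ} (hf : Measurable f) (hg : Measurable g)
    (hg1 : ∀ x, g x ∈ Set.Icc (0 : ℝ) 1) {M : ℝ} (hM : ∀ x, |f x| ≤ M) :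
    Integrable (fun z : X × Bool => f z.1 * (lab z.2 - g z.1)) D :=
  integrable_pairing (measurable_residual hg) (fun z => abs_lab_sub_le (hg1 z.1) z.2) hf hM

theorem grid_mem_Icc {a : ℝ} (h : ∃ j : ℕ, j ≤ T ∧ a = (j : ℝ) / T) : a ∈ Set.Icc (0 : ℝ) 1 := by
  obtain ⟨j, hj, rfl⟩ := h
  exact ⟨by positivity, div_le_one_of_le₀ (by exact_mod_cast hj) (by positivity)⟩

theorem measurable_comp_grid (hT : 0 < T) {f : X → ℝ} (hf : Measurable f)
    (hgrid : ∀ x, ∃ j : ℕ, j ≤ T ∧ f x = (j : ℝ) / T) (g : ℝ → ℝ) :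
    Measurable fun x => g (f x) := by
  have hT' : (T : ℝ) ≠ 0 := by positivity
  have e : (fun x => g (f x)) = (fun n : ℕ => g ((n : ℝ) / T)) ∘ fun x => ⌊f x * T⌋₊ := by
    funext x
    obtain ⟨j, -, hj⟩ := hgrid x
    simp only [Function.comp_apply]
    rw [hj, div_mul_cancel₀ _ hT', Nat.floor_natCast]
  rw [e]
  exact measurable_from_top.comp (Nat.measurable_floor.comp (hf.mul_const _))

theorem abs_resCorr_comp_le (hT : 0 < T) (hp : ∀ t, Measurable (p t))
    (hgrid : ∀ t x, ∃ j : ℕ, j ≤ T ∧ p t x = (j : ℝ) / T) {M : ℝ}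
    (hM : ∀ v ≤ T, |resCorr D p fun t x => thr ((v : ℝ) / T) (p t x)| ≤ M) {g : ℝ → ℝ}
    (hg : ∀ j : ℕ, j ≤ T → |g ((j : ℝ) / T)| ≤ 2)
    (hinc : ∀ v < T, g (((v + 1 : ℕ) : ℝ) / T) ≤ g ((v : ℝ) / T) + 2 / T) :
    |resCorr D p fun t x => g (p t x)| ≤ 6 * M := by
  set a := thrCoef T fun j => g ((j : ℝ) / T) with ha
  have hexp : ∀ t x, g (p t x) =
      ∑ v ∈ Finset.range (T + 1), a v * thr ((v : ℝ) / T) (p t x) := by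
    intro t x
    obtain ⟨j, hj, h⟩ := hgrid t x
    rw [h, ha, sum_thrCoef_mul hT (fun j => g ((j : ℝ) / T)) hj]
  have hlin : (resCorr D p fun t x => g (p t x)) = ∑ v ∈ Finset.range (T + 1),
      a v * resCorr D p fun t x => thr ((v : ℝ) / T) (p t x) := by
    unfold resCorr
    simp only [Finset.mul_sum]
    rw [Finset.sum_comm]
    refine Finset.sum_congr rfl fun t _ => ?_
    have : ∫ z, g (p t z.1) * (lab z.2 - p t z.1) ∂D = ∑ v ∈ Finset.range (T + 1),
        a v * ∫ z, thr ((v : ℝ) / T) (p t z.1) * (lab z.2 - p t z.1) ∂D := by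
      simp only [hexp, Finset.sum_mul, mul_assoc]
      rw [integral_finsetSum]
      · simp only [integral_const_mul]
      · intro v _
        exact (integrable_mul_residual ((measurable_thr _).comp (hp t)) (hp t)
          (fun x => grid_mem_Icc (hgrid t x)) (M := 1) fun x => (abs_thr _ _).le).const_mul _
    rw [this, Finset.mul_sum]
    exact Finset.sum_congr rfl fun v _ => by ring
  have hM0 : 0 ≤ M := (abs_nonneg _).trans (hM 0 (Nat.zero_le _))
  rw [hlin]
  refine (Finset.abs_sum_le_sum_abs _ _).trans ?_
  calc ∑ v ∈ Finset.range (T + 1), |a v * resCorr D p fun t x => thr ((v : ℝ) / T) (p t x)|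
      ≤ ∑ v ∈ Finset.range (T + 1), |a v| * M := Finset.sum_le_sum fun v hv => by
        rw [abs_mul]
        exact mul_le_mul_of_nonneg_left (hM v (Nat.lt_succ_iff.1 (Finset.mem_range.1 hv)))
          (abs_nonneg _)
    _ = (∑ v ∈ Finset.range (T + 1), |a v|) * M := by rw [Finset.sum_mul]
    _ ≤ 6 * M := mul_le_mul_of_nonneg_right (sum_abs_thrCoef_le hT hg hinc) hM0

theorem abs_resCorr_postProcessing_le (hT : 0 < T) (hp : ∀ t, Measurable (p t))
    (hgrid : ∀ t x, ∃ j : ℕ, j ≤ T ∧ p t x = (j : ℝ) / T) {M : ℝ}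
    (hM : ∀ v ≤ T, |resCorr D p fun t x => thr ((v : ℝ) / T) (p t x)| ≤ M) {ℓ : ℝ → Bool → ℝ}
    (hℓ : ℓ ∈ boundedLosses) {κ : ℝ → ℝ} (hκ : IsPostProcessing (1 / (T : ℝ) ^ 2) ℓ κ) :
    |resCorr D p fun t x => discDeriv ℓ (κ (p t x))| ≤ 6 * M := by
  have hT' : (0 : ℝ) < T := by exact_mod_cast hT
  have hmem : ∀ j : ℕ, j ≤ T → ((j : ℝ) / T) ∈ Set.Icc (0 : ℝ) 1 := fun j hj =>
    grid_mem_Icc ⟨j, hj, rfl⟩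
  refine abs_resCorr_comp_le hT hp hgrid hM (g := fun a => discDeriv ℓ (κ a))
    (fun j hj => abs_discDeriv_le hℓ (hκ _ (hmem j hj)).1) fun v hv => ?_
  have h := hκ.discDeriv_le (hmem v hv.le) (hmem (v + 1) hv)
  have e : ((v + 1 : ℕ) : ℝ) / T - (v : ℝ) / T = 1 / T := by push_cast; ring
  rw [e, one_div_mul_eq_div, div_le_iff₀ hT'] at h
  have e2 : 2 * (1 / (T : ℝ) ^ 2) * T = 2 / T := by field_simp
  rw [e2] at h
  linarith

theorem pcalErr_le (hT : 0 < T) (hp : ∀ t, Measurable (p t))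
    (hgrid : ∀ t x, ∃ j : ℕ, j ≤ T ∧ p t x = (j : ℝ) / T) {M : ℝ}
    (hM : ∀ v ≤ T, |resCorr D p fun t x => thr ((v : ℝ) / T) (p t x)| ≤ M) :
    pcalErr D p ≤ 6 * M := by
  have hM0 : 0 ≤ M := (abs_nonneg _).trans (hM 0 (Nat.zero_le _))
  refine Real.iSup_le (fun ℓ => ?_) (by positivity)
  exact abs_resCorr_postProcessing_le hT hp hgrid hM ℓ.2.1
    (isPostProcessing_id ℓ.2 (by positivity))

end Mixture

/-! ### Functions of bounded variation -/

/-- Functions of variation at most `2` and sup norm at most `2` on the unit interval are affine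
combinations of two monotone functions with values in the unit interval. -/
theorem exists_monotone_decomposition {Δ : ℝ → ℝ} (hv : eVariationOn Δ (Set.Icc 0 1) ≤ 2)
    (hb : ∀ a ∈ Set.Icc (0 : ℝ) 1, |Δ a| ≤ 2) :
    ∃ φ ψ : ℝ → ℝ, Monotone φ ∧ Monotone ψ ∧ (∀ a, φ a ∈ Set.Icc (0 : ℝ) 1) ∧
      (∀ a, ψ a ∈ Set.Icc (0 : ℝ) 1) ∧
      ∀ a ∈ Set.Icc (0 : ℝ) 1, Δ a = 2 * φ a - 6 * ψ a + 2 := by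
  set V : ℝ → ℝ := variationOnFromTo Δ (Set.Icc 0 1) 0 with hV
  have h0 : (0 : ℝ) ∈ Set.Icc (0 : ℝ) 1 := by simp
  have hfin : eVariationOn Δ (Set.Icc 0 1) ≠ ⊤ := ne_top_of_le_ne_top (by simp) hv
  have hbv : LocallyBoundedVariationOn Δ (Set.Icc (0 : ℝ) 1) :=
    BoundedVariationOn.locallyBoundedVariationOn hfin
  have hVm : MonotoneOn V (Set.Icc 0 1) := variationOnFromTo.monotoneOn hbv h0
  have hWm : MonotoneOn (V - Δ) (Set.Icc 0 1) := variationOnFromTo.sub_self_monotoneOn hbv h0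
  have hV01 : ∀ a ∈ Set.Icc (0 : ℝ) 1, V a ∈ Set.Icc (0 : ℝ) 2 := by
    intro a ha
    refine ⟨variationOnFromTo.nonneg_of_le _ _ ha.1, ?_⟩
    rw [hV, variationOnFromTo.eq_of_le _ _ ha.1]
    refine ENNReal.toReal_le_of_le_ofReal (by norm_num) ?_
    refine ((eVariationOn.mono Δ Set.inter_subset_left).trans hv).trans ?_
    simp
  set P : ℝ → ℝ := fun a => max 0 (min a 1) with hP
  have hPmem : ∀ a, P a ∈ Set.Icc (0 : ℝ) 1 := fun a =>
    ⟨le_max_left _ _, max_le zero_le_one (min_le_right _ _)⟩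
  have hPm : Monotone P := fun a b h => max_le_max le_rfl (min_le_min h le_rfl)
  have hPid : ∀ a ∈ Set.Icc (0 : ℝ) 1, P a = a := fun a ha => by
    simp only [hP]
    rw [min_eq_left ha.2, max_eq_right ha.1]
  refine ⟨fun a => V (P a) / 2, fun a => ((V - Δ) (P a) + 2) / 6, fun a b h => ?_, fun a b h => ?_,
    fun a => ?_, fun a => ?_, fun a ha => ?_⟩
  · have := hVm (hPmem a) (hPmem b) (hPm h)
    simp only
    linarith
  · have := hWm (hPmem a) (hPmem b) (hPm h)
    simp only
    linarith
  · have := hV01 _ (hPmem a)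
    exact ⟨by linarith [this.1], by linarith [this.2]⟩
  · have h1 := hV01 _ (hPmem a)
    have h2 := abs_le.1 (hb _ (hPmem a))
    simp only [Pi.sub_apply]
    exact ⟨by linarith [h1.1, h2.2], by linarith [h1.2, h2.1]⟩
  · simp only [Pi.sub_apply]
    rw [hPid a ha]
    ring

section Omniprediction

variable {X : Type*} [MeasurableSpace X] {T : ℕ} {D : Measure (X × Bool)} [IsProbabilityMeasure D]
  {p : Fin T → X → ℝ}

theorem abs_pairing_monotone_le (hT : 0 < T) {w : X × Bool → ℝ} (hw : Measurable w)
    (hwb : ∀ z, |w z| ≤ 1) {q : X → ℝ} (hq : Measurable q) (hqb : ∀ x, q x ∈ Set.Icc (0 : ℝ) 1)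
    {e : ℝ} (he : ∀ θ ∈ Set.Icc (0 : ℝ) 1,
      |pairing D w (m := 0) Fin.elim0 Fin.elim0 fun x => thr θ (q x)| ≤ e) {φ : ℝ → ℝ}
    (hφ : Monotone φ) (hφb : ∀ a, φ a ∈ Set.Icc (0 : ℝ) 1) :
    |pairing D w (m := 0) Fin.elim0 Fin.elim0 fun x => φ (q x)| ≤ e + 1 / T := by
  have hT' : (0 : ℝ) < T := by exact_mod_cast hT
  obtain ⟨hm, hle⟩ := abs_pairing_floor_le (T := T) (disc := false) (D := D) (m := 0)
    (x := Fin.elim0) (b := Fin.elim0) hT zero_le_one (fun a ha => ha) hw hwb hq hqb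
    (fun θ hθ _ => he θ hθ) hφ hφb (fun a => rfl) hT
  set ψ : X → ℝ := fun x => (1 / (T : ℝ)) * (⌊T * φ (q x)⌋₊ : ℝ) with hψ
  have hclose : ∀ x, |φ (q x) - ψ x| ≤ 1 / T := by
    intro x
    have h0 : 0 ≤ T * φ (q x) := mul_nonneg hT'.le (hφb _).1
    have h1 := Nat.floor_le h0
    have h2 := Nat.lt_floor_add_one (T * φ (q x))
    have e1 : φ (q x) - ψ x = (1 / (T : ℝ)) * (T * φ (q x) - ⌊T * φ (q x)⌋₊) := by
      rw [hψ]; field_simp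
    rw [e1, abs_mul, abs_of_pos (by positivity : (0 : ℝ) < 1 / T)]
    refine mul_le_of_le_one_right (by positivity) ?_
    rw [abs_of_nonneg (by linarith)]
    linarith
  have hφm : Measurable fun x => φ (q x) := hφ.measurable.comp hq
  have hφ1 : ∀ x, |φ (q x)| ≤ 1 := fun x =>
    abs_le.2 ⟨by linarith [(hφb (q x)).1], (hφb (q x)).2⟩
  have hψ1 : ∀ x, |ψ x| ≤ 1 + 1 / T := fun x => by
    have h1 := hclose x
    rw [abs_sub_comm] at h1
    have := abs_add_le (ψ x - φ (q x)) (φ (q x))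
    rw [sub_add_cancel] at this
    linarith [hφ1 x]
  have hdm : Measurable fun x => φ (q x) - ψ x := hφm.sub hm
  have hsum := pairing_add (D := D) (m := 0) (x := Fin.elim0) (b := Fin.elim0) hw hwb hm hψ1 hdm
    hclose
  simp only [add_sub_cancel] at hsum
  rw [hsum]
  refine (abs_add_le _ _).trans (add_le_add hle ?_)
  unfold pairing
  simp only [Finset.univ_eq_empty, Finset.sum_empty, sub_zero]
  have := norm_integral_le_of_norm_le_const (μ := D)
    (f := fun z : X × Bool => (φ (q z.1) - ψ z.1) * w z) (C := 1 / T) (.of_forall fun z => by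
      rw [Real.norm_eq_abs, abs_mul]
      exact (mul_le_mul (hclose z.1) (hwb z) (abs_nonneg _) (by positivity)).trans_eq (mul_one _))
  simpa using this

/-- The average residual of a mixture. -/
def avgRes (p : Fin T → X → ℝ) (z : X × Bool) : ℝ := (1 / (T : ℝ)) * ∑ t, (lab z.2 - p t z.1)

theorem pairing_avgRes (hp : ∀ t, Measurable (p t)) (hp1 : ∀ t x, p t x ∈ Set.Icc (0 : ℝ) 1)
    {f : X → ℝ} (hf : Measurable f) {M : ℝ} (hM : ∀ x, |f x| ≤ M) :
    pairing D (avgRes p) (m := 0) Fin.elim0 Fin.elim0 f = resCorr D p fun _ => f := by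
  unfold pairing resCorr avgRes
  simp only [Finset.univ_eq_empty, Finset.sum_empty, sub_zero]
  have e : (fun z : X × Bool => f z.1 * (1 / (T : ℝ) * ∑ t, (lab z.2 - p t z.1))) = fun z =>
      (1 / (T : ℝ)) * ∑ t, f z.1 * (lab z.2 - p t z.1) := by
    funext z
    rw [← Finset.mul_sum]; ring
  rw [e, integral_const_mul, integral_finsetSum]
  exact fun t _ => integrable_mul_residual hf (hp t) (hp1 t) hM

theorem abs_resCorr_bv_le (hT : 0 < T) (hp : ∀ t, Measurable (p t))
    (hp1 : ∀ t x, p t x ∈ Set.Icc (0 : ℝ) 1) {h : X → ℝ} (hh : Measurable h)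
    (hh1 : ∀ x, h x ∈ Set.Icc (0 : ℝ) 1) {e : ℝ} (he : ∀ θ ∈ Set.Icc (0 : ℝ) 1,
      |resCorr D p fun _ x => thr θ (h x)| ≤ e) {Δ : ℝ → ℝ}
    (hv : eVariationOn Δ (Set.Icc 0 1) ≤ 2) (hb : ∀ a ∈ Set.Icc (0 : ℝ) 1, |Δ a| ≤ 2) :
    |resCorr D p fun _ x => Δ (h x)| ≤ 10 * e + 8 / T := by
  have hT' : (0 : ℝ) < T := by exact_mod_cast hT
  obtain ⟨φ, ψ, hφ, hψ, hφb, hψb, hΔ⟩ := exists_monotone_decomposition hv hb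
  have hw : Measurable (avgRes p) :=
    (Finset.measurable_sum _ fun t _ => measurable_residual (hp t)).const_mul _
  have hwb : ∀ z, |avgRes p z| ≤ 1 := fun z => by
    unfold avgRes
    rw [abs_mul, abs_of_pos (by positivity : (0 : ℝ) < 1 / T), one_div, inv_mul_le_iff₀ hT']
    refine (Finset.abs_sum_le_sum_abs _ _).trans
      ((Finset.sum_le_sum fun t _ => abs_lab_sub_le (hp1 t z.1) z.2).trans ?_)
    simp
  have he' : ∀ θ ∈ Set.Icc (0 : ℝ) 1,
      |pairing D (avgRes p) (m := 0) Fin.elim0 Fin.elim0 fun x => thr θ (h x)| ≤ e := fun θ hθ => by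
    rw [pairing_avgRes (f := fun x => thr θ (h x)) hp hp1 ((measurable_thr θ).comp hh) (M := 1)
      fun x => (abs_thr _ _).le]
    exact he θ hθ
  have h1 := abs_pairing_monotone_le hT hw hwb hh hh1 he' hφ hφb
  have h2 := abs_pairing_monotone_le hT hw hwb hh hh1 he' hψ hψb
  have h3 := he' 1 (by simp)
  have e3 : (fun x => thr 1 (h x)) = fun _ => (1 : ℝ) := funext fun x => if_pos (hh1 x).2
  rw [e3] at h3
  have b1 : ∀ {f : ℝ → ℝ}, (∀ a, f a ∈ Set.Icc (0 : ℝ) 1) → ∀ x, |f (h x)| ≤ 1 := fun hf x =>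
    abs_le.2 ⟨by linarith [(hf (h x)).1], (hf (h x)).2⟩
  have m1 : Measurable fun x => φ (h x) := hφ.measurable.comp hh
  have m2 : Measurable fun x => ψ (h x) := hψ.measurable.comp hh
  have m4 : Measurable fun x => 2 * φ (h x) + -6 * ψ (h x) :=
    (m1.const_mul _).add (m2.const_mul _)
  have b2 : ∀ x, |2 * φ (h x)| ≤ 2 := fun x => by
    rw [abs_mul, abs_two]; linarith [b1 hφb x]
  have b3 : ∀ x, |-6 * ψ (h x)| ≤ 6 := fun x => by
    rw [abs_mul, abs_neg, abs_of_pos (by norm_num : (0 : ℝ) < 6)]; linarith [b1 hψb x]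
  have b4 : ∀ x, |2 * φ (h x) + -6 * ψ (h x)| ≤ 8 := fun x =>
    (abs_add_le _ _).trans (by linarith [b2 x, b3 x])
  have eΔ : (fun x => Δ (h x)) = fun x => (2 * φ (h x) + -6 * ψ (h x)) + 2 * 1 := by
    funext x
    rw [hΔ _ (hh1 x)]; ring
  have hm : Measurable fun x => Δ (h x) := by rw [eΔ]; exact m4.add_const _
  rw [← pairing_avgRes hp hp1 hm (M := 2) (fun x => hb _ (hh1 x)), eΔ,
    pairing_add (φ := fun x => 2 * φ (h x) + -6 * ψ (h x)) (ψ := fun _ => 2 * 1) hw hwb m4 b4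
      measurable_const (M' := 2) (fun _ => by norm_num),
    pairing_add (φ := fun x => 2 * φ (h x)) (ψ := fun x => -6 * ψ (h x)) hw hwb (m1.const_mul _) b2
      (m2.const_mul _) b3,
    pairing_const_mul, pairing_const_mul, pairing_const_mul 2 fun _ => 1]
  rw [abs_le] at h1 h2 h3 ⊢
  have e8 : (8 : ℝ) / T = 8 * (1 / T) := by ring
  rw [e8]
  constructor <;> linarith [h1.1, h1.2, h2.1, h2.2, h3.1, h3.2]

theorem average_le (hT : 0 < T) {a b c : Fin T → ℝ} {u v : ℝ}
    (h : ∀ t, a t ≤ u - b t + c t + v) :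
    (1 / (T : ℝ)) * ∑ t, a t ≤ u - (1 / (T : ℝ)) * ∑ t, b t + (1 / (T : ℝ)) * ∑ t, c t + v := by
  have hT' : (0 : ℝ) < T := by exact_mod_cast hT
  have hsum := mul_le_mul_of_nonneg_left (Finset.sum_le_sum fun t (_ : t ∈ Finset.univ) => h t)
    (by positivity : (0 : ℝ) ≤ 1 / T)
  refine hsum.trans_eq ?_
  simp only [Finset.sum_add_distrib, Finset.sum_sub_distrib, Finset.sum_const, Finset.card_univ,
    Fintype.card_fin, nsmul_eq_mul]
  field_simp

theorem isOmnipredictor_of_bounds (hT : 0 < T) (hp : ∀ t, Measurable (p t))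
    (hgrid : ∀ t x, ∃ j : ℕ, j ≤ T ∧ p t x = (j : ℝ) / T) {M e ε : ℝ}
    (hM : ∀ v ≤ T, |resCorr D p fun t x => thr ((v : ℝ) / T) (p t x)| ≤ M) {H : Set (X → ℝ)}
    (hH : ∀ h ∈ H, ∀ x, h x ∈ Set.Icc (0 : ℝ) 1)
    (hHm : ∀ h ∈ H, ∀ θ ∈ Set.Icc (0 : ℝ) 1, Measurable fun x => thr θ (h x))
    (he : ∀ h ∈ H, ∀ θ ∈ Set.Icc (0 : ℝ) 1, |resCorr D p fun _ x => thr θ (h x)| ≤ e)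
    (hε : 6 * M + 10 * e + 8 / T + 1 / (T : ℝ) ^ 2 ≤ ε) :
    IsOmnipredictor D (1 / (T : ℝ) ^ 2) bvLosses H ε p := by
  have hT' : (0 : ℝ) < T := by exact_mod_cast hT
  have hp1 : ∀ t x, p t x ∈ Set.Icc (0 : ℝ) 1 := fun t x => grid_mem_Icc (hgrid t x)
  intro ℓ hℓ
  refine ⟨exists_isPostProcessing hℓ.1 (by positivity), fun κ hκ h hh => ?_⟩
  have hhm : Measurable h := by
    refine measurable_of_Iic fun a => ?_
    by_cases ha : a ∈ Set.Icc (0 : ℝ) 1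
    · have e1 : h ⁻¹' Set.Iic a = (fun x => thr a (h x)) ⁻¹' {1} := by
        ext x
        simp only [Set.mem_preimage, Set.mem_Iic, Set.mem_singleton_iff, thr]
        split_ifs with hx
        · simp [hx]
        · simp only [hx, false_iff]; norm_num
      rw [e1]
      exact hHm h hh a ha (measurableSet_singleton _)
    · rw [Set.mem_Icc, not_and_or, not_le, not_le] at ha
      rcases ha with ha | ha
      · convert MeasurableSet.empty
        ext x
        simp only [Set.mem_preimage, Set.mem_Iic, Set.mem_empty_iff_false, iff_false, not_le]
        exact ha.trans_le (hH h hh x).1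
      · convert MeasurableSet.univ
        ext x
        simp only [Set.mem_preimage, Set.mem_Iic, Set.mem_univ, iff_true]
        exact (hH h hh x).2.trans ha.le
  have hcal := (abs_le.1 (abs_resCorr_postProcessing_le hT hp hgrid hM hℓ.1 hκ)).2
  have hbv := (abs_le.1 (abs_resCorr_bv_le hT hp hp1 hhm (hH h hh) (he h hh) hℓ.2.2
    fun a ha => abs_discDeriv_le hℓ.1 ha)).1
  have hΔm : Measurable (discDeriv ℓ) := (hℓ.2.1 true).sub (hℓ.2.1 false)
  have hloss1 : ∀ {a : ℝ} (y : Bool), a ∈ Set.Icc (0 : ℝ) 1 → |ℓ a y| ≤ 1 := fun y ha =>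
    abs_le.2 (hℓ.1 _ ha y)
  have int1 : Integrable (fun z : X × Bool => ℓ (h z.1) z.2) D := by
    refine integrable_of_abs_le (b := 1) ?_ fun z => hloss1 _ (hH h hh z.1)
    have e1 : (fun z : X × Bool => ℓ (h z.1) z.2) = fun z =>
        ℓ (h z.1) false + lab z.2 * discDeriv ℓ (h z.1) := funext fun z => loss_eq _ _ _
    rw [e1]
    have hh1 : Measurable fun z : X × Bool => h z.1 := hhm.comp measurable_fst
    exact ((hℓ.2.1 false).comp hh1).add
      ((measurable_lab.comp measurable_snd).mul (hΔm.comp hh1))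
  have int2 : ∀ t, Integrable (fun z : X × Bool => ℓ (κ (p t z.1)) z.2) D := fun t => by
    refine integrable_of_abs_le (b := 1) ?_ fun z => hloss1 _ (hκ _ (hp1 t z.1)).1
    have e1 : (fun z : X × Bool => ℓ (κ (p t z.1)) z.2) = fun z =>
        ℓ (κ (p t z.1)) false + lab z.2 * discDeriv ℓ (κ (p t z.1)) := funext fun z => loss_eq _ _ _
    rw [e1]
    have m : ∀ g : ℝ → ℝ, Measurable fun z : X × Bool => g (p t z.1) := fun g =>
      (measurable_comp_grid hT (hp t) (hgrid t) g).comp measurable_fst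
    exact (m fun a => ℓ (κ a) false).add
      ((measurable_lab.comp measurable_snd).mul (m fun a => discDeriv ℓ (κ a)))
  have int3 : ∀ t, Integrable (fun z : X × Bool => discDeriv ℓ (h z.1) * (lab z.2 - p t z.1)) D :=
    fun t => integrable_mul_residual (hΔm.comp hhm) (hp t) (hp1 t) (M := 2)
      fun x => abs_discDeriv_le hℓ.1 (hH h hh x)
  have int4 : ∀ t, Integrable
      (fun z : X × Bool => discDeriv ℓ (κ (p t z.1)) * (lab z.2 - p t z.1)) D :=
    fun t => integrable_mul_residual (measurable_comp_grid hT (hp t) (hgrid t)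
      fun a => discDeriv ℓ (κ a)) (hp t) (hp1 t) (M := 2)
      fun x => abs_discDeriv_le hℓ.1 (hκ _ (hp1 t x)).1
  have hstep : ∀ t, ∫ z, ℓ (κ (p t z.1)) z.2 ∂D ≤ ∫ z, ℓ (h z.1) z.2 ∂D -
      ∫ z, discDeriv ℓ (h z.1) * (lab z.2 - p t z.1) ∂D +
      ∫ z, discDeriv ℓ (κ (p t z.1)) * (lab z.2 - p t z.1) ∂D + 1 / (T : ℝ) ^ 2 := by
    intro t
    have hle := integral_mono (μ := D) (int2 t)
      (((int1.sub (int3 t)).add (int4 t)).add (integrable_const (1 / (T : ℝ) ^ 2))) fun z => by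
        have := (hκ _ (hp1 t z.1)).2 _ (hH h hh z.1)
        simp only [berLoss_eq] at this
        simp only [Pi.add_apply, Pi.sub_apply]
        rw [loss_eq ℓ (κ (p t z.1)), loss_eq ℓ (h z.1)]
        linarith
    rw [integral_add' ((int1.sub (int3 t)).add (int4 t)) (integrable_const _),
      integral_add' (int1.sub (int3 t)) (int4 t), integral_sub' int1 (int3 t)] at hle
    simpa using hle
  have hsum := average_le hT hstep
  unfold resCorr at hcal hbv
  linarith

end Omniprediction

/-! ### Error bounds on a single run -/

section GoodRun

variable {X : Type*} [MeasurableSpace X] {T k : ℕ} {O : List (X × ℝ) → X → ℝ} {disc : Bool}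
  {D : Measure (X × Bool)} [IsProbabilityMeasure D] {C : Set (X → ℝ)} {ω : Runs X T k}

theorem measurable_hyp_run (hOm : MeasurableOracle O) (ω : Runs X T k) (t : Fin T) :
    Measurable (hyp O disc ω t) := by
  have hm : Measurable fun x : X => (ω, x) := measurable_const.prodMk measurable_id
  have h := (measurable_hyp (disc := disc) hOm t).comp hm
  exact h

theorem measurable_pred_run (hOm : MeasurableOracle O) (ω : Runs X T k) (t : Fin T) :
    Measurable (pred O disc ω t) := by
  have hm : Measurable fun x : X => (ω, x) := measurable_const.prodMk measurable_id
  have h := (measurable_pred (disc := disc) hOm t).comp hm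
  exact h

/-- Difference between population and learner's sample in the correlation of `f` with the
predictions of round `t`. -/
theorem abs_pairing_pred_le (hT : 0 < T) (hk : 0 < k)
    (hC : ∀ c ∈ C, Measurable c ∧ ∀ x, c x ∈ Set.Icc (-1 : ℝ) 1) (hneg : ∀ c ∈ C, -c ∈ C)
    (hO : IsERMOracle C O) (hOm : MeasurableOracle O) {e : ℝ}
    (hprod : ∀ c ∈ C, ∀ g ∈ comp (thrClass T disc) (convK k C), ∫ z, c z.1 * g z.1 ∂D -
      (1 / (T : ℝ)) * ∑ i, c (lrnPt ω i).1 * g (lrnPt ω i).1 ≤ e) (t : Fin T) {c : X → ℝ}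
    (hc : c ∈ C) :
    |pairing D (fun z => c z.1) (fun i => (lrnPt ω i).1)
      (fun i => (1 / (T : ℝ)) * c (lrnPt ω i).1) (pred O disc ω t)| ≤ e := by
  have hT' : (0 : ℝ) < T := by exact_mod_cast hT
  have hq := hyp_mem_convK (disc := disc) hk hO ω t
  have hlink : ∀ a, ∃ j : ℕ, j ≤ T ∧ link O disc ω t a = (j : ℝ) / T := fun a =>
    remap_mem_grid _ _ _ _
  have h := (abs_pairing_floor_le (D := D) (w := fun z => c z.1) (x := fun i => (lrnPt ω i).1)
    (b := fun i => (1 / (T : ℝ)) * c (lrnPt ω i).1) (T := T) (disc := disc) (lo := -1) hT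
    (by norm_num) (fun a ha => prep_mem_Icc hT ha) ((hC c hc).1.comp measurable_fst)
    (fun z => abs_le.2 ((hC c hc).2 z.1)) (measurable_hyp_run hOm ω t)
    (fun x => convK_bounds (fun c hc => (hC c hc).2) hq x) (e := e) (fun θ hθ hd => ?_)
    (link_mono (O := O) (disc := disc) ω t) (fun a => grid_mem_Icc (hlink a))
    (fun a => by unfold link; rw [prep_prep hT]) hT).2
  · have e1 : (fun x => (1 / (T : ℝ)) * (⌊T * link O disc ω t (hyp O disc ω t x)⌋₊ : ℝ)) =
        pred O disc ω t := by
      funext x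
      obtain ⟨j, -, hj⟩ := hlink (hyp O disc ω t x)
      unfold pred
      rw [hj, mul_div_cancel₀ _ hT'.ne', Nat.floor_natCast]
      ring
    rwa [e1] at h
  · have hg : (fun x => thr θ (hyp O disc ω t x)) ∈ comp (thrClass T disc) (convK k C) :=
      ⟨thr θ, ⟨θ, hθ, hd, rfl⟩, _, hq, rfl⟩
    have h1 := hprod c hc _ hg
    have h2 := hprod _ (hneg c hc) _ hg
    simp only [Pi.neg_apply, neg_mul, integral_neg, Finset.sum_neg_distrib, mul_neg] at h2
    have e2 : pairing D (fun z => c z.1) (fun i => (lrnPt ω i).1)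
        (fun i => (1 / (T : ℝ)) * c (lrnPt ω i).1) (fun x => thr θ (hyp O disc ω t x)) =
        ∫ z, c z.1 * thr θ (hyp O disc ω t z.1) ∂D -
        (1 / (T : ℝ)) * ∑ i, c (lrnPt ω i).1 * thr θ (hyp O disc ω t (lrnPt ω i).1) := by
      unfold pairing
      rw [Finset.mul_sum]
      congr 1
      · exact integral_congr_ae (.of_forall fun z => mul_comm _ _)
      · exact Finset.sum_congr rfl fun i _ => by ring
    rw [e2]
    exact abs_le.2 ⟨by linarith, h1⟩

/-- Difference between population and learner's sample in the correlation of `f` with the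
residuals of round `t`. -/
def resGap (D : Measure (X × Bool)) (O : List (X × ℝ) → X → ℝ) (disc : Bool) (ω : Runs X T k)
    (t : Fin T) (f : X → ℝ) : ℝ :=
  pairing D (fun z => lab z.2 - pred O disc ω t z.1) (fun i => (lrnPt ω i).1)
    (fun i => (1 / (T : ℝ)) * (lab (lrnPt ω i).2 - pred O disc ω t (lrnPt ω i).1)) f

theorem resGap_eq (f : X → ℝ) (t : Fin T) : resGap D O disc ω t f =
    ∫ z, f z.1 * (lab z.2 - pred O disc ω t z.1) ∂D - (1 / (T : ℝ)) *
      ∑ i, f (lrnPt ω i).1 * (lab (lrnPt ω i).2 - pred O disc ω t (lrnPt ω i).1) := by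
  unfold resGap pairing
  rw [Finset.mul_sum]
  congr 1
  exact Finset.sum_congr rfl fun i _ => by ring

theorem abs_resGap_le (hT : 0 < T) (hk : 0 < k)
    (hC : ∀ c ∈ C, Measurable c ∧ ∀ x, c x ∈ Set.Icc (-1 : ℝ) 1) (hneg : ∀ c ∈ C, -c ∈ C)
    (hO : IsERMOracle C O) (hOm : MeasurableOracle O) {e e' : ℝ}
    (hprod : ∀ c ∈ C, ∀ g ∈ comp (thrClass T disc) (convK k C), ∫ z, c z.1 * g z.1 ∂D -
      (1 / (T : ℝ)) * ∑ i, c (lrnPt ω i).1 * g (lrnPt ω i).1 ≤ e)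
    (hlab : ∀ c ∈ C, ∫ z, c z.1 * lab z.2 ∂D -
      (1 / (T : ℝ)) * ∑ i, c (lrnPt ω i).1 * lab (lrnPt ω i).2 ≤ e') (t : Fin T) {c : X → ℝ}
    (hc : c ∈ C) : |resGap D O disc ω t c| ≤ e' + e := by
  have hcm := (hC c hc).1
  have hcb : ∀ x, |c x| ≤ 1 := fun x => abs_le.2 ((hC c hc).2 x)
  have h1 := abs_pairing_pred_le hT hk hC hneg hO hOm hprod t hc
  have h2 := hlab c hc
  have h3 := hlab _ (hneg c hc)
  simp only [Pi.neg_apply, neg_mul, integral_neg, Finset.sum_neg_distrib, mul_neg] at h3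
  have i1 : Integrable (fun z : X × Bool => c z.1 * lab z.2) D :=
    integrable_pairing (measurable_lab.comp measurable_snd) (W := 1)
      (fun z => by simpa using abs_lab_sub_le (a := 0) (by simp) z.2) hcm hcb
  have i2 : Integrable (fun z : X × Bool => pred O disc ω t z.1 * c z.1) D :=
    integrable_pairing (w := fun z : X × Bool => c z.1) (hcm.comp measurable_fst)
      (fun z => hcb z.1) (measurable_pred_run hOm ω t) (M := 1) fun x =>
        abs_le.2 ⟨by linarith [(pred_mem_Icc (O := O) (disc := disc) ω t x).1],
          (pred_mem_Icc ω t x).2⟩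
  have e1 : resGap D O disc ω t c = (∫ z, c z.1 * lab z.2 ∂D -
      (1 / (T : ℝ)) * ∑ i, c (lrnPt ω i).1 * lab (lrnPt ω i).2) -
      pairing D (fun z => c z.1) (fun i => (lrnPt ω i).1)
      (fun i => (1 / (T : ℝ)) * c (lrnPt ω i).1) (pred O disc ω t) := by
    have e2 : ∫ z, c z.1 * (lab z.2 - pred O disc ω t z.1) ∂D =
        ∫ z, c z.1 * lab z.2 ∂D - ∫ z, pred O disc ω t z.1 * c z.1 ∂D := by
      rw [← integral_sub i1 i2]
      exact integral_congr_ae (.of_forall fun z => by simp only; ring)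
    have e3 : (1 / (T : ℝ)) *
        ∑ i, c (lrnPt ω i).1 * (lab (lrnPt ω i).2 - pred O disc ω t (lrnPt ω i).1) =
        (1 / (T : ℝ)) * ∑ i, c (lrnPt ω i).1 * lab (lrnPt ω i).2 -
        ∑ i, (1 / (T : ℝ)) * c (lrnPt ω i).1 * pred O disc ω t (lrnPt ω i).1 := by
      rw [Finset.mul_sum, Finset.mul_sum, ← Finset.sum_sub_distrib]
      exact Finset.sum_congr rfl fun i _ => by ring
    rw [resGap_eq, e2, e3, pairing]
    ring
  rw [e1]
  rw [abs_le] at h1 ⊢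
  constructor <;> linarith [h1.1, h1.2]

theorem abs_resGap_convK_le (hOm : MeasurableOracle O)
    (hC : ∀ c ∈ C, Measurable c ∧ ∀ x, c x ∈ Set.Icc (-1 : ℝ) 1) {e : ℝ} {t : Fin T}
    (h : ∀ c ∈ C, |resGap D O disc ω t c| ≤ e) {q : X → ℝ} (hq : q ∈ convK k C) :
    |resGap D O disc ω t q| ≤ e := by
  obtain ⟨α, c, hα, hα1, hc, rfl⟩ := hq
  have hα' : ∀ i, α i ≤ 1 := fun i => by
    rw [← hα1]
    exact Finset.single_le_sum (fun j _ => hα j) (Finset.mem_univ i)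
  have e1 : resGap D O disc ω t (fun x => ∑ i, α i * c i x) =
      ∑ i, α i * resGap D O disc ω t (c i) := by
    unfold resGap
    rw [pairing_sum (measurable_residual (measurable_pred_run hOm ω t)) (abs_residual_le ω t)
      Finset.univ (φ := fun i x => α i * c i x) (fun i => (hC _ (hc i)).1.const_mul _) (M := 1)
      fun i x => by
        rw [abs_mul, abs_of_nonneg (hα i)]
        exact mul_le_one₀ (hα' i) (abs_nonneg _) (abs_le.2 ((hC _ (hc i)).2 x))]
    exact Finset.sum_congr rfl fun i _ => pairing_const_mul _ _
  rw [e1]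
  calc |∑ i, α i * resGap D O disc ω t (c i)| ≤ ∑ i, |α i * resGap D O disc ω t (c i)| :=
        Finset.abs_sum_le_sum_abs _ _
    _ ≤ ∑ i, α i * e := Finset.sum_le_sum fun i _ => by
        rw [abs_mul, abs_of_nonneg (hα i)]
        exact mul_le_mul_of_nonneg_left (h _ (hc i)) (hα i)
    _ = e := by rw [← Finset.sum_mul, hα1, one_mul]

/-- Regret of the calibrator. -/
theorem sum_roundPayoff_le (hT : 2 ≤ T) (hk : 0 < k)
    (hC : ∀ c ∈ C, Measurable c ∧ ∀ x, c x ∈ Set.Icc (-1 : ℝ) 1) (hO : IsERMOracle C O)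
    (i : Constr T) :
    ∑ t, roundPayoff O disc ω t i ≤
      ∑ t : Fin T, ∑ j, (stAt O disc ω t).w j * roundPayoff O disc ω t j +
      Real.sqrt (Real.log T / T) * T + Real.log (2 * T + 3) / Real.sqrt (Real.log T / T) := by
  have hT' : (0 : ℝ) < T := by exact_mod_cast (by omega : 0 < T)
  have hT1 : (1 : ℝ) < T := by exact_mod_cast hT
  set u : ℕ → Constr T → ℝ := fun n => if h : n < T then roundPayoff O disc ω ⟨n, h⟩ else 0
    with hu
  have hut : ∀ t : Fin T, u t = roundPayoff O disc ω t := fun t => by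
    simp only [hu, t.2, dif_pos]
  have h := expUpdate_regret (T := T) (η := Real.sqrt (Real.log T / T))
    (Real.sqrt_pos.2 (div_pos (Real.log_pos hT1) hT')) (by
      rw [Real.sqrt_le_one, div_le_one hT']
      exact (Real.log_le_sub_one_of_pos hT').trans (by linarith))
    (w := fun n => (stAt O disc ω n).w) (u := u) (N := T) (fun i => rfl)
    (fun n hn => by
      have := congrArg State.w (stAt_succ O disc ω ⟨n, hn⟩)
      simp only [hu, hn, dif_pos]
      exact this)
    (fun n hn i => by
      simp only [hu, hn, dif_pos]
      exact abs_payoff_le (abs_le.2 (prep_mem_Icc (by omega)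
        (abs_le.1 (convK_abs_le hC hO hk ω ⟨n, hn⟩ _)))) (abs_residual_le ω ⟨n, hn⟩ _) i) i
  rw [Finset.sum_range, Finset.sum_range] at h
  simpa only [hut] using h

/-- Regret of the learner on its sample. -/
theorem sum_residual_le_mix (hT : 0 < T)
    (hC : ∀ c ∈ C, Measurable c ∧ ∀ x, c x ∈ Set.Icc (-1 : ℝ) 1) (hO : IsERMOracle C O)
    {c : X → ℝ} (hc : c ∈ C) :
    ∑ t, ∑ i, c (lrnPt ω i).1 * (lab (lrnPt ω i).2 - pred O disc ω t (lrnPt ω i).1) ≤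
      ∑ t : Fin T, ∑ i, combo (mixList O disc ω t) (lrnPt ω i).1 *
        (lab (lrnPt ω i).2 - pred O disc ω t (lrnPt ω i).1) + 11 * (T * Real.sqrt T) := by
  have hT' : (0 : ℝ) < T := by exact_mod_cast hT
  have hs : 0 < Real.sqrt T := Real.sqrt_pos.2 hT'
  have hT1 : (1 : ℝ) ≤ Real.sqrt T := by
    rw [Real.one_le_sqrt]; exact_mod_cast hT
  have hfw : 16 * T ≤ fwIters T := by
    have : ((16 * T : ℕ) : ℝ) ≤ fwIters T := by
      refine le_trans ?_ (Nat.le_ceil _)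
      push_cast
      nlinarith
    exact_mod_cast this
  set r : ℕ → Fin T → ℝ := fun n => (stAt O disc ω (n + 1)).z - (stAt O disc ω n).z with hr
  have hrt : ∀ (t : Fin T) i, r t i = lab (lrnPt ω i).2 - pred O disc ω t (lrnPt ω i).1 :=
    fun t i => by
      have := congrFun (congrArg State.z (stAt_succ O disc ω t)) i
      simp only [hr, Pi.sub_apply, this]
      ring
  have hmin := fun n : ℕ => fwList_near_min (fun i => (lrnPt ω i).1) (stAt O disc ω n).z
    (1 / Real.sqrt T) (fun c hc => (hC c hc).2) hO (n := fwIters T) (by omega) hfw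
  have h := regularized_regret (Q := hullOn C fun i => (lrnPt ω i).1)
    (fun u hu i => hullOn_bounds (fun c hc => (hC c hc).2) hu i) (convex_convexHull _ _)
    (η := 1 / Real.sqrt T) (z := fun n => (stAt O disc ω n).z)
    (u := fun n i => combo (mixList O disc ω n) (lrnPt ω i).1) (r := r) (N := T) rfl
    (fun n _ => by simp only [hr]; abel)
    (fun n hn i => by rw [hrt ⟨n, hn⟩ i]; exact abs_residual_le ω ⟨n, hn⟩ _)
    (fun n _ => (hmin n).1) (fun n _ => (hmin n).2)
    (c := fun i => c (lrnPt ω i).1) (subset_convexHull _ _ ⟨c, hc, rfl⟩)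
  rw [Finset.sum_range, Finset.sum_range] at h
  simp only [hrt] at h
  rw [one_div, inv_mul_le_iff₀ hs] at h
  have e1 : (Real.sqrt T)⁻¹ ^ 2 * T = 1 := by
    rw [inv_pow, Real.sq_sqrt hT'.le, inv_mul_cancel₀ hT'.ne']
  have e2 : Real.sqrt T * (6 * T + T * (2 + 3 * (Real.sqrt T)⁻¹ ^ 2 * T)) =
      11 * (T * Real.sqrt T) := by
    rw [mul_assoc 3, e1]; ring
  rw [e2] at h
  linarith

theorem abs_resCorr_thr_le (hT : 0 < T) {a r : ℝ}
    (hdev : ∀ vs : Fin (T + 1) × Bool, ∑ t, (∫ z, sgn vs.2 * (thr (((vs.1 : ℕ) : ℝ) / T)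
      (pred O disc ω t z.1) * (lab z.2 - pred O disc ω t z.1)) ∂D - sgn vs.2 *
      (thr (((vs.1 : ℕ) : ℝ) / T) (pred O disc ω t (calPt ω t).1) *
        (lab (calPt ω t).2 - pred O disc ω t (calPt ω t).1))) ≤ a)
    (hreg : ∀ i, ∑ t, roundPayoff O disc ω t i ≤ r) {v : ℕ} (hv : v ≤ T) :
    |resCorr D (pred O disc ω) fun t x => thr ((v : ℝ) / T) (pred O disc ω t x)| ≤ (a + r) / T := by
  have hT' : (0 : ℝ) < T := by exact_mod_cast hT
  have key : ∀ s, sgn s * ∑ t, ∫ z, thr ((v : ℝ) / T) (pred O disc ω t z.1) *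
      (lab z.2 - pred O disc ω t z.1) ∂D ≤ a + r := by
    intro s
    have h1 := hdev (⟨v, by omega⟩, s)
    have h2 := hreg (some (⟨v, by omega⟩, s))
    simp only [Finset.sum_sub_distrib, integral_const_mul, ← Finset.mul_sum] at h1
    have e1 : ∑ t, roundPayoff O disc ω t (some (⟨v, by omega⟩, s)) =
        sgn s * ∑ t, thr ((v : ℝ) / T) (pred O disc ω t (calPt ω t).1) *
        (lab (calPt ω t).2 - pred O disc ω t (calPt ω t).1) := by
      rw [Finset.mul_sum]
      exact Finset.sum_congr rfl fun t _ => by simp only [roundPayoff, payoff]; ring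
    rw [e1] at h2
    linarith
  have k1 := key true
  have k2 := key false
  simp only [sgn_true, sgn_false] at k1 k2
  unfold resCorr
  rw [abs_mul, abs_of_pos (by positivity : (0 : ℝ) < 1 / T), one_div_mul_eq_div]
  gcongr
  exact abs_le.2 ⟨by linarith, by linarith⟩

theorem abs_resCorr_class_le (hT : 2 ≤ T) (hk : 0 < k)
    (hC : ∀ c ∈ C, Measurable c ∧ ∀ x, c x ∈ Set.Icc (-1 : ℝ) 1) (hneg : ∀ c ∈ C, -c ∈ C)
    (hO : IsERMOracle C O) (hOm : MeasurableOracle O) {a r d e : ℝ}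
    (hdev : ∑ t, (∫ z, hyp O disc ω t z.1 * (lab z.2 - pred O disc ω t z.1) ∂D -
      hyp O disc ω t (calPt ω t).1 * (lab (calPt ω t).2 - pred O disc ω t (calPt ω t).1)) ≤ a)
    (hreg : ∀ i, ∑ t, roundPayoff O disc ω t i ≤ r) (hdraw : ∑ t, drawError O disc ω t ≤ d)
    (hgap : ∀ t, ∀ c ∈ C, |resGap D O disc ω t c| ≤ e) {c : X → ℝ} (hc : c ∈ C) :
    |resCorr D (pred O disc ω) fun _ => c| ≤
      2 * e + (11 * Real.sqrt T + d + a + 1 + r) / T := by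
  have hT' : (0 : ℝ) < T := by exact_mod_cast (by omega : 0 < T)
  have key : ∀ c ∈ C, ∑ t, ∫ z, c z.1 * (lab z.2 - pred O disc ω t z.1) ∂D ≤
      T * (2 * e) + (11 * Real.sqrt T + d + a + 1 + r) := by
    intro c hc
    have h1 : ∑ t, ∫ z, c z.1 * (lab z.2 - pred O disc ω t z.1) ∂D ≤ ∑ t : Fin T, ((1 / (T : ℝ)) *
        ∑ i, c (lrnPt ω i).1 * (lab (lrnPt ω i).2 - pred O disc ω t (lrnPt ω i).1) + e) :=
      Finset.sum_le_sum fun t _ => by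
        have h := (abs_le.1 (hgap t c hc)).2
        rw [resGap_eq] at h
        linarith
    have h2 := mul_le_mul_of_nonneg_left (sum_residual_le_mix (ω := ω) (disc := disc)
      (by omega : 0 < T) hC hO hc) (by positivity : (0 : ℝ) ≤ 1 / T)
    have h3 : ∀ t : Fin T, (1 / (T : ℝ)) * ∑ i, combo (mixList O disc ω t) (lrnPt ω i).1 *
        (lab (lrnPt ω i).2 - pred O disc ω t (lrnPt ω i).1) ≤ (1 / (T : ℝ)) *
        ∑ i, hyp O disc ω t (lrnPt ω i).1 * (lab (lrnPt ω i).2 - pred O disc ω t (lrnPt ω i).1) +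
        drawError O disc ω t := by
      intro t
      unfold drawError
      rw [← mul_add, ← Finset.sum_add_distrib]
      refine mul_le_mul_of_nonneg_left (Finset.sum_le_sum fun i _ => ?_) (by positivity)
      have hr := abs_residual_le (O := O) (disc := disc) ω t (lrnPt ω i)
      have h := (neg_abs_le ((hyp O disc ω t (lrnPt ω i).1 -
        combo (mixList O disc ω t) (lrnPt ω i).1) *
        (lab (lrnPt ω i).2 - pred O disc ω t (lrnPt ω i).1)))
      rw [abs_mul] at h
      have h' := mul_le_of_le_one_right (abs_nonneg (hyp O disc ω t (lrnPt ω i).1 -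
        combo (mixList O disc ω t) (lrnPt ω i).1)) hr
      linarith
    have h4 : ∀ t : Fin T, (1 / (T : ℝ)) *
        ∑ i, hyp O disc ω t (lrnPt ω i).1 * (lab (lrnPt ω i).2 - pred O disc ω t (lrnPt ω i).1) ≤
        ∫ z, hyp O disc ω t z.1 * (lab z.2 - pred O disc ω t z.1) ∂D + e := by
      intro t
      have h := (abs_le.1 (abs_resGap_convK_le hOm hC (hgap t) (hyp_mem_convK (disc := disc) hk hO ω t))).1
      rw [resGap_eq] at h
      linarith
    have h34 := Finset.sum_le_sum fun t (_ : t ∈ Finset.univ) =>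
      (h3 t).trans (add_le_add_left (h4 t) _)
    have h5 : ∑ t, hyp O disc ω t (calPt ω t).1 *
        (lab (calPt ω t).2 - pred O disc ω t (calPt ω t).1) ≤
        ∑ t : Fin T, (roundPayoff O disc ω t none + 1 / T) := Finset.sum_le_sum fun t _ => by
      have hr := abs_residual_le (O := O) (disc := disc) ω t (calPt ω t)
      have hp := abs_prep_sub_le (disc := disc) (by omega : 0 < T) (hyp O disc ω t (calPt ω t).1)
      have h := neg_abs_le ((lab (calPt ω t).2 - pred O disc ω t (calPt ω t).1) *
        (prep T disc (hyp O disc ω t (calPt ω t).1) - hyp O disc ω t (calPt ω t).1))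
      rw [abs_mul] at h
      have h' := mul_le_mul hr hp (abs_nonneg _) zero_le_one
      simp only [roundPayoff, payoff]
      linarith
    have h6 := hreg none
    have hone : (T : ℝ) * (1 / T) = 1 := by field_simp
    have hsq : (1 / (T : ℝ)) * (11 * (T * Real.sqrt T)) = 11 * Real.sqrt T := by field_simp
    rw [mul_add, hsq] at h2
    simp only [Finset.sum_add_distrib, Finset.sum_sub_distrib, Finset.sum_const, Finset.card_univ,
      Fintype.card_fin, nsmul_eq_mul, hone, ← Finset.mul_sum] at h1 h34 h5 hdev
    linarith
  have k1 := key c hc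
  have k2 := key _ (hneg c hc)
  simp only [Pi.neg_apply, neg_mul, integral_neg, Finset.sum_neg_distrib] at k2
  unfold resCorr
  rw [abs_mul, abs_of_pos (by positivity : (0 : ℝ) < 1 / T), one_div, inv_mul_le_iff₀ hT', mul_add,
    mul_div_cancel₀ _ hT'.ne']
  exact abs_le.2 ⟨by linarith, by linarith⟩

end GoodRun

/-! ### Choice of parameters -/

section Parameters

variable {T : ℕ} {δ : ℝ}

theorem log_le_log_div (hT : 2 ≤ T) (hδ0 : 0 < δ) (hδ1 : δ < 1) :
    Real.log T ≤ Real.log (T / δ) := by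
  have hT' : (0 : ℝ) < T := by exact_mod_cast (by omega : 0 < T)
  refine Real.log_le_log hT' ?_
  rw [le_div_iff₀ hδ0]
  nlinarith

theorem log_div_gt (hT : 2 ≤ T) (hδ0 : 0 < δ) (hδ1 : δ < 1) : 0.69 ≤ Real.log (T / δ) := by
  have h1 := Real.log_two_gt_d9
  have h2 : Real.log 2 ≤ Real.log T := Real.log_le_log two_pos (by exact_mod_cast hT)
  have := log_le_log_div hT hδ0 hδ1
  norm_num at h1 ⊢
  linarith

theorem folds_pos (hT : 2 ≤ T) (hδ0 : 0 < δ) (hδ1 : δ < 1) : 0 < folds T δ := by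
  have hT' : (0 : ℝ) < T := by exact_mod_cast (by omega : 0 < T)
  have := log_div_gt hT hδ0 hδ1
  exact Nat.ceil_pos.2 (mul_pos hT' (by linarith))

theorem mul_sq_sqrt_log (hT : 2 ≤ T) (hδ0 : 0 < δ) (hδ1 : δ < 1) :
    (T : ℝ) * Real.sqrt (Real.log (T / δ) / T) ^ 2 = Real.log (T / δ) := by
  have hT' : (0 : ℝ) < T := by exact_mod_cast (by omega : 0 < T)
  have := log_div_gt hT hδ0 hδ1
  rw [Real.sq_sqrt (div_nonneg (by linarith) hT'.le), mul_div_cancel₀ _ hT'.ne']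

theorem exp_neg_four_mul_le (hT : 2 ≤ T) (hδ0 : 0 < δ) (hδ1 : δ < 1) {b : ℝ}
    (hb : 4 * Real.log (T / δ) ≤ b) : Real.exp (-b) ≤ δ / (6 * T) := by
  have hT' : (0 : ℝ) < T := by exact_mod_cast (by omega : 0 < T)
  have hT2 : (2 : ℝ) ≤ T := by exact_mod_cast hT
  have hpos : 0 < (T : ℝ) / δ := by positivity
  have hle : Real.exp (-b) ≤ (δ / T) ^ 4 := by
    have e1 : (δ / T) ^ 4 = Real.exp (-(4 * Real.log (T / δ))) := by
      rw [show -(4 * Real.log (T / δ)) = ((4 : ℕ) : ℝ) * -Real.log (T / δ) by push_cast; ring,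
        Real.exp_nat_mul, Real.exp_neg, Real.exp_log hpos, inv_div]
    rw [e1]
    exact Real.exp_le_exp.2 (by linarith)
  have hr : δ / T ≤ 1 / 2 := by
    rw [div_le_div_iff₀ hT' two_pos]; linarith
  have hr0 : 0 ≤ δ / T := by positivity
  have h3 : (δ / T) ^ 3 ≤ (1 / 2) ^ 3 := pow_le_pow_left₀ hr0 hr 3
  have e2 : δ / (6 * T) = δ / T * (1 / 6) := by field_simp
  rw [e2]
  calc Real.exp (-b) ≤ δ / T * (δ / T) ^ 3 := hle.trans_eq (by ring)
    _ ≤ δ / T * (1 / 6) := mul_le_mul_of_nonneg_left (h3.trans (by norm_num)) hr0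

theorem le_mul_sqrt_log (hT : 2 ≤ T) (hδ0 : 0 < δ) (hδ1 : δ < 1) {b : ℝ}
    (hb : b ^ 2 ≤ T * Real.log (T / δ)) : b ≤ T * Real.sqrt (Real.log (T / δ) / T) := by
  have hT' : (0 : ℝ) < T := by exact_mod_cast (by omega : 0 < T)
  refine abs_le_of_sq_le_sq' ?_ (by positivity) |>.2
  have := mul_sq_sqrt_log hT hδ0 hδ1
  rw [mul_pow, sq (T : ℝ), mul_assoc, this]
  exact hb

theorem one_le_mul_sqrt_log (hT : 2 ≤ T) (hδ0 : 0 < δ) (hδ1 : δ < 1) :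
    1 ≤ T * Real.sqrt (Real.log (T / δ) / T) := by
  have hT2 : (2 : ℝ) ≤ T := by exact_mod_cast hT
  have := log_div_gt hT hδ0 hδ1
  refine le_mul_sqrt_log hT hδ0 hδ1 ?_
  norm_num at this ⊢
  nlinarith

theorem sqrt_le_mul_sqrt_log (hT : 2 ≤ T) (hδ0 : 0 < δ) (hδ1 : δ < 1) :
    Real.sqrt T ≤ 2 * (T * Real.sqrt (Real.log (T / δ) / T)) := by
  have hT' : (0 : ℝ) < T := by exact_mod_cast (by omega : 0 < T)
  have h := log_div_gt hT hδ0 hδ1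
  have := le_mul_sqrt_log hT hδ0 hδ1 (b := Real.sqrt T / 2) (by
    rw [div_pow, Real.sq_sqrt hT'.le]
    norm_num at h ⊢
    nlinarith)
  linarith

theorem learning_rate_mul_le (hT : 2 ≤ T) (hδ0 : 0 < δ) (hδ1 : δ < 1) :
    Real.sqrt (Real.log T / T) * T ≤ T * Real.sqrt (Real.log (T / δ) / T) := by
  have := log_le_log_div hT hδ0 hδ1
  rw [mul_comm]
  gcongr

theorem log_div_learning_rate_le (hT : 2 ≤ T) (hδ0 : 0 < δ) (hδ1 : δ < 1) :
    Real.log (2 * T + 3) / Real.sqrt (Real.log T / T) ≤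
      3 * (T * Real.sqrt (Real.log (T / δ) / T)) := by
  have hT' : (0 : ℝ) < T := by exact_mod_cast (by omega : 0 < T)
  have hT2 : (2 : ℝ) ≤ T := by exact_mod_cast hT
  have hlog : 0 < Real.log T := Real.log_pos (by linarith)
  have hη : 0 < Real.sqrt (Real.log T / T) := Real.sqrt_pos.2 (div_pos hlog hT')
  have h1 : Real.log (2 * T + 3) ≤ 3 * Real.log T := by
    rw [show 3 * Real.log T = Real.log ((T : ℝ) ^ 3) by rw [Real.log_pow]; norm_num]
    exact Real.log_le_log (by positivity) (by nlinarith [mul_nonneg hT'.le (sub_nonneg.2 hT2)])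
  rw [div_le_iff₀ hη]
  have h2 := learning_rate_mul_le hT hδ0 hδ1
  have h3 : Real.sqrt (Real.log T / T) * T * Real.sqrt (Real.log T / T) = Real.log T := by
    rw [mul_right_comm, Real.mul_self_sqrt (div_nonneg hlog.le hT'.le), div_mul_cancel₀ _ hT'.ne']
  nlinarith [mul_le_mul_of_nonneg_right h2 hη.le]

theorem calls_le (hT : 2 ≤ T) :
    ((T * (fwIters T + 1) : ℕ) : ℝ) ≤ 18 * (T : ℝ) ^ (5 / 2 : ℝ) := by
  have hT' : (0 : ℝ) < T := by exact_mod_cast (by omega : 0 < T)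
  have hT2 : (2 : ℝ) ≤ T := by exact_mod_cast hT
  have hs : 1 ≤ Real.sqrt T := by rw [Real.one_le_sqrt]; linarith
  have h := (Nat.ceil_lt_add_one (by positivity : (0 : ℝ) ≤ 16 * ((T : ℝ) * Real.sqrt T))).le
  have hpow : (T : ℝ) ^ (5 / 2 : ℝ) = T * (T * Real.sqrt T) := by
    rw [show (5 / 2 : ℝ) = 1 + (1 + 1 / 2) by norm_num, Real.rpow_add hT', Real.rpow_add hT',
      Real.rpow_one, ← Real.sqrt_eq_rpow]
  rw [hpow]
  push_cast
  unfold fwIters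
  have h2 : 2 ≤ (T : ℝ) * Real.sqrt T := by nlinarith
  calc (T : ℝ) * ((⌈16 * ((T : ℝ) * Real.sqrt T)⌉₊ : ℝ) + 1)
      ≤ T * (18 * (T * Real.sqrt T)) := mul_le_mul_of_nonneg_left (by linarith) hT'.le
    _ = 18 * (T * (T * Real.sqrt T)) := by ring

end Parameters

/-! ### The guarantees with high probability -/

section HighProbability

variable {X : Type*} [MeasurableSpace X] {T : ℕ} {δ : ℝ} {O : List (X × ℝ) → X → ℝ} {disc : Bool}
  {D : Measure (X × Bool)} [IsProbabilityMeasure D] {C : Set (X → ℝ)}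

theorem comp_thrClass_sign {k : ℕ} : ∀ g ∈ comp (thrClass T disc) (convK k C), ∀ x,
    g x = 1 ∨ g x = -1 := by
  rintro _ ⟨_, ⟨θ, -, -, rfl⟩, q, -, rfl⟩ x
  simp only [thr]
  split_ifs <;> simp

theorem comp_thrClass_measurable {k : ℕ} (hC : ∀ c ∈ C, Measurable c) :
    ∀ g ∈ comp (thrClass T disc) (convK k C), Measurable g := by
  rintro _ ⟨_, ⟨θ, -, -, rfl⟩, _, ⟨α, c, -, -, hc, rfl⟩, rfl⟩
  exact (measurable_thr θ).comp (Finset.measurable_sum _ fun i _ => (hC _ (hc i)).const_mul _)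

theorem comp_thrClass_nonempty {k : ℕ} (hT : 0 < T) (hk : 0 < k) (hC : C.Nonempty) :
    (comp (thrClass T disc) (convK k C)).Nonempty := by
  obtain ⟨c, hc⟩ := hC
  have hT' : (T : ℝ) ≠ 0 := by positivity
  have hk' : (k : ℝ) ≠ 0 := by positivity
  exact ⟨_, thr 1, ⟨1, by simp, fun _ => ⟨T, by push_cast; rw [div_self hT']⟩, rfl⟩, _,
    ⟨fun _ => 1 / k, fun _ => c, fun _ => by positivity, by
      simp only [Finset.sum_const, Finset.card_univ, Fintype.card_fin, nsmul_eq_mul]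
      field_simp, fun _ => hc, rfl⟩, rfl⟩

theorem measure_bad_run_le (hT : 2 ≤ T) (hδ0 : 0 < δ) (hδ1 : δ < 1)
    (hC : ∀ c ∈ C, Measurable c ∧ ∀ x, c x ∈ Set.Icc (-1 : ℝ) 1) (hneg : ∀ c ∈ C, -c ∈ C)
    (hO : IsERMOracle C O) (hOm : MeasurableOracle O)
    (hsup : SupMeasurable (comp (thrClass T disc) (convK (folds T δ) C))) :
    law D T (folds T δ) {ω | ¬ ((∀ v ≤ T, |resCorr D (pred O disc ω) fun t x =>
      thr ((v : ℝ) / T) (pred O disc ω t x)| ≤ 17 * Real.sqrt (Real.log (T / δ) / T)) ∧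
      ∀ c ∈ C, |resCorr D (pred O disc ω) fun _ => c| ≤ 8 * rad T (D.map Prod.fst) C +
        4 * rad T (D.map Prod.fst) (comp (thrClass T disc) (convK (folds T δ) C)) +
        71 * Real.sqrt (Real.log (T / δ) / T))} ≤ ENNReal.ofReal δ := by
  have hT0 : 0 < T := by omega
  have hT' : (0 : ℝ) < T := by exact_mod_cast hT0
  have hT2 : (2 : ℝ) ≤ T := by exact_mod_cast hT
  have hL := log_div_gt hT hδ0 hδ1
  norm_num at hL
  set k := folds T δ with hk_def
  have hk : 0 < k := folds_pos hT hδ0 hδ1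
  set F := comp (thrClass T disc) (convK k C) with hF_def
  set ρ := Real.sqrt (Real.log (T / δ) / T) with hρ
  have hρ0 : 0 ≤ ρ := Real.sqrt_nonneg _
  have hρL : (T : ℝ) * ρ ^ 2 = Real.log (T / δ) := mul_sq_sqrt_log hT hδ0 hδ1
  set a : ℝ := 6 * (T * ρ) with ha_def
  have ha : 0 ≤ a := by positivity
  have ha2 : a ^ 2 = 36 * (T * Real.log (T / δ)) := by rw [ha_def, ← hρL]; ring
  set b : ENNReal := ENNReal.ofReal (δ / (6 * T)) with hb_def
  have hr : ∀ (ω : Runs X T k) t (z : X × Bool), |lab z.2 - pred O disc ω t z.1| ≤ 1 := fun ω t z =>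
    abs_residual_le ω t z
  have hres : ∀ t, Measurable fun p : Runs X T k × (X × Bool) =>
      lab p.2.2 - pred O disc p.1 t p.2.1 := fun t =>
    (measurable_lab.comp (measurable_snd.comp measurable_snd)).sub ((measurable_pred hOm t).comp
      (measurable_fst.prodMk (measurable_fst.comp measurable_snd)))
  set A1 : Fin (T + 1) × Bool → Set (Runs X T k) := fun vs => {ω | a ≤ ∑ t, (∫ z, sgn vs.2 *
    (thr (((vs.1 : ℕ) : ℝ) / T) (pred O disc ω t z.1) * (lab z.2 - pred O disc ω t z.1)) ∂D -
    sgn vs.2 * (thr (((vs.1 : ℕ) : ℝ) / T) (pred O disc ω t (calPt ω t).1) *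
      (lab (calPt ω t).2 - pred O disc ω t (calPt ω t).1)))} with hA1
  have hA1le : ∀ vs, law D T k (A1 vs) ≤ b := fun vs => by
    refine (measure_test_deviation_le (D := D) hT0 (g := fun t (ω : Runs X T k) z => sgn vs.2 *
      (thr (((vs.1 : ℕ) : ℝ) / T) (pred O disc ω t z.1) * (lab z.2 - pred O disc ω t z.1)))
      (fun t => ?_) (fun t ω z => ?_) (fun t ω ω' h h1 h2 => ?_) ha).trans
      (ENNReal.ofReal_le_ofReal (exp_neg_four_mul_le hT hδ0 hδ1 ?_))
    · exact (((measurable_thr _).comp ((measurable_pred hOm t).comp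
        (measurable_fst.prodMk (measurable_fst.comp measurable_snd)))).mul (hres t)).const_mul _
    · rw [abs_mul, abs_sgn, one_mul, abs_mul, abs_thr, one_mul]
      exact hr ω t z
    · rw [pred_congr O disc h h1 h2]
    · rw [ha2, le_div_iff₀ (by positivity)]
      nlinarith
  set A2 : Set (Runs X T k) := {ω | a ≤ ∑ t, (∫ z, hyp O disc ω t z.1 *
    (lab z.2 - pred O disc ω t z.1) ∂D - hyp O disc ω t (calPt ω t).1 *
    (lab (calPt ω t).2 - pred O disc ω t (calPt ω t).1))} with hA2
  have hA2le : law D T k A2 ≤ b := by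
    refine (measure_test_deviation_le (D := D) hT0 (g := fun t (ω : Runs X T k) z =>
      hyp O disc ω t z.1 * (lab z.2 - pred O disc ω t z.1))
      (fun t => ?_) (fun t ω z => ?_) (fun t ω ω' h h1 h2 => ?_) ha).trans
      (ENNReal.ofReal_le_ofReal (exp_neg_four_mul_le hT hδ0 hδ1 ?_))
    · exact ((measurable_hyp hOm t).comp
        (measurable_fst.prodMk (measurable_fst.comp measurable_snd))).mul (hres t)
    · rw [abs_mul]
      exact mul_le_one₀ (convK_abs_le hC hO hk ω t _) (abs_nonneg _) (hr ω t z)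
    · rw [pred_congr O disc h h1 h2, hyp_congr O disc h h2]
    · rw [ha2, le_div_iff₀ (by positivity)]
      nlinarith
  set A3 : Set (Runs X T k) :=
    {ω | 1 + a ≤ ∑ t : Fin T, ∑ i, (stAt O disc ω t).w i * roundPayoff O disc ω t i} with hA3
  have hA3le : law D T k A3 ≤ b := by
    refine (measure_mixed_payoff_le hT0 hk hC hO hOm ha).trans
      (ENNReal.ofReal_le_ofReal (exp_neg_four_mul_le hT hδ0 hδ1 ?_))
    rw [ha2, le_div_iff₀ (by positivity)]
    nlinarith
  set A4 : Set (Runs X T k) := {ω | 7 * (T * ρ) ≤ ∑ t, drawError O disc ω t} with hA4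
  have hA4le : law D T k A4 ≤ b := by
    refine (measure_drawError_le hT0 hk hC hO hOm _).trans (ENNReal.ofReal_le_ofReal ?_)
    rw [← neg_sub]
    refine exp_neg_four_mul_le hT hδ0 hδ1 ?_
    have hkT : T * ρ ≤ Real.sqrt k := by
      refine Real.le_sqrt_of_sq_le ?_
      rw [mul_pow, sq (T : ℝ), mul_assoc, hρL]
      exact Nat.le_ceil _
    have h1 : T * ρ * (7 * (T * ρ)) ≤ Real.sqrt k * (7 * (T * ρ)) :=
      mul_le_mul_of_nonneg_right hkT (by positivity)
    have h2 : T * ρ * (7 * (T * ρ)) = 7 * (T * Real.log (T / δ)) := by rw [← hρL]; ring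
    nlinarith
  have hFm := comp_thrClass_measurable (T := T) (disc := disc) (k := k) fun c hc => (hC c hc).1
  have hF0 := comp_thrClass_nonempty (disc := disc) hT0 hk ⟨_, (hO []).1⟩
  have hunif : 4 * Real.log (T / δ) ≤ T * (6 * ρ) ^ 2 / 8 := by
    have : (T : ℝ) * (6 * ρ) ^ 2 / 8 = 36 / 8 * (T * ρ ^ 2) := by ring
    rw [this, hρL]
    linarith
  set A5 : Set (Runs X T k) := {ω | ¬ ∀ c ∈ C, ∀ g ∈ F, ∫ z, c z.1 * g z.1 ∂D -
    (1 / (T : ℝ)) * ∑ i, c (lrnPt ω i).1 * g (lrnPt ω i).1 ≤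
    2 * (rad T (D.map Prod.fst) C + rad T (D.map Prod.fst) F) + 6 * ρ} with hA5
  have hA5le : law D T k A5 ≤ b :=
    (measure_uniform_prod_le hT0 hC hO hOm comp_thrClass_sign hFm hF0 hsup (by positivity)).trans
      (ENNReal.ofReal_le_ofReal (exp_neg_four_mul_le hT hδ0 hδ1 hunif))
  set A6 : Set (Runs X T k) := {ω | ¬ ∀ c ∈ C, ∫ z, c z.1 * lab z.2 ∂D -
    (1 / (T : ℝ)) * ∑ i, c (lrnPt ω i).1 * lab (lrnPt ω i).2 ≤
    2 * rad T (D.map Prod.fst) C + 6 * ρ} with hA6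
  have hA6le : law D T k A6 ≤ b :=
    (measure_uniform_lab_le hT0 hC hO hOm (by positivity)).trans
      (ENNReal.ofReal_le_ofReal (exp_neg_four_mul_le hT hδ0 hδ1 hunif))
  have hunion : law D T k ((⋃ vs, A1 vs) ∪ A2 ∪ A3 ∪ A4 ∪ A5 ∪ A6) ≤ ENNReal.ofReal δ := by
    have h1 : law D T k (⋃ vs, A1 vs) ≤ (2 * (T + 1) : ℕ) * b := by
      refine (measure_iUnion_fintype_le _ _).trans
        ((Finset.sum_le_sum fun vs _ => hA1le vs).trans_eq ?_)
      simp only [Finset.sum_const, Finset.card_univ, Fintype.card_prod, Fintype.card_fin,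
        Fintype.card_bool, nsmul_eq_mul]
      rw [mul_comm (T + 1) 2]
    calc law D T k ((⋃ vs, A1 vs) ∪ A2 ∪ A3 ∪ A4 ∪ A5 ∪ A6)
        ≤ (2 * (T + 1) : ℕ) * b + b + b + b + b + b := by
          refine (measure_union_le _ _).trans (add_le_add ?_ hA6le)
          refine (measure_union_le _ _).trans (add_le_add ?_ hA5le)
          refine (measure_union_le _ _).trans (add_le_add ?_ hA4le)
          refine (measure_union_le _ _).trans (add_le_add ?_ hA3le)
          exact (measure_union_le _ _).trans (add_le_add h1 hA2le)
      _ = ((2 * (T + 1) + 5 : ℕ) : ENNReal) * b := by push_cast; ring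
      _ ≤ ((6 * T : ℕ) : ENNReal) * b := by
          gcongr
          omega
      _ = ENNReal.ofReal δ := by
          rw [hb_def, ← ENNReal.ofReal_natCast, ← ENNReal.ofReal_mul (by positivity)]
          congr 1
          push_cast
          field_simp
  refine (measure_mono fun ω hω => ?_).trans hunion
  by_contra hout
  simp only [Set.mem_union, Set.mem_iUnion, not_or, not_exists] at hout
  obtain ⟨⟨⟨⟨⟨n1, n2⟩, n3⟩, n4⟩, n5⟩, n6⟩ := hout
  simp only [hA1, hA2, hA3, hA4, hA5, hA6, Set.mem_ofPred_eq, not_le, not_not] at n1 n2 n3 n4 n5 n6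
  refine hω ?_
  have hone : 1 ≤ T * ρ := one_le_mul_sqrt_log hT hδ0 hδ1
  have hsq : Real.sqrt T ≤ 2 * (T * ρ) := sqrt_le_mul_sqrt_log hT hδ0 hδ1
  have hη1 : Real.sqrt (Real.log T / T) * T ≤ T * ρ := learning_rate_mul_le hT hδ0 hδ1
  have hη2 : Real.log (2 * T + 3) / Real.sqrt (Real.log T / T) ≤ 3 * (T * ρ) :=
    log_div_learning_rate_le hT hδ0 hδ1
  have hreg : ∀ i, ∑ t, roundPayoff O disc ω t i ≤ 11 * (T * ρ) := fun i => by
    have := sum_roundPayoff_le (ω := ω) (disc := disc) hT hk hC hO i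
    linarith
  have hgap := fun t c (hc : c ∈ C) => abs_resGap_le hT0 hk hC hneg hO hOm n5 n6 t hc
  refine ⟨fun v hv => ?_, fun c hc => ?_⟩
  · refine (abs_resCorr_thr_le hT0 (fun vs => (n1 vs).le) hreg hv).trans ?_
    rw [div_le_iff₀ hT']
    linarith
  · refine (abs_resCorr_class_le hT hk hC hneg hO hOm n2.le hreg n4.le hgap hc).trans ?_
    have : (11 * Real.sqrt T + 7 * (T * ρ) + a + 1 + 11 * (T * ρ)) / T ≤ 47 * ρ := by
      rw [div_le_iff₀ hT']
      linarith
    linarith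

end HighProbability

end Omni

end

theorem mainTheorem3 :
    ∃ K : ℝ, 0 < K ∧
      ∀ (X : Type*) [MeasurableSpace X] (D : MeasureTheory.Measure (X × Bool))
        [MeasureTheory.IsProbabilityMeasure D]
        (C : Set (X → ℝ)) (O : List (X × ℝ) → X → ℝ) (T : ℕ) (δ : ℝ) (disc : Bool),
        2 ≤ T → 0 < δ → δ < 1 →
        (∀ c ∈ C, Measurable c ∧ ∀ x, c x ∈ Set.Icc (-1 : ℝ) 1) →
        (∀ c ∈ C, -c ∈ C) →
        Omni.IsERMOracle C O → Omni.MeasurableOracle O →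
        Omni.SupMeasurable
          (Omni.comp (Omni.thrClass T disc) (Omni.convK (Omni.folds T δ) C)) →
        -- representation of the output and number of oracle calls, on every run
        (∀ (S : Fin (T + T) → X × Bool) (r : Omni.Seeds T (Omni.folds T δ)),
          (((Omni.algorithm disc S r).calls O : ℕ) : ℝ) ≤ K * (T : ℝ) ^ (5 / 2 : ℝ) ∧
          ∀ t : Fin T,
            MonotoneOn (((Omni.algorithm disc S r).run O).out t).v (Set.Icc (-1) 1) ∧
            (∀ a ∈ Set.Icc (-1 : ℝ) 1, ∃ j : ℕ, j ≤ T ∧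
              (((Omni.algorithm disc S r).run O).out t).v a = (j : ℝ) / T) ∧
            (((Omni.algorithm disc S r).run O).out t).q ∈ Omni.convK (Omni.folds T δ) C) ∧
        -- error bounds, with probability at least `1 - δ`
        Omni.law D T (Omni.folds T δ)
          {ω | ¬ (let p : Fin T → X → ℝ :=
                    fun t => (((Omni.algorithm disc ω.1 ω.2).run O).out t).eval
                  let ε : ℝ := K * (Omni.rad T (D.map Prod.fst) C +
                    Omni.rad T (D.map Prod.fst)
                      (Omni.comp (Omni.thrClass T disc) (Omni.convK (Omni.folds T δ) C))) +
                    K * Real.sqrt (Real.log (T / δ) / T)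
                  Omni.pcalErr D p ≤ K * Real.sqrt (Real.log (T / δ) / T) ∧
                  Omni.maErr D C p ≤ ε ∧
                  ∀ H : Set (X → ℝ), (∀ h ∈ H, ∀ x, h x ∈ Set.Icc (0 : ℝ) 1) →
                    C = Omni.signedThr H →
                    Omni.IsOmnipredictor D (1 / (T : ℝ) ^ 2) Omni.bvLosses H ε p)}
          ≤ ENNReal.ofReal δ := by
  refine ⟨1000, by norm_num, ?_⟩
  intro X _ D _ C O T δ disc hT hδ0 hδ1 hC hneg hO hOm hsup
  have hT0 : 0 < T := by omega
  have hT' : (0 : ℝ) < T := by exact_mod_cast hT0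
  have hk := Omni.folds_pos hT hδ0 hδ1
  refine ⟨fun S r => ⟨?_, fun t => ?_⟩, ?_⟩
  · rw [Omni.algorithm_calls O disc (S, r)]
    refine (Omni.calls_le hT).trans ?_
    gcongr
    norm_num
  · have h := Omni.stAt_out O disc (S, r) t
    rw [← Omni.algorithm_run O disc (S, r)] at h
    rw [h]
    exact ⟨(Omni.link_mono (O := O) (disc := disc) (S, r) t).monotoneOn _,
      fun a _ => Omni.remap_mem_grid _ _ _ _, Omni.hyp_mem_convK hk hO (S, r) t⟩
  · refine le_trans (MeasureTheory.measure_mono ?_)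
      (Omni.measure_bad_run_le (D := D) hT hδ0 hδ1 hC hneg hO hOm hsup)
    intro ω hω hgood
    refine hω ?_
    obtain ⟨hM, he⟩ := hgood
    have hp : (fun t => (((Omni.algorithm disc ω.1 ω.2).run O).out t).eval) =
        Omni.pred O disc ω := by
      funext t
      rw [Omni.algorithm_run O disc ω, Omni.stAt_out]
      rfl
    rw [hp]
    have hC' : ∀ c ∈ C, ∀ x, |c x| ≤ 1 := fun c hc x => abs_le.2 ((hC c hc).2 x)
    have hr1 := Omni.rad_nonneg (T := T) (D.map Prod.fst) ⟨_, (hO []).1⟩ hC'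
    have hr2 := Omni.rad_nonneg (T := T) (D.map Prod.fst)
      (Omni.comp_thrClass_nonempty (T := T) (disc := disc) hT0 hk ⟨_, (hO []).1⟩) fun g hg x => by
        rcases Omni.comp_thrClass_sign g hg x with h | h <;> simp [h]
    have hone := Omni.one_le_mul_sqrt_log hT hδ0 hδ1
    have hpm := fun t => Omni.measurable_pred_run (disc := disc) hOm ω t
    have hgrid := fun t x => Omni.pred_mem_grid (O := O) (disc := disc) ω t x
    have hρ := Real.sqrt_nonneg (Real.log (T / δ) / T)
    refine ⟨(Omni.pcalErr_le hT0 hpm hgrid hM).trans (by linarith),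
      Real.iSup_le (fun c => (he c.1 c.2).trans (by linarith)) (by positivity), fun H hH hCH => ?_⟩
    have hthr : ∀ h ∈ H, ∀ θ ∈ Set.Icc (0 : ℝ) 1, (fun x => Omni.thr θ (h x)) ∈ C := by
      intro h hh θ hθ
      rw [hCH]
      exact ⟨h, hh, θ, hθ, true, by simp [Omni.sgn]⟩
    refine Omni.isOmnipredictor_of_bounds hT0 hpm hgrid hM hH
      (fun h hh θ hθ => (hC _ (hthr h hh θ hθ)).1) (fun h hh θ hθ => he _ (hthr h hh θ hθ)) ?_
    have h1 : 1 / (T : ℝ) ≤ Real.sqrt (Real.log (T / δ) / T) := by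
      rw [div_le_iff₀ hT']; linarith
    have h2 : 1 / (T : ℝ) ^ 2 ≤ 1 / T :=
      one_div_le_one_div_of_le hT' (le_self_pow₀ (by exact_mod_cast hT0) two_ne_zero)
    have h3 : (8 : ℝ) / T = 8 * (1 / T) := by ring
    rw [h3]
    linarith
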